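/- Let $\Omega\subset\mathbb R^2$ be a bounded polygon (an open connected set) with Lipschitz boundary, let $k>0$, and let $n=n_1+i\,n_2/k$, where $n_1>0$ and $n_2\ge 0$ are bounded smooth real functions on $\Omega$. For $u,v\in H^1(\Omega)$ (complex valued) put $$a(u,v)=\int_\Omega \nabla u\cdot\overline{\nabla v}\,dx-k^2\int_\Omega n\,u\,\overline v\,dx,\qquad (u,v)=\int_\Omega u\,\overline v\,dx,\qquad \langle f,g\rangle=\int_{\partial\Omega} f\,\overline g\,ds .$$ Assume that * $k^2$ is not a Neumann eigenvalue associated with $n$, i.e. the only $u\in H^1(\Omega)$ with $a(u,v)=0$ for all $v\in H^1(\Omega)$ is $u=0$; * the adjoint problem has $H^2$ regularity: whenever $f\in L^2(\Omega)$ and $w\in H^1(\Omega)$ satisfy $a(v,w)=(v,f)$ for all $v\in H^1(\Omega)$, then $w\in H^2(\Omega)$. Fix a polynomial degree $p\ge 1$ and a shape-regularity constant $\sigma$. For a conforming triangulation $\mathcal T_h$ of $\Omega$ with mesh size $h$ (the largest diameter of a triangle) in which every triangle $K$ contains a disc of some radius $r>0$ with $\operatorname{diam}K\le\sigma r$, let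 $V_h\subset H^1(\Omega)$ be the Lagrange finite element space of degree $p$ (complex-valued functions, continuous on $\overline\Omega$ and polynomial of degree at most $p$ on each triangle), and let $V_h^B=V_h|_{\partial\Omega}$. For $g\in L^2(\partial\Omega)$ let $g_h$ be the $L^2(\partial\Omega)$-orthogonal projection of $g$ onto $V_h^B$. The source problem is to find $u\in H^1(\Omega)$ with $a(u,v)=\langle g,v\rangle$ for all $v\in H^1(\Omega)$ (with $v$ on $\partial\Omega$ understood as the trace), and the discrete source problem is to find $u_h\in V_h$ with $a(u_h,v_h)=\langle g_h,v_h\rangle$ for all $v_h\in V_h$. Then there are constants $h_0>0$ and $C>0$, depending only on $\Omega,k,n,p,\sigma$, such that for every such triangulation with $h\le h_0$ and every $g\in L^2(\partial\Omega)$ the discrete source problem has a unique solution $u_h$, and, if $u$ is the solution of the source problem, $$\|u-u_h\|_{H^1(\Omega)}\le C\inf_{v\in V_h}\|u-v\|_{H^1(\Omega)},\qquad \|u-u_h\|_{L^2(\Omega)}\le C\,h\,\|u-u_h\|_{H^1(\Omega)} .$$ -/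

import Mathlib

open MeasureTheory Set Filter Topology
open scoped ContDiff NNReal

noncomputable section

namespace Steklov

/-- The Euclidean plane. -/
abbrev Plane : Type := EuclideanSpace ℝ (Fin 2)

/-! ### Polygonal Lipschitz domains -/

/-- Near each boundary point, `Ω` is, after a linear isometry of the plane, the part of a
neighbourhood lying strictly above the graph of a Lipschitz function. -/
def HasLipschitzBoundary (Ω : Set Plane) : Prop :=
  ∀ x ∈ frontier Ω, ∃ (e : Plane ≃ₗᵢ[ℝ] Plane) (r : ℝ) (K : ℝ≥0) (φ : ℝ → ℝ),
    0 < r ∧ LipschitzWith K φ ∧ ∀ y ∈ Metric.ball x r, (y ∈ Ω ↔ φ (e y 0) < e y 1)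

/-- A bounded polygon (as an open connected set) with Lipschitz boundary. -/
structure IsLipschitzPolygon (Ω : Set Plane) : Prop where
  isOpen : IsOpen Ω
  isConnected : IsConnected Ω
  isBounded : Bornology.IsBounded Ω
  frontier_eq : ∃ S : Finset (Plane × Plane), frontier Ω = ⋃ s ∈ S, segment ℝ s.1 s.2
  lipschitz : HasLipschitzBoundary Ω

/-! ### Lebesgue and Sobolev spaces -/

/-- `L²(Ω)`, complex valued. -/
abbrev L2 (Ω : Set Plane) : Type := Lp ℂ 2 ((volume : Measure Plane).restrict Ω)

/-- Arc length on `∂Ω`: the one-dimensional Hausdorff measure. -/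
abbrev boundaryMeasure (Ω : Set Plane) : Measure Plane :=
  (Measure.hausdorffMeasure 1 : Measure Plane).restrict (frontier Ω)

/-- `L²(∂Ω)`, complex valued. -/
abbrev L2Boundary (Ω : Set Plane) : Type := Lp ℂ 2 (boundaryMeasure Ω)

/-- `φ` is a test function: smooth with compact support contained in `Ω`. -/
structure IsTestFunction (Ω : Set Plane) (φ : Plane → ℝ) : Prop where
  contDiff : ContDiff ℝ ∞ φ
  hasCompactSupport : HasCompactSupport φ
  tsupport_subset : tsupport φ ⊆ Ω

/-- The classical partial derivative `∂φ/∂xᵢ`. -/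
def partialDeriv (i : Fin 2) (φ : Plane → ℝ) (x : Plane) : ℝ :=
  fderiv ℝ φ x (EuclideanSpace.single i 1)

/-- `d` is the weak partial derivative `∂f/∂xᵢ` of `f` in `Ω`. -/
def IsWeakPartial (Ω : Set Plane) (i : Fin 2) (f d : L2 Ω) : Prop :=
  ∀ φ : Plane → ℝ, IsTestFunction Ω φ →
    ∫ x in Ω, partialDeriv i φ x • f x = - ∫ x in Ω, φ x • d x

theorem integrable_smul_L2 {Ω : Set Plane} {ψ : Plane → ℝ} (hc : Continuous ψ)
    (hs : HasCompactSupport ψ) (f : L2 Ω) :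
    Integrable (fun x => ψ x • f x) ((volume : Measure Plane).restrict Ω) := by
  have h1 : MemLp ψ 2 ((volume : Measure Plane).restrict Ω) :=
    hc.memLp_of_hasCompactSupport hs
  exact memLp_one_iff_integrable.1 ((Lp.memLp f).smul h1)

theorem IsTestFunction.integrable_smul {Ω : Set Plane} {φ : Plane → ℝ}
    (h : IsTestFunction Ω φ) (f : L2 Ω) :
    Integrable (fun x => φ x • f x) ((volume : Measure Plane).restrict Ω) :=
  integrable_smul_L2 h.contDiff.continuous h.hasCompactSupport f

theorem IsTestFunction.integrable_partialDeriv_smul {Ω : Set Plane} {φ : Plane → ℝ}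
    (h : IsTestFunction Ω φ) (i : Fin 2) (f : L2 Ω) :
    Integrable (fun x => partialDeriv i φ x • f x) ((volume : Measure Plane).restrict Ω) := by
  refine integrable_smul_L2 ?_ ?_ f
  · exact (h.contDiff.continuous_fderiv (by simp)).clm_apply continuous_const
  · exact h.hasCompactSupport.fderiv_apply (𝕜 := ℝ) _

theorem IsWeakPartial.zero (Ω : Set Plane) (i : Fin 2) : IsWeakPartial Ω i 0 0 := by
  intro φ _
  have h := Lp.coeFn_zero ℂ 2 ((volume : Measure Plane).restrict Ω)
  have h1 : ∫ x in Ω, partialDeriv i φ x • (0 : L2 Ω) x = 0 :=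
    integral_eq_zero_of_ae (by filter_upwards [h] with x hx; rw [hx, Pi.zero_apply, smul_zero])
  have h2 : ∫ x in Ω, φ x • (0 : L2 Ω) x = 0 :=
    integral_eq_zero_of_ae (by filter_upwards [h] with x hx; rw [hx, Pi.zero_apply, smul_zero])
  rw [h1, h2, neg_zero]

theorem IsWeakPartial.add {Ω : Set Plane} {i : Fin 2} {f g d e : L2 Ω}
    (hf : IsWeakPartial Ω i f d) (hg : IsWeakPartial Ω i g e) :
    IsWeakPartial Ω i (f + g) (d + e) := by
  intro φ hφ
  have h1 : ∫ x in Ω, partialDeriv i φ x • (f + g) x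
      = (∫ x in Ω, partialDeriv i φ x • f x) + ∫ x in Ω, partialDeriv i φ x • g x := by
    rw [← integral_add (hφ.integrable_partialDeriv_smul i f)
      (hφ.integrable_partialDeriv_smul i g)]
    refine integral_congr_ae ?_
    filter_upwards [Lp.coeFn_add f g] with x hx
    rw [hx, Pi.add_apply, smul_add]
  have h2 : ∫ x in Ω, φ x • (d + e) x
      = (∫ x in Ω, φ x • d x) + ∫ x in Ω, φ x • e x := by
    rw [← integral_add (hφ.integrable_smul d) (hφ.integrable_smul e)]
    refine integral_congr_ae ?_
    filter_upwards [Lp.coeFn_add d e] with x hx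
    rw [hx, Pi.add_apply, smul_add]
  rw [h1, h2, hf φ hφ, hg φ hφ, neg_add]

theorem IsWeakPartial.smul {Ω : Set Plane} {i : Fin 2} {f d : L2 Ω} (c : ℂ)
    (hf : IsWeakPartial Ω i f d) : IsWeakPartial Ω i (c • f) (c • d) := by
  intro φ hφ
  have h1 : ∫ x in Ω, partialDeriv i φ x • (c • f) x
      = c • ∫ x in Ω, partialDeriv i φ x • f x := by
    rw [← integral_smul]
    refine integral_congr_ae ?_
    filter_upwards [Lp.coeFn_smul c f] with x hx
    rw [hx, Pi.smul_apply, smul_comm]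
  have h2 : ∫ x in Ω, φ x • (c • d) x = c • ∫ x in Ω, φ x • d x := by
    rw [← integral_smul]
    refine integral_congr_ae ?_
    filter_upwards [Lp.coeFn_smul c d] with x hx
    rw [hx, Pi.smul_apply, smul_comm]
  rw [h1, h2, hf φ hφ, smul_neg]

/-- `H¹(Ω)` as a subspace, realised as the space of pairs `(u, ∇u)` with `u ∈ L²(Ω)` and weak gradient
`∇u ∈ L²(Ω)²` (determined by `u`).  The norm inherited from the Hilbert sum is the usual one,
`‖u‖² = ‖u‖²_{L²} + ‖∂₁u‖²_{L²} + ‖∂₂u‖²_{L²}`. -/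
def H1Submodule (Ω : Set Plane) :
    Submodule ℂ (WithLp 2 (L2 Ω × PiLp 2 (fun _ : Fin 2 => L2 Ω))) where
  carrier := {w | ∀ i : Fin 2, IsWeakPartial Ω i w.fst (w.snd i)}
  add_mem' := fun hv hw i => (hv i).add (hw i)
  zero_mem' := fun i => IsWeakPartial.zero Ω i
  smul_mem' := fun c _ hw i => (hw i).smul c

/-- The Hilbert space `H¹(Ω)`. -/
abbrev H1 (Ω : Set Plane) : Type := H1Submodule Ω

/-- The underlying `L²` function of an `H¹` function. -/
def H1.toL2 {Ω : Set Plane} (u : H1 Ω) : L2 Ω := u.1.fst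

/-- The weak partial derivative of an `H¹` function. -/
def H1.deriv {Ω : Set Plane} (u : H1 Ω) (i : Fin 2) : L2 Ω := u.1.snd i

/-- The function `u` belongs to `H²(Ω)`. -/
def IsH2 {Ω : Set Plane} (u : H1 Ω) : Prop :=
  ∀ i j : Fin 2, ∃ d : L2 Ω, IsWeakPartial Ω j (u.deriv i) d

/-! ### Boundary values -/

/-- `v ∈ H¹(Ω) ∩ C(closure Ω)` and `γ ∈ L²(∂Ω)` is its restriction to the boundary. -/
def IsBoundaryRestriction {Ω : Set Plane} (v : H1 Ω) (γ : L2Boundary Ω) : Prop :=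
  ∃ φ : Plane → ℂ, ContinuousOn φ (closure Ω) ∧
    (v.toL2 =ᵐ[(volume : Measure Plane).restrict Ω] φ) ∧ (γ =ᵐ[boundaryMeasure Ω] φ)

/-- `γ` is the trace of `v ∈ H¹(Ω)` on `∂Ω`.  The trace operator `H¹(Ω) → L²(∂Ω)` is the
continuous extension of the restriction `v ↦ v|_{∂Ω}` from `H¹(Ω) ∩ C(closure Ω)`; its graph is
therefore the closure of the graph of the restriction. -/
def IsTrace {Ω : Set Plane} (v : H1 Ω) (γ : L2Boundary Ω) : Prop :=
  ∃ (w : ℕ → H1 Ω) (δ : ℕ → L2Boundary Ω), (∀ j, IsBoundaryRestriction (w j) (δ j)) ∧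
    Tendsto w atTop (𝓝 v) ∧ Tendsto δ atTop (𝓝 γ)

/-! ### The continuous problems -/

/-- `(u, v) = ∫_Ω u v̄ dx`. -/
def pairing {Ω : Set Plane} (u v : L2 Ω) : ℂ :=
  ∫ x in Ω, u x * (starRingEnd ℂ) (v x)

/-- `⟨f, g⟩ = ∫_{∂Ω} f ḡ ds`. -/
def boundaryPairing {Ω : Set Plane} (f g : L2Boundary Ω) : ℂ :=
  ∫ x, f x * (starRingEnd ℂ) (g x) ∂(boundaryMeasure Ω)

/-- `(∇u, ∇v) - κ (n u, v)`. -/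
def form {Ω : Set Plane} (κ : ℂ) (n : Plane → ℂ) (u v : H1 Ω) : ℂ :=
  (∑ i : Fin 2, pairing (u.deriv i) (v.deriv i))
    - κ * ∫ x in Ω, n x * u.toL2 x * (starRingEnd ℂ) (v.toL2 x)

/-- The index of refraction `n = n₁ + i n₂ / k`. -/
def refractiveIndex (k : ℝ) (n₁ n₂ : Plane → ℝ) (x : Plane) : ℂ :=
  (n₁ x : ℂ) + Complex.I * ((n₂ x : ℂ) / (k : ℂ))

/-- `κ` is a Neumann eigenvalue associated with `n`: the problem `Δu + κ n u = 0` in `Ω`,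
`∂u/∂ν = 0` on `∂Ω` has a nontrivial (weak) solution in `H¹(Ω)`. -/
def IsNeumannEigenvalue (Ω : Set Plane) (n : Plane → ℂ) (κ : ℂ) : Prop :=
  ∃ u : H1 Ω, u ≠ 0 ∧ ∀ v : H1 Ω, form κ n u v = 0

/-- `u` solves the source problem `a(u, v) = ⟨g, v⟩` for all `v ∈ H¹(Ω)`. -/
def IsSourceSolution {Ω : Set Plane} (κ : ℂ) (n : Plane → ℂ) (g : L2Boundary Ω) (u : H1 Ω) :
    Prop :=
  ∀ (v : H1 Ω) (γ : L2Boundary Ω), IsTrace v γ → form κ n u v = boundaryPairing g γ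

/-- `H²` regularity of the adjoint problem: for every `f ∈ L²(Ω)`, a solution `w ∈ H¹(Ω)` of
`a(v, w) = (v, f)` for all `v ∈ H¹(Ω)` lies in `H²(Ω)`. -/
def AdjointH2Regular (Ω : Set Plane) (κ : ℂ) (n : Plane → ℂ) : Prop :=
  ∀ (f : L2 Ω) (w : H1 Ω), (∀ v : H1 Ω, form κ n v w = pairing v.toL2 f) → IsH2 w

/-! ### Finite elements -/

/-- A conforming triangulation of `Ω`.  Triangles are given by their sets of three vertices; two
closed triangles meet in the convex hull of their common vertices (nothing, a vertex, an edge). -/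
structure Mesh (Ω : Set Plane) where
  cells : Finset (Finset Plane)
  card_eq : ∀ t ∈ cells, t.card = 3
  affineIndependent : ∀ t ∈ cells, AffineIndependent ℝ ((↑) : t → Plane)
  iUnion_eq : ⋃ t ∈ cells, convexHull ℝ (t : Set Plane) = closure Ω
  inter_eq : ∀ s ∈ cells, ∀ t ∈ cells,
    convexHull ℝ (s : Set Plane) ∩ convexHull ℝ (t : Set Plane)
      = convexHull ℝ ((s : Set Plane) ∩ (t : Set Plane))

/-- The mesh size `h`: the largest diameter of a triangle. -/
def Mesh.size {Ω : Set Plane} (T : Mesh Ω) : ℝ :=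
  ⨆ t : T.cells, Metric.diam (convexHull ℝ ((t : Finset Plane) : Set Plane))

/-- Shape regularity with constant `σ`: every triangle contains a disc of some radius `r > 0` such
that the diameter of the triangle is at most `σ r`. -/
def Mesh.IsRegular {Ω : Set Plane} (T : Mesh Ω) (σ : ℝ) : Prop :=
  ∀ t ∈ T.cells, ∃ (c : Plane) (r : ℝ), 0 < r ∧
    Metric.closedBall c r ⊆ convexHull ℝ (t : Set Plane) ∧
    Metric.diam (convexHull ℝ (t : Set Plane)) ≤ σ * r

/-- `φ` is continuous on `closure Ω` and a polynomial of total degree at most `p` on each closed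
triangle. -/
def Mesh.IsPiecewisePoly {Ω : Set Plane} (T : Mesh Ω) (p : ℕ) (φ : Plane → ℂ) : Prop :=
  ContinuousOn φ (closure Ω) ∧ ∀ t ∈ T.cells, ∃ P : MvPolynomial (Fin 2) ℂ,
    P.totalDegree ≤ p ∧ ∀ x ∈ convexHull ℝ (t : Set Plane),
      φ x = MvPolynomial.eval (fun i => ((x i : ℝ) : ℂ)) P

/-- The Lagrange finite element space `V_h ⊆ H¹(Ω)` of degree `p`. -/
def Mesh.lagrange {Ω : Set Plane} (T : Mesh Ω) (p : ℕ) : Submodule ℂ (H1 Ω) where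
  carrier := {v | ∃ φ : Plane → ℂ, T.IsPiecewisePoly p φ ∧
    (v.toL2 =ᵐ[(volume : Measure Plane).restrict Ω] φ)}
  add_mem' := by
    rintro v w ⟨φ, ⟨hφ, hφ'⟩, hv⟩ ⟨ψ, ⟨hψ, hψ'⟩, hw⟩
    refine ⟨φ + ψ, ⟨hφ.add hψ, fun t ht => ?_⟩, ?_⟩
    · obtain ⟨P, hP, hP'⟩ := hφ' t ht
      obtain ⟨Q, hQ, hQ'⟩ := hψ' t ht
      refine ⟨P + Q, (MvPolynomial.totalDegree_add P Q).trans (max_le hP hQ), fun x hx => ?_⟩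
      rw [map_add, Pi.add_apply, hP' x hx, hQ' x hx]
    · exact (Lp.coeFn_add v.toL2 w.toL2).trans (hv.add hw)
  zero_mem' := by
    refine ⟨0, ⟨continuousOn_const, fun t _ => ⟨0, by simp, fun x _ => by simp⟩⟩, ?_⟩
    exact Lp.coeFn_zero ℂ 2 ((volume : Measure Plane).restrict Ω)
  smul_mem' := by
    rintro c v ⟨φ, ⟨hφ, hφ'⟩, hv⟩
    refine ⟨c • φ, ⟨hφ.const_smul c, fun t ht => ?_⟩, ?_⟩
    · obtain ⟨P, hP, hP'⟩ := hφ' t ht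
      refine ⟨c • P, (MvPolynomial.totalDegree_smul_le c P).trans hP, fun x hx => ?_⟩
      rw [MvPolynomial.smul_eval, Pi.smul_apply, smul_eq_mul, hP' x hx]
    · exact (Lp.coeFn_smul c v.toL2).trans (hv.const_smul c)

/-- `γ` belongs to `V_h^B = V_h|_{∂Ω}`. -/
def Mesh.MemBoundarySpace {Ω : Set Plane} (T : Mesh Ω) (p : ℕ) (γ : L2Boundary Ω) : Prop :=
  ∃ v ∈ T.lagrange p, IsBoundaryRestriction v γ

/-- `gh` is the `L²(∂Ω)`-orthogonal projection of `g` onto `V_h^B`. -/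
def Mesh.IsBoundaryProjection {Ω : Set Plane} (T : Mesh Ω) (p : ℕ) (g gh : L2Boundary Ω) :
    Prop :=
  T.MemBoundarySpace p gh ∧
    ∀ γ : L2Boundary Ω, T.MemBoundarySpace p γ → boundaryPairing (g - gh) γ = 0

/-- `uh ∈ V_h` solves the discrete source problem `a(uh, vh) = ⟨gh, vh⟩` for all `vh ∈ V_h`, where
`gh` is the projection of `g` onto `V_h^B`. -/
def Mesh.IsDiscreteSolution {Ω : Set Plane} (T : Mesh Ω) (p : ℕ) (κ : ℂ) (n : Plane → ℂ)
    (g : L2Boundary Ω) (uh : H1 Ω) : Prop :=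
  uh ∈ T.lagrange p ∧ ∃ gh : L2Boundary Ω, T.IsBoundaryProjection p g gh ∧
    ∀ vh ∈ T.lagrange p, ∀ γ : L2Boundary Ω, IsBoundaryRestriction vh γ →
      form κ n uh vh = boundaryPairing gh γ

end Steklov

end

/-!
The proof is the duality argument of Schatz on the Hilbert space `H¹(Ω)`.

*The form.* Multiplication by the refractive index is bounded on `L²(Ω)`, so the form is
`a(u, v) = (u, v)_{H¹} - (M u, v)_{L²}` for a bounded operator `M` of `L²(Ω)`
(`exists_form_operator`): it is a compact perturbation of the inner product once
`H¹(Ω) → L²(Ω)` is known to be compact. Compactness is read off from the meshes themselves: by the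
Poincaré inequality on convex sets, replacing a function by its mean value on each triangle costs
`O(h)` in `L²`, so the embedding is a norm limit of operators with finite-dimensional range
(`Mesh.exists_finiteDimensional_le`). As `k²` is not a Neumann eigenvalue, the Fredholm alternative
gives a bounded solution operator `S : L²(Ω) → H¹(Ω)` of the adjoint problem
(`exists_adjoint_solution`); by `H²` regularity and the closed graph theorem the second derivatives
of `S f` are bounded by `‖f‖` (`exists_second_deriv_bound`).

*Approximation.* A function `w ∈ H²(Ω)` on a triangle of diameter `d` is compared with its affine
interpolant. Smoothing `w` by mollification and applying Taylor's formula from each vertex shows that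
`w` has a continuous representative whose nodal interpolant satisfies the usual first-order
estimate, with a constant that depends on the shape regularity only
(`Mesh.exists_interpolation_le`). The interpolants are continuous and piecewise affine, hence
belong to `H¹(Ω)` (`Mesh.exists_H1`); this uses that the open triangles fill `Ω` up to a null set,
which follows from the Lipschitz condition through `interior (closure Ω) = Ω`.

*Error bounds.* Let `e = u - u_h`. Elements of `V_h` have boundary values in `V_h^B`, to which
`g - g_h` is orthogonal, so `a(e, v) = 0` for `v ∈ V_h`. With `f = e` in the dual problem,
`‖e‖²_{L²} = a(e, S e - v) ≤ C h ‖e‖_{H¹} ‖e‖_{L²}`, which is the `L²` bound; inserted into the Gårding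
inequality it absorbs the zeroth-order term for small `h`, and quasi-optimality follows
(`galerkin_error_bounds`). Uniqueness of the discrete solution is the case of an error in `V_h`, and
existence follows as `V_h` is finite-dimensional.
-/

noncomputable section

namespace Steklov

/-! ### Weak derivatives and the Hilbert space `H¹` -/

theorem pairing_eq_inner {Ω : Set Plane} (u v : L2 Ω) : pairing u v = inner ℂ v u := by
  rw [pairing, L2.inner_def]
  rfl

theorem boundaryPairing_eq_inner {Ω : Set Plane} (u v : L2Boundary Ω) :
    boundaryPairing u v = inner ℂ v u := by
  rw [boundaryPairing, L2.inner_def]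
  rfl

/-- The inner product of the Hilbert space `H¹(Ω)`, singled out among the `ℂ`-valued inner products
found by instance search. -/
instance H1.instInner (Ω : Set Plane) : Inner ℂ (H1 Ω) := InnerProductSpace.toInner

theorem H1.inner_eq {Ω : Set Plane} (u v : H1 Ω) :
    inner ℂ u v = inner ℂ u.toL2 v.toL2 + ∑ i, inner ℂ (u.deriv i) (v.deriv i) := by
  rw [Submodule.coe_inner, WithLp.prod_inner_apply, PiLp.inner_apply]
  rfl

theorem H1.norm_sq_eq {Ω : Set Plane} (u : H1 Ω) :
    ‖u‖ ^ 2 = ‖u.toL2‖ ^ 2 + ∑ i, ‖u.deriv i‖ ^ 2 := by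
  change ‖u.1‖ ^ 2 = _
  rw [WithLp.prod_norm_sq_eq_of_L2, PiLp.norm_sq_eq_of_L2]
  rfl

theorem continuous_integral_smul {Ω : Set Plane} {ψ : Plane → ℝ} (hc : Continuous ψ)
    (hs : HasCompactSupport ψ) : Continuous fun f : L2 Ω => ∫ x in Ω, ψ x • f x := by
  have h1 : MemLp (fun x => (ψ x : ℂ)) 2 ((volume : Measure Plane).restrict Ω) :=
    (hc.memLp_of_hasCompactSupport hs).ofReal
  have h2 : (fun f : L2 Ω => ∫ x in Ω, ψ x • f x) = fun f => inner ℂ h1.toLp f := by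
    funext f
    rw [L2.inner_def]
    refine integral_congr_ae ?_
    filter_upwards [h1.coeFn_toLp] with x hx
    simp [hx, mul_comm]
  rw [h2]
  exact continuous_const.inner continuous_id

/-- The graph of the weak derivative is closed. -/
theorem isClosed_isWeakPartial (Ω : Set Plane) (i : Fin 2) :
    IsClosed {w : L2 Ω × L2 Ω | IsWeakPartial Ω i w.1 w.2} := by
  have h : {w : L2 Ω × L2 Ω | IsWeakPartial Ω i w.1 w.2} =
      ⋂ (φ : Plane → ℝ) (_ : IsTestFunction Ω φ),
        {w | ∫ x in Ω, partialDeriv i φ x • w.1 x = - ∫ x in Ω, φ x • w.2 x} := by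
    ext w
    simp [IsWeakPartial]
  rw [h]
  refine isClosed_iInter fun φ => isClosed_iInter fun hφ => isClosed_eq ?_ ?_
  · exact (continuous_integral_smul
      ((hφ.contDiff.continuous_fderiv (by simp)).clm_apply continuous_const)
      (hφ.hasCompactSupport.fderiv_apply (𝕜 := ℝ) _)).comp continuous_fst
  · exact ((continuous_integral_smul hφ.contDiff.continuous hφ.hasCompactSupport).comp
      continuous_snd).neg

instance (Ω : Set Plane) : CompleteSpace (H1 Ω) := by
  refine IsClosed.completeSpace_coe (hs := ?_)
  have h : (H1Submodule Ω : Set (WithLp 2 (L2 Ω × PiLp 2 (fun _ : Fin 2 => L2 Ω)))) =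
      ⋂ i : Fin 2, (fun w : WithLp 2 (L2 Ω × PiLp 2 (fun _ : Fin 2 => L2 Ω)) =>
        (w.fst, w.snd i)) ⁻¹' {w : L2 Ω × L2 Ω | IsWeakPartial Ω i w.1 w.2} := by
    ext w
    simp only [mem_iInter]
    rfl
  rw [h]
  refine isClosed_iInter fun i => (isClosed_isWeakPartial Ω i).preimage ?_
  fun_prop

theorem setIntegral_smul_eq_integral_smul_indicator {Ω : Set Plane} (hΩ : MeasurableSet Ω)
    (ψ : Plane → ℝ) (f : Plane → ℂ) :
    ∫ x in Ω, ψ x • f x = ∫ x, ψ x • Ω.indicator f x := by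
  rw [← integral_indicator hΩ]
  refine integral_congr_ae (Eventually.of_forall fun x => ?_)
  by_cases hx : x ∈ Ω
  · simp [hx]
  · simp [hx]

theorem eq_zero_of_forall_integral_smul {Ω : Set Plane} (hΩ : IsOpen Ω) {d : L2 Ω}
    (h : ∀ φ, IsTestFunction Ω φ → ∫ x in Ω, φ x • d x = 0) : d = 0 := by
  have hd : MemLp (Ω.indicator d) 2 (volume : Measure Plane) :=
    (memLp_indicator_iff_restrict hΩ.measurableSet).2 (Lp.memLp d)
  have h0 := hΩ.ae_eq_zero_of_integral_contDiff_smul_eq_zero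
    ((hd.locallyIntegrable (by norm_num)).locallyIntegrableOn Ω) fun g hg hg' hg'' => by
      rw [← setIntegral_smul_eq_integral_smul_indicator hΩ.measurableSet]
      exact h g ⟨hg, hg', hg''⟩
  refine (Lp.eq_zero_iff_ae_eq_zero).2 ?_
  refine (ae_restrict_iff' hΩ.measurableSet).2 ?_
  filter_upwards [h0] with x hx hxΩ
  simpa [hxΩ] using hx hxΩ

theorem IsWeakPartial.eq_zero {Ω : Set Plane} (hΩ : IsOpen Ω) {i : Fin 2} {d : L2 Ω}
    (h : IsWeakPartial Ω i 0 d) : d = 0 := by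
  refine eq_zero_of_forall_integral_smul hΩ fun φ hφ => ?_
  have h1 := h φ hφ
  rw [IsWeakPartial.zero Ω i φ hφ] at h1
  have h2 : ∫ x in Ω, φ x • (0 : L2 Ω) x = 0 := by
    refine integral_eq_zero_of_ae ?_
    filter_upwards [Lp.coeFn_zero ℂ 2 ((volume : Measure Plane).restrict Ω)] with x hx
    rw [hx, Pi.zero_apply, smul_zero]
  rw [h2] at h1
  simpa using h1.symm

theorem IsWeakPartial.unique {Ω : Set Plane} (hΩ : IsOpen Ω) {i : Fin 2} {f d e : L2 Ω}
    (hd : IsWeakPartial Ω i f d) (he : IsWeakPartial Ω i f e) : d = e := by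
  have h := hd.add (he.smul (-1))
  rw [neg_one_smul, neg_one_smul, add_neg_cancel] at h
  have := h.eq_zero hΩ
  rwa [← sub_eq_add_neg, sub_eq_zero] at this

theorem H1.ext_toL2 {Ω : Set Plane} (hΩ : IsOpen Ω) {u v : H1 Ω} (h : u.toL2 = v.toL2) :
    u = v := by
  have h' : ∀ i, u.deriv i = v.deriv i := fun i => by
    have hu : IsWeakPartial Ω i u.toL2 (u.deriv i) := u.2 i
    have hv : IsWeakPartial Ω i v.toL2 (v.deriv i) := v.2 i
    rw [h] at hu
    exact hu.unique hΩ hv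
  refine Subtype.ext ?_
  apply (WithLp.equiv 2 _).injective
  refine Prod.ext h ?_
  apply (WithLp.equiv 2 _).injective
  funext i
  exact h' i

/-- The embedding `H¹(Ω) → L²(Ω)` as a continuous linear map. -/
def H1.toL2L (Ω : Set Plane) : H1 Ω →L[ℂ] L2 Ω where
  toFun := H1.toL2
  map_add' _ _ := rfl
  map_smul' _ _ := rfl
  cont := by
    change Continuous fun u : H1 Ω => u.1.fst
    fun_prop

/-- The weak partial derivative as a continuous linear map `H¹(Ω) → L²(Ω)`. -/
def H1.derivL (Ω : Set Plane) (i : Fin 2) : H1 Ω →L[ℂ] L2 Ω where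
  toFun u := u.deriv i
  map_add' _ _ := rfl
  map_smul' _ _ := rfl
  cont := by
    change Continuous fun u : H1 Ω => u.1.snd i
    fun_prop

/-! ### Mollification -/

/-- The radius `1 / (m + 1)` of the `m`-th mollifier. -/
def mollRadius (m : ℕ) : ℝ := 1 / ((m : ℝ) + 1)

theorem mollRadius_pos (m : ℕ) : 0 < mollRadius m := by
  unfold mollRadius; positivity

theorem tendsto_mollRadius : Tendsto mollRadius atTop (𝓝 0) :=
  tendsto_one_div_add_atTop_nhds_zero_nat

/-- The bump function of radius `mollRadius m` about the origin. -/
def mollBump (m : ℕ) : ContDiffBump (0 : Plane) where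
  rIn := mollRadius m / 2
  rOut := mollRadius m
  rIn_pos := half_pos (mollRadius_pos m)
  rIn_lt_rOut := half_lt_self (mollRadius_pos m)

/-- The normalised mollifier, of integral one. -/
def mollKernel (m : ℕ) : Plane → ℝ := (mollBump m).normed volume

theorem mollKernel_contDiff (m : ℕ) : ContDiff ℝ ∞ (mollKernel m) :=
  (mollBump m).contDiff_normed

theorem mollKernel_hasCompactSupport (m : ℕ) : HasCompactSupport (mollKernel m) :=
  (mollBump m).hasCompactSupport_normed

theorem mollKernel_nonneg (m : ℕ) (x : Plane) : 0 ≤ mollKernel m x :=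
  (mollBump m).nonneg_normed x

theorem tsupport_mollKernel (m : ℕ) :
    tsupport (mollKernel m) = Metric.closedBall 0 (mollRadius m) :=
  (mollBump m).tsupport_normed_eq

/-- The mollification of a function on `Ω`, extended by zero outside `Ω`. -/
def mollify {Ω : Set Plane} (m : ℕ) (f : L2 Ω) : Plane → ℂ :=
  convolution (mollKernel m) (Ω.indicator f) (ContinuousLinearMap.lsmul ℝ ℝ) volume

theorem locallyIntegrable_indicator {Ω : Set Plane} (hΩ : IsOpen Ω) (f : L2 Ω) :
    LocallyIntegrable (Ω.indicator f) (volume : Measure Plane) :=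
  ((memLp_indicator_iff_restrict hΩ.measurableSet).2 (Lp.memLp f)).locallyIntegrable
    (by norm_num)

theorem continuous_mollify {Ω : Set Plane} (hΩ : IsOpen Ω) (m : ℕ) (f : L2 Ω) :
    Continuous (mollify m f) :=
  (mollKernel_hasCompactSupport m).continuous_convolution_left _
    (mollKernel_contDiff m).continuous (locallyIntegrable_indicator hΩ f)

theorem ae_tendsto_mollify {Ω : Set Plane} (hΩ : IsOpen Ω) (f : L2 Ω) :
    ∀ᵐ x ∂((volume : Measure Plane).restrict Ω),
      Tendsto (fun m => mollify m f x) atTop (𝓝 (f x)) := by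
  have h := ContDiffBump.ae_convolution_tendsto_right_of_locallyIntegrable
    (φ := mollBump) (l := atTop) (K := 2) tendsto_mollRadius
    (Eventually.of_forall fun m => by simp only [mollBump]; linarith)
    (locallyIntegrable_indicator hΩ f)
  rw [ae_restrict_iff' hΩ.measurableSet]
  filter_upwards [h] with x hx hxΩ
  rw [indicator_of_mem hxΩ] at hx
  exact hx

theorem mollify_eq {Ω : Set Plane} (hΩ : IsOpen Ω) (m : ℕ) (f : L2 Ω) (x : Plane) :
    mollify m f x = ∫ y in Ω, mollKernel m (x - y) • f y := by
  rw [mollify, convolution_eq_swap, setIntegral_smul_eq_integral_smul_indicator hΩ.measurableSet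
    (fun y => mollKernel m (x - y))]
  rfl

theorem isTestFunction_mollKernel {Ω : Set Plane} {m : ℕ} {x : Plane}
    (hx : Metric.closedBall x (mollRadius m) ⊆ Ω) :
    IsTestFunction Ω fun y => mollKernel m (x - y) := by
  have hs : tsupport (fun y => mollKernel m (x - y)) ⊆ Metric.closedBall x (mollRadius m) := by
    refine closure_minimal (fun y hy => ?_) Metric.isClosed_closedBall
    have : x - y ∈ tsupport (mollKernel m) := subset_tsupport _ hy
    rw [tsupport_mollKernel, mem_closedBall_zero_iff] at this
    rwa [Metric.mem_closedBall, dist_comm, dist_eq_norm]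
  exact ⟨(mollKernel_contDiff m).comp (contDiff_const.sub contDiff_id),
    (isCompact_closedBall _ _).of_isClosed_subset (isClosed_tsupport _) hs, hs.trans hx⟩

theorem euclidean_sum_single (v : Plane) :
    v = ∑ i, v i • (EuclideanSpace.single i (1 : ℝ) : Plane) := by
  ext j
  fin_cases j <;> simp

/-- The linear map `v ↦ ∑ᵢ vᵢ cᵢ` with partial derivatives `cᵢ`. -/
def gradMap (c : Fin 2 → ℂ) : Plane →L[ℝ] ℂ :=
  ∑ i, (EuclideanSpace.proj i : Plane →L[ℝ] ℝ).smulRight (c i)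

@[simp] theorem gradMap_apply (c : Fin 2 → ℂ) (v : Plane) : gradMap c v = ∑ i, v i • c i := by
  simp [gradMap]

/-- Well inside `Ω`, mollification commutes with weak differentiation. -/
theorem hasFDerivAt_mollify {Ω : Set Plane} (hΩ : IsOpen Ω) {m : ℕ} {f : L2 Ω}
    {d : Fin 2 → L2 Ω} (hd : ∀ i, IsWeakPartial Ω i f (d i)) {x : Plane}
    (hx : Metric.closedBall x (mollRadius m) ⊆ Ω) :
    HasFDerivAt (mollify m f) (gradMap fun i => mollify m (d i) x) x := by
  have hloc := locallyIntegrable_indicator hΩ f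
  have h1 := (mollKernel_hasCompactSupport m).hasFDerivAt_convolution_left
    (ContinuousLinearMap.lsmul ℝ ℝ) ((mollKernel_contDiff m).of_le (by simp)) hloc x
  refine h1.congr_fderiv ?_
  have hex := ((mollKernel_hasCompactSupport m).fderiv (𝕜 := ℝ)).convolutionExists_left
    ((ContinuousLinearMap.lsmul ℝ ℝ : ℝ →L[ℝ] ℂ →L[ℝ] ℂ).precompL Plane)
    ((mollKernel_contDiff m).continuous_fderiv (by simp)) hloc x
  have h2 : ∀ i : Fin 2, (convolution (fderiv ℝ (mollKernel m)) (Ω.indicator f)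
      ((ContinuousLinearMap.lsmul ℝ ℝ : ℝ →L[ℝ] ℂ →L[ℝ] ℂ).precompL Plane) volume x)
      (EuclideanSpace.single i 1) = mollify m (d i) x := by
    intro i
    have hpd : ∀ y, partialDeriv i (fun y => mollKernel m (x - y)) y =
        - fderiv ℝ (mollKernel m) (x - y) (EuclideanSpace.single i 1) := by
      intro y
      have hk : HasFDerivAt (mollKernel m) (fderiv ℝ (mollKernel m) (x - y)) (x - y) :=
        ((mollKernel_contDiff m).differentiable (by simp) _).hasFDerivAt
      have : HasFDerivAt (fun y => mollKernel m (x - y)) _ y :=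
        hk.comp y ((hasFDerivAt_id y).const_sub x)
      rw [partialDeriv, HasFDerivAt.fderiv this]
      simp
    have h3 := hd i _ (isTestFunction_mollKernel hx)
    rw [← mollify_eq hΩ, setIntegral_smul_eq_integral_smul_indicator hΩ.measurableSet] at h3
    rw [← neg_eq_iff_eq_neg] at h3
    rw [← h3, ← integral_neg, convolution]
    rw [ContinuousLinearMap.integral_apply hex]
    rw [← integral_sub_left_eq_self _ volume x]
    refine integral_congr_ae (Eventually.of_forall fun y => ?_)
    simp [hpd]
  ext v
  conv_lhs => rw [euclidean_sum_single v]
  rw [map_sum, gradMap_apply]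
  simp_rw [map_smul, h2]

theorem sq_lintegral_le {α : Type*} [MeasurableSpace α] (ν : Measure α) [IsProbabilityMeasure ν]
    {g : α → ENNReal} (hg : AEMeasurable g ν) : (∫⁻ x, g x ∂ν) ^ 2 ≤ ∫⁻ x, g x ^ 2 ∂ν := by
  have h := ENNReal.lintegral_mul_le_Lp_mul_Lq ν Real.HolderConjugate.two_two hg
    (aemeasurable_const (b := (1 : ENNReal)))
  simp only [Pi.mul_apply, mul_one, ENNReal.one_rpow, lintegral_const, measure_univ] at h
  calc (∫⁻ x, g x ∂ν) ^ 2 ≤ ((∫⁻ x, g x ^ (2 : ℝ) ∂ν) ^ (1 / 2 : ℝ)) ^ 2 := by gcongr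
    _ = ∫⁻ x, g x ^ 2 ∂ν := by
      rw [← ENNReal.rpow_natCast, ← ENNReal.rpow_mul]
      norm_num

/-- Mollification does not increase `L²` norms (on slightly larger sets). -/
theorem lintegral_mollify_le {Ω U V : Set Plane} (hΩ : IsOpen Ω) (hU : MeasurableSet U)
    (hUΩ : U ⊆ Ω) (hV : MeasurableSet V) {m : ℕ}
    (hVU : ∀ x ∈ V, Metric.closedBall x (mollRadius m) ⊆ U) (f : L2 Ω) :
    ∫⁻ x in V, ‖mollify m f x‖ₑ ^ 2 ≤ ∫⁻ x in U, ‖f x‖ₑ ^ 2 := by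
  set F : Plane → ℂ := Ω.indicator f with hF
  have hFm : AEStronglyMeasurable F volume := (locallyIntegrable_indicator hΩ f).aestronglyMeasurable
  have hρm : Measurable fun y => ENNReal.ofReal (mollKernel m y) :=
    (mollKernel_contDiff m).continuous.measurable.ennreal_ofReal
  set ν : Measure Plane := volume.withDensity fun y => ENNReal.ofReal (mollKernel m y) with hν
  have hρ1 : ∫⁻ y, ENNReal.ofReal (mollKernel m y) = 1 := by
    rw [← ofReal_integral_eq_lintegral_ofReal]
    · simp [mollKernel, (mollBump m).integral_normed]
    · exact (mollKernel_contDiff m).continuous.integrable_of_hasCompactSupport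
        (mollKernel_hasCompactSupport m)
    · exact Eventually.of_forall (mollKernel_nonneg m)
  have hprob : IsProbabilityMeasure ν := ⟨by rw [hν, withDensity_apply _ MeasurableSet.univ]; simpa⟩
  have hac : ν ≪ volume := withDensity_absolutelyContinuous _ _
  have hmp : Measure.QuasiMeasurePreserving (fun p : Plane × Plane => p.1 - p.2)
      ((volume : Measure Plane).prod (volume : Measure Plane)) volume :=
    quasiMeasurePreserving_sub_of_right_invariant volume volume
  have hFsub : ∀ x : Plane, AEMeasurable (fun y => ‖F (x - y)‖ₑ) (volume : Measure Plane) :=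
    fun x => (hFm.comp_quasiMeasurePreserving
      (Measure.measurePreserving_sub_left volume x).quasiMeasurePreserving).enorm
  have h1 : ∀ x, ‖mollify m f x‖ₑ ^ 2 ≤ ∫⁻ y, ENNReal.ofReal (mollKernel m y) * ‖F (x - y)‖ₑ ^ 2 := by
    intro x
    calc ‖mollify m f x‖ₑ ^ 2 ≤ (∫⁻ y, ENNReal.ofReal (mollKernel m y) * ‖F (x - y)‖ₑ) ^ 2 := by
          gcongr
          refine (enorm_integral_le_lintegral_enorm _).trans (lintegral_mono fun y => ?_)
          rw [ContinuousLinearMap.lsmul_apply, enorm_smul,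
            Real.enorm_of_nonneg (mollKernel_nonneg m y)]
      _ = (∫⁻ y, ‖F (x - y)‖ₑ ∂ν) ^ 2 := by
          rw [hν, lintegral_withDensity_eq_lintegral_mul₀ hρm.aemeasurable (hFsub x)]
          rfl
      _ ≤ ∫⁻ y, ‖F (x - y)‖ₑ ^ 2 ∂ν := sq_lintegral_le ν ((hFsub x).mono_ac hac)
      _ = _ := by
          rw [hν, lintegral_withDensity_eq_lintegral_mul₀ hρm.aemeasurable ((hFsub x).pow_const 2)]
          rfl
  calc ∫⁻ x in V, ‖mollify m f x‖ₑ ^ 2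
      ≤ ∫⁻ x in V, ∫⁻ y, ENNReal.ofReal (mollKernel m y) * ‖F (x - y)‖ₑ ^ 2 :=
        lintegral_mono fun x => h1 x
    _ = ∫⁻ y, ∫⁻ x in V, ENNReal.ofReal (mollKernel m y) * ‖F (x - y)‖ₑ ^ 2 := by
        refine lintegral_lintegral_swap ?_
        have h2 : AEMeasurable (fun p : Plane × Plane => ‖F (p.1 - p.2)‖ₑ)
            ((volume.restrict V).prod volume) :=
          (hFm.comp_quasiMeasurePreserving hmp).enorm.mono_ac
            (Measure.absolutelyContinuous_of_le (Measure.prod_mono Measure.restrict_le_self le_rfl))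
        exact (hρm.comp measurable_snd).aemeasurable.mul (h2.pow_const 2)
    _ ≤ ∫⁻ y, ENNReal.ofReal (mollKernel m y) * ∫⁻ x in U, ‖f x‖ₑ ^ 2 := by
        refine lintegral_mono fun y => ?_
        by_cases hy : y ∈ tsupport (mollKernel m)
        swap
        · simp [image_eq_zero_of_notMem_tsupport hy]
        rw [lintegral_const_mul' _ _ ENNReal.ofReal_ne_top]
        refine mul_le_mul' le_rfl ?_
        rw [← lintegral_indicator hV, ← lintegral_indicator hU]
        calc ∫⁻ x, V.indicator (fun x => ‖F (x - y)‖ₑ ^ 2) x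
            ≤ ∫⁻ x, U.indicator (fun x => ‖f x‖ₑ ^ 2) (x - y) := by
              refine lintegral_mono fun x => ?_
              by_cases hx : x ∈ V
              · rw [tsupport_mollKernel, mem_closedBall_zero_iff] at hy
                have hxy : x - y ∈ U := hVU x hx (by simpa [dist_eq_norm] using hy)
                simp [hx, hxy, hF, hUΩ hxy]
              · simp [hx]
          _ = ∫⁻ x, U.indicator (fun x => ‖f x‖ₑ ^ 2) x := lintegral_sub_right_eq_self _ y
    _ = ∫⁻ x in U, ‖f x‖ₑ ^ 2 := by
        rw [lintegral_mul_const _ hρm, hρ1, one_mul]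

/-! ### Integral inequalities on convex sets -/

theorem lintegral_comp_smul_add {G : Plane → ENNReal} (hG : Measurable G) {s : ℝ} (hs : 0 < s)
    (b : Plane) : ∫⁻ x, G (s • x + b) = ENNReal.ofReal ((s ^ 2)⁻¹) * ∫⁻ x, G x := by
  have h1 : ∫⁻ x, G (s • x + b) = ∫⁻ x, G (x + b) ∂(Measure.map (s • ·) volume) :=
    (lintegral_map (hG.comp (measurable_id.add_const b)) (measurable_const_smul s)).symm
  rw [h1, Measure.map_addHaar_smul _ hs.ne', lintegral_smul_measure,
    lintegral_add_right_eq_self, abs_of_pos (by positivity), finrank_euclideanSpace_fin,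
    smul_eq_mul]

/-- A function on `[0, 1]` increases by at most the `L²` norm of its derivative. -/
theorem enorm_sub_sq_le_lintegral {k k' : ℝ → ℂ} (hk : ∀ s ∈ Icc (0 : ℝ) 1, HasDerivAt k (k' s) s)
    (hk' : Continuous k') :
    ‖k 1 - k 0‖ₑ ^ 2 ≤ ∫⁻ s in Ioc (0 : ℝ) 1, ‖k' s‖ₑ ^ 2 := by
  have h := intervalIntegral.integral_eq_sub_of_hasDerivAt (a := 0) (b := 1)
    (by rwa [uIcc_of_le zero_le_one]) (hk'.intervalIntegrable 0 1)
  rw [intervalIntegral.integral_of_le zero_le_one] at h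
  have : IsProbabilityMeasure ((volume : Measure ℝ).restrict (Ioc 0 1)) := ⟨by simp⟩
  calc ‖k 1 - k 0‖ₑ ^ 2 ≤ (∫⁻ s in Ioc (0 : ℝ) 1, ‖k' s‖ₑ) ^ 2 := by
        rw [← h]
        gcongr
        exact enorm_integral_le_lintegral_enorm _
    _ ≤ _ := sq_lintegral_le _ hk'.measurable.enorm.aemeasurable

theorem enorm_sq_eq (z : ℂ) : ‖z‖ₑ ^ 2 = ENNReal.ofReal (‖z‖ ^ 2) := by
  rw [ENNReal.ofReal_pow (norm_nonneg _), ofReal_norm]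

theorem enorm_sq_le_of_norm_sq_le {ι : Type*} (s : Finset ι) {z : ℂ} {c : ι → ℂ} {D : ℝ}
    (hD : 0 ≤ D) (h : ‖z‖ ^ 2 ≤ D * ∑ i ∈ s, ‖c i‖ ^ 2) :
    ‖z‖ₑ ^ 2 ≤ ENNReal.ofReal D * ∑ i ∈ s, ‖c i‖ₑ ^ 2 := by
  simp_rw [enorm_sq_eq]
  rw [← ENNReal.ofReal_sum_of_nonneg fun _ _ => sq_nonneg _, ← ENNReal.ofReal_mul hD]
  exact ENNReal.ofReal_le_ofReal h

theorem norm_sum_smul_sq_le {ι : Type*} (s : Finset ι) (a : ι → ℝ) (c : ι → ℂ) :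
    ‖∑ i ∈ s, a i • c i‖ ^ 2 ≤ (∑ i ∈ s, a i ^ 2) * ∑ i ∈ s, ‖c i‖ ^ 2 := by
  have h1 : ‖∑ i ∈ s, a i • c i‖ ≤ ∑ i ∈ s, |a i| * ‖c i‖ :=
    (norm_sum_le _ _).trans (Finset.sum_le_sum fun i _ => by rw [norm_smul, Real.norm_eq_abs])
  calc ‖∑ i ∈ s, a i • c i‖ ^ 2 ≤ (∑ i ∈ s, |a i| * ‖c i‖) ^ 2 := by gcongr
    _ ≤ (∑ i ∈ s, |a i| ^ 2) * ∑ i ∈ s, ‖c i‖ ^ 2 := Finset.sum_mul_sq_le_sq_mul_sq _ _ _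
    _ = _ := by simp_rw [sq_abs]

theorem norm_gradMap_sq_le (c : Fin 2 → ℂ) (v : Plane) :
    ‖gradMap c v‖ ^ 2 ≤ ‖v‖ ^ 2 * ∑ i, ‖c i‖ ^ 2 := by
  rw [gradMap_apply, EuclideanSpace.norm_sq_eq]
  simp_rw [Real.norm_eq_abs, sq_abs]
  exact norm_sum_smul_sq_le _ _ _

theorem norm_gradMap_gradMap_sq_le (c : Fin 2 → Fin 2 → ℂ) (v : Plane) :
    ‖gradMap (fun i => gradMap (c i) v) v‖ ^ 2 ≤ ‖v‖ ^ 4 * ∑ p : Fin 2 × Fin 2, ‖c p.1 p.2‖ ^ 2 := by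
  calc ‖gradMap (fun i => gradMap (c i) v) v‖ ^ 2
      ≤ ‖v‖ ^ 2 * ∑ i, ‖gradMap (c i) v‖ ^ 2 := norm_gradMap_sq_le _ _
    _ ≤ ‖v‖ ^ 2 * ∑ i, ‖v‖ ^ 2 * ∑ j, ‖c i j‖ ^ 2 := by
        gcongr with i
        exact norm_gradMap_sq_le _ _
    _ = _ := by
        rw [Fintype.sum_prod_type, ← Finset.mul_sum]
        ring

/-- First-order Taylor expansion in `L²` on a convex set, for a smooth function.  The remainder at
the point `a` is `∫₀¹ s h''(s) ds` for `h(s) = g(a + s(x - a))`; the weight `s` is what makes the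
change of variables `x ↦ a + s(x - a)`, of Jacobian `s²`, harmless in the plane. -/
theorem lintegral_taylor_le {V : Set Plane} (hVc : Convex ℝ V) (hVm : MeasurableSet V)
    {g : Plane → ℂ} {g₁ : Fin 2 → Plane → ℂ} {g₂ : Fin 2 → Fin 2 → Plane → ℂ}
    (hc₂ : ∀ i j, Continuous (g₂ i j))
    (h₁ : ∀ x ∈ V, HasFDerivAt g (gradMap fun i => g₁ i x) x)
    (h₂ : ∀ i, ∀ x ∈ V, HasFDerivAt (g₁ i) (gradMap fun j => g₂ i j x) x)
    {a : Plane} (ha : a ∈ V) {d : ℝ} (hd : ∀ x ∈ V, dist x a ≤ d) :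
    ∫⁻ x in V, ‖g a - g x - gradMap (fun i => g₁ i x) (a - x)‖ₑ ^ 2 ≤
      ENNReal.ofReal (d ^ 4) * ∫⁻ x in V, ∑ p : Fin 2 × Fin 2, ‖g₂ p.1 p.2 x‖ₑ ^ 2 := by
  set H : Plane → ENNReal := fun x => ∑ p : Fin 2 × Fin 2, ‖g₂ p.1 p.2 x‖ₑ ^ 2 with hH
  have hHm : Measurable H := by
    refine Finset.measurable_sum _ fun p _ => ?_
    exact ((hc₂ p.1 p.2).measurable.enorm.pow_const 2)
  have hHVm : Measurable (V.indicator H) := hHm.indicator hVm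
  have key : ∀ x ∈ V, ‖g a - g x - gradMap (fun i => g₁ i x) (a - x)‖ₑ ^ 2 ≤
      ∫⁻ s in Ioc (0 : ℝ) 1, ENNReal.ofReal (s ^ 2 * d ^ 4) * V.indicator H (s • x + (1 - s) • a) := by
    intro x hx
    set v := x - a with hv
    have hmem : ∀ s ∈ Icc (0 : ℝ) 1, a + s • v ∈ V := fun s hs =>
      hVc.add_smul_sub_mem ha hx hs
    have hline : ∀ s : ℝ, HasDerivAt (fun s : ℝ => a + s • v) v s := fun s => by
      simpa using ((hasDerivAt_id s).smul_const v).const_add a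
    have hcl : Continuous fun s : ℝ => a + s • v := by fun_prop
    have hk : ∀ s ∈ Icc (0 : ℝ) 1, HasDerivAt
        (fun s : ℝ => s • gradMap (fun i => g₁ i (a + s • v)) v - g (a + s • v))
        (s • gradMap (fun i => gradMap (fun j => g₂ i j (a + s • v)) v) v) s := by
      intro s hs
      have e1 := (h₁ _ (hmem s hs)).comp_hasDerivAt s (hline s)
      have e2 : HasDerivAt (fun s : ℝ => gradMap (fun i => g₁ i (a + s • v)) v)
          (gradMap (fun i => gradMap (fun j => g₂ i j (a + s • v)) v) v) s := by
        simp_rw [gradMap_apply (c := fun i => g₁ i _),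
          gradMap_apply (c := fun i => gradMap _ _)]
        refine HasDerivAt.fun_sum fun i _ => ?_
        exact ((h₂ i _ (hmem s hs)).comp_hasDerivAt s (hline s)).const_smul (v i)
      refine (((hasDerivAt_id s).smul e2).sub e1).congr_deriv ?_
      simp
    have hk' : Continuous fun s : ℝ =>
        s • gradMap (fun i => gradMap (fun j => g₂ i j (a + s • v)) v) v := by
      simp_rw [gradMap_apply]
      fun_prop
    have h := enorm_sub_sq_le_lintegral hk hk'
    have hz : (1 : ℝ) • gradMap (fun i => g₁ i (a + (1 : ℝ) • v)) v - g (a + (1 : ℝ) • v) -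
        ((0 : ℝ) • gradMap (fun i => g₁ i (a + (0 : ℝ) • v)) v - g (a + (0 : ℝ) • v)) =
        g a - g x - gradMap (fun i => g₁ i x) (a - x) := by
      have : a - x = - v := by rw [hv, neg_sub]
      rw [this, map_neg]
      simp only [one_smul, zero_smul, add_zero, hv, add_sub_cancel]
      ring
    rw [hz] at h
    refine h.trans (setLIntegral_mono' measurableSet_Ioc fun s hs => ?_)
    have hs' : s ∈ Icc (0 : ℝ) 1 := ⟨hs.1.le, hs.2⟩
    have hpt : s • x + (1 - s) • a = a + s • v := by rw [hv]; module
    rw [hpt, indicator_of_mem (hmem s hs')]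
    refine enorm_sq_le_of_norm_sq_le Finset.univ (by positivity) ?_
    rw [norm_smul, mul_pow, Real.norm_eq_abs, sq_abs, mul_assoc]
    refine mul_le_mul_of_nonneg_left ((norm_gradMap_gradMap_sq_le _ v).trans ?_) (sq_nonneg _)
    have : ‖v‖ ≤ d := by rw [hv, ← dist_eq_norm]; exact hd x hx
    gcongr
  calc ∫⁻ x in V, ‖g a - g x - gradMap (fun i => g₁ i x) (a - x)‖ₑ ^ 2
      ≤ ∫⁻ x in V, ∫⁻ s in Ioc (0 : ℝ) 1,
          ENNReal.ofReal (s ^ 2 * d ^ 4) * V.indicator H (s • x + (1 - s) • a) :=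
        setLIntegral_mono' hVm key
    _ = ∫⁻ s in Ioc (0 : ℝ) 1, ∫⁻ x in V,
          ENNReal.ofReal (s ^ 2 * d ^ 4) * V.indicator H (s • x + (1 - s) • a) := by
        refine lintegral_lintegral_swap (Measurable.aemeasurable ?_)
        refine Measurable.mul (by fun_prop) (hHVm.comp ?_)
        fun_prop
    _ ≤ ∫⁻ s in Ioc (0 : ℝ) 1, ENNReal.ofReal (d ^ 4) * ∫⁻ x in V, H x := by
        refine setLIntegral_mono' measurableSet_Ioc fun s hs => ?_
        rw [lintegral_const_mul' _ _ ENNReal.ofReal_ne_top]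
        calc ENNReal.ofReal (s ^ 2 * d ^ 4) * ∫⁻ x in V, V.indicator H (s • x + (1 - s) • a)
            ≤ ENNReal.ofReal (s ^ 2 * d ^ 4) * ∫⁻ x, V.indicator H (s • x + (1 - s) • a) :=
              mul_le_mul' le_rfl (setLIntegral_le_lintegral _ _)
          _ = ENNReal.ofReal (d ^ 4) * ∫⁻ x in V, H x := by
              rw [lintegral_comp_smul_add hHVm hs.1, lintegral_indicator hVm, ← mul_assoc,
                ← ENNReal.ofReal_mul (by positivity)]
              congr 2
              have := hs.1.ne'
              field_simp
    _ = _ := by simp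

theorem lintegral_comp_smul_add_le {G : Plane → ENNReal} (hG : Measurable G) {s : ℝ}
    (hs : 1 / 2 ≤ s) (b : Plane) : ∫⁻ x, G (s • x + b) ≤ 4 * ∫⁻ x, G x := by
  rw [lintegral_comp_smul_add hG (by linarith)]
  refine mul_le_mul' ?_ le_rfl
  have h4 : (s ^ 2)⁻¹ ≤ 4 := by
    rw [inv_le_comm₀ (by nlinarith) (by norm_num)]
    nlinarith
  exact (ENNReal.ofReal_le_ofReal h4).trans (by simp)

/-- The Poincaré inequality on a convex set, for a smooth function and in double integral form.
Along the segment from `y` to `x`, the change of variables is made in whichever of the two end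
points is the closer one. -/
theorem lintegral_lintegral_sub_le {V : Set Plane} (hVc : Convex ℝ V) (hVm : MeasurableSet V)
    {g : Plane → ℂ} {g₁ : Fin 2 → Plane → ℂ} (hc₁ : ∀ i, Continuous (g₁ i))
    (h₁ : ∀ x ∈ V, HasFDerivAt g (gradMap fun i => g₁ i x) x)
    {d : ℝ} (hd : ∀ x ∈ V, ∀ y ∈ V, dist x y ≤ d) :
    ∫⁻ x in V, ∫⁻ y in V, ‖g x - g y‖ₑ ^ 2 ≤
      8 * volume V * (ENNReal.ofReal (d ^ 2) * ∫⁻ x in V, ∑ i, ‖g₁ i x‖ₑ ^ 2) := by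
  set H : Plane → ENNReal := fun x => ∑ i, ‖g₁ i x‖ₑ ^ 2 with hH
  have hHm : Measurable H :=
    Finset.measurable_sum _ fun i _ => ((hc₁ i).measurable.enorm.pow_const 2)
  set G : Plane → ENNReal := fun x => ENNReal.ofReal (d ^ 2) * V.indicator H x with hG
  have hGm : Measurable G := (hHm.indicator hVm).const_mul _
  have hGi : ∫⁻ x, G x = ENNReal.ofReal (d ^ 2) * ∫⁻ x in V, H x := by
    rw [hG, lintegral_const_mul' _ _ ENNReal.ofReal_ne_top, lintegral_indicator hVm]
  have key : ∀ x ∈ V, ∀ y ∈ V, ‖g x - g y‖ₑ ^ 2 ≤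
      (∫⁻ s in Ioc (0 : ℝ) (1 / 2), G ((1 - s) • y + s • x)) +
        ∫⁻ s in Ioc (1 / 2 : ℝ) 1, G (s • x + (1 - s) • y) := by
    intro x hx y hy
    set v := x - y with hv
    have hmem : ∀ s ∈ Icc (0 : ℝ) 1, y + s • v ∈ V := fun s hs =>
      hVc.add_smul_sub_mem hy hx hs
    have hline : ∀ s : ℝ, HasDerivAt (fun s : ℝ => y + s • v) v s := fun s => by
      simpa using ((hasDerivAt_id s).smul_const v).const_add y
    have hk : ∀ s ∈ Icc (0 : ℝ) 1, HasDerivAt (fun s : ℝ => g (y + s • v))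
        (gradMap (fun i => g₁ i (y + s • v)) v) s := fun s hs =>
      (h₁ _ (hmem s hs)).comp_hasDerivAt s (hline s)
    have hk' : Continuous fun s : ℝ => gradMap (fun i => g₁ i (y + s • v)) v := by
      simp_rw [gradMap_apply]
      fun_prop
    have h := enorm_sub_sq_le_lintegral hk hk'
    simp only [one_smul, zero_smul, add_zero, hv, add_sub_cancel] at h
    have hle : ∀ s ∈ Icc (0 : ℝ) 1, ‖gradMap (fun i => g₁ i (y + s • (x - y))) (x - y)‖ₑ ^ 2 ≤
        G (s • x + (1 - s) • y) := by
      intro s hs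
      have hpt : s • x + (1 - s) • y = y + s • v := by rw [hv]; module
      rw [hpt, hG]
      simp only
      rw [indicator_of_mem (hmem s hs)]
      refine enorm_sq_le_of_norm_sq_le Finset.univ (by positivity) ?_
      refine (norm_gradMap_sq_le _ _).trans ?_
      have : ‖x - y‖ ≤ d := by rw [← dist_eq_norm]; exact hd x hx y hy
      gcongr
    refine h.trans ?_
    rw [← Ioc_union_Ioc_eq_Ioc (a := (0 : ℝ)) (b := 1 / 2) (c := 1) (by norm_num) (by norm_num)]
    refine (lintegral_union_le _ _ _).trans (add_le_add ?_ ?_)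
    · refine setLIntegral_mono' measurableSet_Ioc fun s hs => ?_
      rw [add_comm ((1 - s) • y)]
      exact hle s ⟨hs.1.le, hs.2.trans (by norm_num)⟩
    · refine setLIntegral_mono' measurableSet_Ioc fun s hs => ?_
      exact hle s ⟨by linarith [hs.1], hs.2⟩
  have half1 : ∀ x : Plane, ∫⁻ y in V, ∫⁻ s in Ioc (0 : ℝ) (1 / 2), G ((1 - s) • y + s • x) ≤
      4 * ∫⁻ z, G z := by
    intro x
    have hm : Measurable fun p : Plane × ℝ => (1 - p.2) • p.1 + p.2 • x := by fun_prop
    rw [lintegral_lintegral_swap (f := fun y s => G ((1 - s) • y + s • x))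
      (hGm.comp hm).aemeasurable]
    calc ∫⁻ s in Ioc (0 : ℝ) (1 / 2), ∫⁻ y in V, G ((1 - s) • y + s • x)
        ≤ ∫⁻ s in Ioc (0 : ℝ) (1 / 2), 4 * ∫⁻ z, G z :=
          setLIntegral_mono' measurableSet_Ioc fun s hs =>
            (setLIntegral_le_lintegral _ _).trans
              (lintegral_comp_smul_add_le hGm (by linarith [hs.2]) _)
      _ ≤ 4 * ∫⁻ z, G z := by
          rw [lintegral_const, Measure.restrict_apply_univ, Real.volume_Ioc]
          refine mul_le_of_le_one_right' ?_
          rw [ENNReal.ofReal_le_one]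
          norm_num
  have half2 : ∀ y : Plane, ∫⁻ x in V, ∫⁻ s in Ioc (1 / 2 : ℝ) 1, G (s • x + (1 - s) • y) ≤
      4 * ∫⁻ z, G z := by
    intro y
    have hm : Measurable fun p : Plane × ℝ => p.2 • p.1 + (1 - p.2) • y := by fun_prop
    rw [lintegral_lintegral_swap (f := fun x s => G (s • x + (1 - s) • y))
      (hGm.comp hm).aemeasurable]
    calc ∫⁻ s in Ioc (1 / 2 : ℝ) 1, ∫⁻ x in V, G (s • x + (1 - s) • y)
        ≤ ∫⁻ s in Ioc (1 / 2 : ℝ) 1, 4 * ∫⁻ z, G z :=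
          setLIntegral_mono' measurableSet_Ioc fun s hs =>
            (setLIntegral_le_lintegral _ _).trans
              (lintegral_comp_smul_add_le hGm hs.1.le _)
      _ ≤ 4 * ∫⁻ z, G z := by
          rw [lintegral_const, Measure.restrict_apply_univ, Real.volume_Ioc]
          refine mul_le_of_le_one_right' ?_
          rw [ENNReal.ofReal_le_one]
          norm_num
  set K : Plane → Plane → ENNReal := fun x y =>
    ∫⁻ s in Ioc (1 / 2 : ℝ) 1, G (s • x + (1 - s) • y) with hK
  have hm2 : Measurable (Function.uncurry K) := by
    have hm : Measurable fun q : (Plane × Plane) × ℝ => q.2 • q.1.1 + (1 - q.2) • q.1.2 := by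
      fun_prop
    exact Measurable.lintegral_prod_right' (f := fun q : (Plane × Plane) × ℝ =>
      G (q.2 • q.1.1 + (1 - q.2) • q.1.2)) (hGm.comp hm)
  calc ∫⁻ x in V, ∫⁻ y in V, ‖g x - g y‖ₑ ^ 2
      ≤ ∫⁻ x in V, ∫⁻ y in V,
          ((∫⁻ s in Ioc (0 : ℝ) (1 / 2), G ((1 - s) • y + s • x)) + K x y) :=
        setLIntegral_mono' hVm fun x hx => setLIntegral_mono' hVm fun y hy => key x hx y hy
    _ = ∫⁻ x in V, ((∫⁻ y in V, ∫⁻ s in Ioc (0 : ℝ) (1 / 2), G ((1 - s) • y + s • x)) +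
          ∫⁻ y in V, K x y) :=
        lintegral_congr fun x => lintegral_add_right _ hm2.of_uncurry_left
    _ = (∫⁻ x in V, ∫⁻ y in V, ∫⁻ s in Ioc (0 : ℝ) (1 / 2), G ((1 - s) • y + s • x)) +
        ∫⁻ x in V, ∫⁻ y in V, K x y :=
        lintegral_add_right _ hm2.lintegral_prod_right'
    _ = (∫⁻ x in V, ∫⁻ y in V, ∫⁻ s in Ioc (0 : ℝ) (1 / 2), G ((1 - s) • y + s • x)) +
        ∫⁻ y in V, ∫⁻ x in V, K x y := by
        rw [lintegral_lintegral_swap hm2.aemeasurable]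
    _ ≤ (∫⁻ _ in V, 4 * ∫⁻ z, G z) + ∫⁻ _ in V, 4 * ∫⁻ z, G z :=
        add_le_add (lintegral_mono fun x => half1 x) (lintegral_mono fun y => half2 y)
    _ = _ := by
        rw [lintegral_const, Measure.restrict_apply_univ, hGi]
        ring

/-! ### Taylor and Poincaré estimates for Sobolev functions -/

/-- The interior of the set of centres of closed discs of radius `r` contained in `U`. -/
def erode (U : Set Plane) (r : ℝ) : Set Plane := interior {x | Metric.closedBall x r ⊆ U}

theorem isOpen_erode (U : Set Plane) (r : ℝ) : IsOpen (erode U r) := isOpen_interior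

theorem closedBall_subset_of_mem_erode {U : Set Plane} {r : ℝ} {x : Plane} (hx : x ∈ erode U r) :
    Metric.closedBall x r ⊆ U :=
  interior_subset (s := {x | Metric.closedBall x r ⊆ U}) hx

theorem erode_subset {U : Set Plane} {r : ℝ} (hr : 0 ≤ r) : erode U r ⊆ U := fun _ hx =>
  closedBall_subset_of_mem_erode hx (Metric.mem_closedBall_self hr)

theorem convex_erode {U : Set Plane} (hU : Convex ℝ U) (r : ℝ) : Convex ℝ (erode U r) := by
  refine Convex.interior fun x hx y hy s t hs ht hst z hz => ?_
  set w := z - (s • x + t • y) with hw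
  have hwr : ‖w‖ ≤ r := by rwa [hw, ← dist_eq_norm]
  have h1 : x + w ∈ U := hx (by simpa using hwr)
  have h2 : y + w ∈ U := hy (by simpa using hwr)
  have h3 : z = s • (x + w) + t • (y + w) := by
    rw [smul_add, smul_add, add_add_add_comm, ← add_smul, hst, one_smul, hw]
    abel
  rw [h3]
  exact hU h1 h2 hs ht hst

theorem eventually_mem_erode {U : Set Plane} (hU : IsOpen U) {x : Plane} (hx : x ∈ U) :
    ∀ᶠ m in atTop, x ∈ erode U (mollRadius m) := by
  obtain ⟨δ, hδ, hball⟩ := Metric.isOpen_iff.1 hU x hx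
  have h := tendsto_mollRadius.eventually (gt_mem_nhds (half_pos hδ))
  filter_upwards [h] with m hm
  refine mem_interior.2 ⟨Metric.ball x (δ / 2), fun y hy => ?_, Metric.isOpen_ball,
    Metric.mem_ball_self (half_pos hδ)⟩
  refine (Metric.closedBall_subset_ball' ?_).trans hball
  rw [Metric.mem_ball] at hy
  linarith

/-- A bound passes to a pointwise limit by Fatou's lemma. -/
theorem lintegral_le_of_ae_tendsto {α : Type*} [MeasurableSpace α] {μ : Measure α}
    {F : ℕ → α → ENNReal} (hF : ∀ m, AEMeasurable (F m) μ) {f : α → ENNReal}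
    (h : ∀ᵐ x ∂μ, Tendsto (fun m => F m x) atTop (𝓝 (f x))) {C : ENNReal}
    (hC : ∀ᶠ m in atTop, ∫⁻ x, F m x ∂μ ≤ C) : ∫⁻ x, f x ∂μ ≤ C := by
  calc ∫⁻ x, f x ∂μ = ∫⁻ x, liminf (fun m => F m x) atTop ∂μ :=
        lintegral_congr_ae (h.mono fun x hx => hx.liminf_eq.symm)
    _ ≤ liminf (fun m => ∫⁻ x, F m x ∂μ) atTop := lintegral_liminf_le' hF
    _ ≤ liminf (fun _ : ℕ => C) atTop := liminf_le_liminf hC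
    _ = C := by simp

theorem continuous_gradMap_apply {X : Type*} [TopologicalSpace X] {c : Fin 2 → X → ℂ}
    {v : X → Plane} (hc : ∀ i, Continuous (c i)) (hv : Continuous v) :
    Continuous fun x => gradMap (fun i => c i x) (v x) := by
  simp_rw [gradMap_apply]
  fun_prop

theorem tendsto_gradMap_apply {X : Type*} {l : Filter X} {c : Fin 2 → X → ℂ}
    {v : X → Plane} {c₀ : Fin 2 → ℂ} {v₀ : Plane} (hc : ∀ i, Tendsto (c i) l (𝓝 (c₀ i)))
    (hv : Tendsto v l (𝓝 v₀)) :
    Tendsto (fun x => gradMap (fun i => c i x) (v x)) l (𝓝 (gradMap c₀ v₀)) := by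
  simp_rw [gradMap_apply]
  refine tendsto_finsetSum _ fun i _ => Tendsto.smul ?_ (hc i)
  exact ((EuclideanSpace.proj i : Plane →L[ℝ] ℝ).continuous.tendsto v₀).comp hv

theorem tendsto_enorm_sq {X : Type*} {l : Filter X} {f : X → ℂ} {z : ℂ} (h : Tendsto f l (𝓝 z)) :
    Tendsto (fun x => ‖f x‖ₑ ^ 2) l (𝓝 (‖z‖ₑ ^ 2)) :=
  ENNReal.Tendsto.pow h.enorm

theorem lintegral_sum_enorm_mollify_le {ι : Type*} [Fintype ι] {Ω U : Set Plane} (hΩ : IsOpen Ω)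
    (hU : IsOpen U) (hUΩ : U ⊆ Ω) (m : ℕ) (D : ι → L2 Ω) :
    ∫⁻ x in erode U (mollRadius m), ∑ i, ‖mollify m (D i) x‖ₑ ^ 2 ≤
      ∫⁻ x in U, ∑ i, ‖D i x‖ₑ ^ 2 := by
  rw [lintegral_finsetSum, lintegral_finsetSum']
  · exact Finset.sum_le_sum fun i _ => lintegral_mollify_le hΩ hU.measurableSet hUΩ
      (isOpen_erode _ _).measurableSet (fun x hx => closedBall_subset_of_mem_erode hx) _
  · intro i _
    exact (((Lp.aestronglyMeasurable (D i)).mono_measure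
      (Measure.restrict_mono hUΩ le_rfl)).enorm.pow_const 2)
  · intro i _
    exact (continuous_mollify hΩ m (D i)).measurable.enorm.pow_const 2

/-- First-order Taylor expansion in `L²` of an `H²` function about a point `a` at which the
mollified functions converge to `z`. -/
theorem H1.lintegral_taylor_le {Ω U : Set Plane} (hΩ : IsOpen Ω) (hU : IsOpen U)
    (hUc : Convex ℝ U) (hUΩ : U ⊆ Ω) {u : H1 Ω} {D : Fin 2 → Fin 2 → L2 Ω}
    (hD : ∀ i j, IsWeakPartial Ω j (u.deriv i) (D i j)) {a : Plane} (ha : a ∈ U) {z : ℂ}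
    (hz : Tendsto (fun m => mollify m u.toL2 a) atTop (𝓝 z)) {d : ℝ}
    (hd : ∀ x ∈ U, dist x a ≤ d) :
    ∫⁻ x in U, ‖z - u.toL2 x - gradMap (fun i => u.deriv i x) (a - x)‖ₑ ^ 2 ≤
      ENNReal.ofReal (d ^ 4) * ∫⁻ x in U, ∑ p : Fin 2 × Fin 2, ‖D p.1 p.2 x‖ₑ ^ 2 := by
  have hV : ∀ m, erode U (mollRadius m) ⊆ U := fun m => erode_subset (mollRadius_pos m).le
  have hVm : ∀ m, MeasurableSet (erode U (mollRadius m)) := fun m =>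
    (isOpen_erode _ _).measurableSet
  set R : ℕ → Plane → ℂ := fun m x => mollify m u.toL2 a - mollify m u.toL2 x -
    gradMap (fun i => mollify m (u.deriv i) x) (a - x) with hR
  have hRc : ∀ m, Continuous (R m) := fun m =>
    (continuous_const.sub (continuous_mollify hΩ m _)).sub
      (continuous_gradMap_apply (fun i => continuous_mollify hΩ m _)
        (continuous_const.sub continuous_id))
  refine lintegral_le_of_ae_tendsto
    (F := fun m => (erode U (mollRadius m)).indicator fun x => ‖R m x‖ₑ ^ 2) (fun m => ?_) ?_ ?_
  · exact (((hRc m).measurable.enorm.pow_const 2).indicator (hVm m)).aemeasurable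
  · have hle : (volume : Measure Plane).restrict U ≤ volume.restrict Ω :=
      Measure.restrict_mono hUΩ le_rfl
    have hu := ae_mono hle (ae_tendsto_mollify hΩ u.toL2)
    have hu' := ae_all_iff.2 fun i => ae_mono hle (ae_tendsto_mollify hΩ (u.deriv i))
    filter_upwards [hu, hu', ae_restrict_mem hU.measurableSet] with x hx hx' hxU
    have h1 : Tendsto (fun m => ‖R m x‖ₑ ^ 2) atTop
        (𝓝 (‖z - u.toL2 x - gradMap (fun i => u.deriv i x) (a - x)‖ₑ ^ 2)) :=
      tendsto_enorm_sq ((hz.sub hx).sub (tendsto_gradMap_apply hx' tendsto_const_nhds))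
    refine h1.congr' ?_
    filter_upwards [eventually_mem_erode hU hxU] with m hm
    rw [indicator_of_mem hm]
  · filter_upwards [eventually_mem_erode hU ha] with m hm
    rw [lintegral_indicator (hVm m), Measure.restrict_restrict_of_subset (hV m)]
    refine (Steklov.lintegral_taylor_le (convex_erode hUc _) (hVm m)
      (g₁ := fun i => mollify m (u.deriv i)) (g₂ := fun i j => mollify m (D i j))
      (fun i j => continuous_mollify hΩ m _) (fun x hx => ?_) (fun i x hx => ?_) hm
      (fun x hx => hd x (hV m hx))).trans ?_
    · exact hasFDerivAt_mollify hΩ (fun i => u.2 i)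
        ((closedBall_subset_of_mem_erode hx).trans hUΩ)
    · exact hasFDerivAt_mollify hΩ (fun j => hD i j)
        ((closedBall_subset_of_mem_erode hx).trans hUΩ)
    · exact mul_le_mul' le_rfl
        (lintegral_sum_enorm_mollify_le hΩ hU hUΩ m fun p : Fin 2 × Fin 2 => D p.1 p.2)

/-- The Poincaré inequality on a convex subset, in double integral form. -/
theorem H1.lintegral_lintegral_sub_le {Ω U : Set Plane} (hΩ : IsOpen Ω) (hU : IsOpen U)
    (hUc : Convex ℝ U) (hUΩ : U ⊆ Ω) (u : H1 Ω) {d : ℝ}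
    (hd : ∀ x ∈ U, ∀ y ∈ U, dist x y ≤ d) :
    ∫⁻ x in U, ∫⁻ y in U, ‖u.toL2 x - u.toL2 y‖ₑ ^ 2 ≤
      8 * volume U * (ENNReal.ofReal (d ^ 2) * ∫⁻ x in U, ∑ i, ‖u.deriv i x‖ₑ ^ 2) := by
  have hV : ∀ m, erode U (mollRadius m) ⊆ U := fun m => erode_subset (mollRadius_pos m).le
  have hVm : ∀ m, MeasurableSet (erode U (mollRadius m)) := fun m =>
    (isOpen_erode _ _).measurableSet
  have hc := fun m => continuous_mollify hΩ m u.toL2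
  have hu := ae_mono (Measure.restrict_mono (μ := (volume : Measure Plane)) hUΩ le_rfl)
    (ae_tendsto_mollify hΩ u.toL2)
  set F : ℕ → Plane → Plane → ENNReal := fun m x y => (erode U (mollRadius m)).indicator
    (fun x => (erode U (mollRadius m)).indicator
      (fun y => ‖mollify m u.toL2 x - mollify m u.toL2 y‖ₑ ^ 2) y) x with hF
  have hFm : ∀ m, Measurable (Function.uncurry (F m)) := by
    intro m
    have h1 : Function.uncurry (F m) = (erode U (mollRadius m) ×ˢ erode U (mollRadius m)).indicator
        fun p => ‖mollify m u.toL2 p.1 - mollify m u.toL2 p.2‖ₑ ^ 2 := by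
      funext ⟨x, y⟩
      by_cases hx : x ∈ erode U (mollRadius m) <;> by_cases hy : y ∈ erode U (mollRadius m) <;>
        simp [hF, hx, hy]
    rw [h1]
    refine Measurable.indicator ?_ ((hVm m).prod (hVm m))
    exact (((hc m).comp continuous_fst).sub ((hc m).comp continuous_snd)).measurable.enorm.pow_const 2
  have hbound : ∀ m, ∫⁻ x in U, ∫⁻ y in U, F m x y ≤
      8 * volume U * (ENNReal.ofReal (d ^ 2) * ∫⁻ x in U, ∑ i, ‖u.deriv i x‖ₑ ^ 2) := by
    intro m
    have h1 : ∫⁻ x in U, ∫⁻ y in U, F m x y =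
        ∫⁻ x in erode U (mollRadius m), ∫⁻ y in erode U (mollRadius m),
          ‖mollify m u.toL2 x - mollify m u.toL2 y‖ₑ ^ 2 := by
      rw [← Measure.restrict_restrict_of_subset (hV m), ← lintegral_indicator (hVm m)]
      refine lintegral_congr fun x => ?_
      by_cases hx : x ∈ erode U (mollRadius m)
      · simp only [hF, indicator_of_mem hx]
        rw [lintegral_indicator (hVm m)]
      · simp [hF, hx]
    rw [h1]
    refine (Steklov.lintegral_lintegral_sub_le (convex_erode hUc _) (hVm m)
      (g₁ := fun i => mollify m (u.deriv i)) (fun i => continuous_mollify hΩ m _) (fun x hx => ?_)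
      (fun x hx y hy => hd x (hV m hx) y (hV m hy))).trans ?_
    · exact hasFDerivAt_mollify hΩ (fun i => u.2 i)
        ((closedBall_subset_of_mem_erode hx).trans hUΩ)
    · exact mul_le_mul' (mul_le_mul' le_rfl (measure_mono (hV m)))
        (mul_le_mul' le_rfl (lintegral_sum_enorm_mollify_le hΩ hU hUΩ m fun i => u.deriv i))
  -- Fatou's lemma, in the inner and then in the outer variable.
  calc ∫⁻ x in U, ∫⁻ y in U, ‖u.toL2 x - u.toL2 y‖ₑ ^ 2
      ≤ ∫⁻ x in U, liminf (fun m => ∫⁻ y in U, F m x y) atTop := by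
        refine lintegral_mono_ae ?_
        filter_upwards [hu, ae_restrict_mem hU.measurableSet] with x hx hxU
        refine le_trans (lintegral_mono_ae ?_)
          (lintegral_liminf_le fun m => (hFm m).of_uncurry_left (x := x))
        filter_upwards [hu, ae_restrict_mem hU.measurableSet] with y hy hyU
        refine (Tendsto.liminf_eq ?_).ge
        refine (tendsto_enorm_sq (hx.sub hy)).congr' ?_
        filter_upwards [eventually_mem_erode hU hxU, eventually_mem_erode hU hyU] with m hm hm'
        simp [hF, hm, hm']
    _ ≤ liminf (fun m => ∫⁻ x in U, ∫⁻ y in U, F m x y) atTop :=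
        lintegral_liminf_le fun m => (hFm m).lintegral_prod_right'
    _ ≤ liminf (fun _ : ℕ => _) atTop := liminf_le_liminf (Eventually.of_forall hbound)
    _ = _ := by simp

/-- The Poincaré inequality on a bounded convex subset: an `H¹` function is close to a
constant. -/
theorem H1.exists_lintegral_sub_const_le {Ω U : Set Plane} (hΩ : IsOpen Ω) (hU : IsOpen U)
    (hUc : Convex ℝ U) (hUΩ : U ⊆ Ω) (hUn : U.Nonempty) (u : H1 Ω) {d : ℝ}
    (hd : ∀ x ∈ U, ∀ y ∈ U, dist x y ≤ d) :
    ∃ c : ℂ, ∫⁻ x in U, ‖u.toL2 x - c‖ₑ ^ 2 ≤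
      ENNReal.ofReal (8 * d ^ 2) * ∫⁻ x in U, ∑ i, ‖u.deriv i x‖ₑ ^ 2 := by
  have hb : Bornology.IsBounded U := Metric.isBounded_iff.2 ⟨d, fun x hx y hy => hd x hx y hy⟩
  have hU0 : volume U ≠ 0 := (hU.measure_pos volume hUn).ne'
  have hUt : volume U ≠ ⊤ := hb.measure_lt_top.ne
  have hum : AEStronglyMeasurable u.toL2 ((volume : Measure Plane).restrict U) :=
    (Lp.aestronglyMeasurable u.toL2).mono_measure (Measure.restrict_mono hUΩ le_rfl)
  have hm : AEMeasurable (fun y => ∫⁻ x in U, ‖u.toL2 y - u.toL2 x‖ₑ ^ 2)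
      ((volume : Measure Plane).restrict U) := by
    refine AEMeasurable.lintegral_prod_right' (f := fun p : Plane × Plane =>
      ‖u.toL2 p.1 - u.toL2 p.2‖ₑ ^ 2) ?_
    exact ((hum.comp_fst.sub hum.comp_snd).enorm.pow_const 2)
  obtain ⟨y, hy, hyle⟩ := exists_le_setLAverage hU0 hUt hm
  refine ⟨u.toL2 y, ?_⟩
  calc ∫⁻ x in U, ‖u.toL2 x - u.toL2 y‖ₑ ^ 2 = ∫⁻ x in U, ‖u.toL2 y - u.toL2 x‖ₑ ^ 2 := by
        simp_rw [enorm_sub_rev]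
    _ ≤ (∫⁻ y in U, ∫⁻ x in U, ‖u.toL2 y - u.toL2 x‖ₑ ^ 2) / volume U := by
        rwa [setLAverage_eq] at hyle
    _ ≤ (8 * volume U * (ENNReal.ofReal (d ^ 2) * ∫⁻ x in U, ∑ i, ‖u.deriv i x‖ₑ ^ 2)) /
          volume U := by
        gcongr
        exact H1.lintegral_lintegral_sub_le hΩ hU hUc hUΩ u hd
    _ = _ := by
        rw [mul_comm 8, mul_assoc, ENNReal.mul_div_right_comm, ENNReal.div_self hU0 hUt, one_mul,
          ENNReal.ofReal_mul (by norm_num), mul_assoc]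
        simp

/-! ### Lipschitz boundaries -/

/-- Points of `Ω` close to a given point of its closure are joined, inside `Ω`, to a common disc by
convex sets of comparable size.  Near the boundary these are triangles opening upwards, steeper
than the graph which bounds `Ω`. -/
theorem HasLipschitzBoundary.exists_convex_of_mem_frontier {Ω : Set Plane}
    (h : HasLipschitzBoundary Ω) {x : Plane} (hx : x ∈ frontier Ω) :
    ∃ M : ℝ, 0 < M ∧ ∃ δ₀ : ℝ, 0 < δ₀ ∧ ∀ δ : ℝ, 0 < δ → δ < δ₀ → ∃ c : Plane,
      ∀ a ∈ Ω, dist a x < δ → ∃ U : Set Plane, IsOpen U ∧ Convex ℝ U ∧ U ⊆ Ω ∧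
        U ⊆ Metric.ball x (M * δ) ∧ a ∈ U ∧ Metric.ball c δ ⊆ U := by
  obtain ⟨e, r, K, φ, hr, hφ, hΩ⟩ := h x hx
  set L : ℝ := K + 1 with hL
  have hK0 : (0 : ℝ) ≤ K := K.2
  have hL1 : 1 ≤ L := by linarith
  have hcoord : ∀ (y z : Plane) (i : Fin 2), |e y i - e z i| ≤ dist y z := by
    intro y z i
    have := PiLp.norm_apply_le (e y - e z) i
    rwa [← map_sub, LinearIsometryEquiv.norm_map, map_sub, ← dist_eq_norm, Real.norm_eq_abs] at this
  have hdist : ∀ y : Plane, dist y x ≤ |e y 0 - e x 0| + |e y 1 - e x 1| := by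
    intro y
    rw [← e.dist_map, EuclideanSpace.dist_eq]
    refine Real.sqrt_le_iff.2 ⟨by positivity, ?_⟩
    simp only [Fin.sum_univ_two, Real.dist_eq]
    nlinarith [abs_nonneg (e y 0 - e x 0), abs_nonneg (e y 1 - e x 1)]
  -- In the coordinates of `e`, the triangle has its apex slightly below `a`, sides of slope `± L` and
  -- top at height `5 L δ` above `x`, which leaves room for a disc of radius `δ` about the point at
  -- height `4 L δ`; it lies within `13 L δ` of `x`.
  refine ⟨13 * L, by positivity, r / (13 * L), by positivity, fun δ hδ hδr => ?_⟩
  rw [lt_div_iff₀ (by positivity)] at hδr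
  set c : Plane := x + (4 * L * δ) • e.symm (EuclideanSpace.single 1 1) with hc
  have hc0 : e c 0 = e x 0 := by simp [hc]
  have hc1 : e c 1 = e x 1 + 4 * L * δ := by simp [hc]
  refine ⟨c, fun a ha hax => ?_⟩
  have har : a ∈ Metric.ball x r := by
    rw [Metric.mem_ball]
    nlinarith
  have hφa := (hΩ a har).1 ha
  obtain ⟨η, hη, hηδ, hηφ⟩ : ∃ η : ℝ, 0 < η ∧ η ≤ δ ∧ φ (e a 0) < e a 1 - η := by
    refine ⟨min δ ((e a 1 - φ (e a 0)) / 2), lt_min hδ (by linarith), min_le_left _ _, ?_⟩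
    have := min_le_right δ ((e a 1 - φ (e a 0)) / 2)
    linarith
  have ha0 := abs_lt.1 ((hcoord a x 0).trans_lt hax)
  have ha1 := abs_lt.1 ((hcoord a x 1).trans_lt hax)
  have hlin : ∀ p q : ℝ, IsLinearMap ℝ fun y : Plane => p * e y 0 + q * e y 1 := by
    intro p q
    constructor
    · intro y z
      simp only [map_add, PiLp.add_apply]
      ring
    · intro s y
      simp only [map_smul, PiLp.smul_apply, smul_eq_mul]
      ring
  have hcont : ∀ p q : ℝ, Continuous fun y : Plane => p * e y 0 + q * e y 1 := by
    intro p q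
    have he := e.continuous
    fun_prop
  set b : ℝ := e a 1 - η with hb
  have hLδ : δ ≤ L * δ := le_mul_of_one_le_left hδ.le hL1
  have hsub : ∀ y, L * e y 0 + (-1) * e y 1 < L * e a 0 - b →
      (-L) * e y 0 + (-1) * e y 1 < -L * e a 0 - b →
      0 * e y 0 + 1 * e y 1 < e x 1 + 5 * L * δ →
      L * |e y 0 - e a 0| < e y 1 - b ∧ y ∈ Metric.ball x (13 * L * δ) := by
    intro y h1 h2 h3
    have h4 : L * |e y 0 - e a 0| < e y 1 - b := by
      rcases abs_cases (e y 0 - e a 0) with ⟨h, _⟩ | ⟨h, _⟩ <;> rw [h] <;> linarith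
    refine ⟨h4, ?_⟩
    have h5 : |e y 0 - e a 0| ≤ 7 * δ := by
      have : L * |e y 0 - e a 0| < L * (7 * δ) := by linarith
      exact (lt_of_mul_lt_mul_left this (by linarith)).le
    have h6 : |e y 0 - e x 0| < 8 * δ := by
      have := abs_le.1 h5
      exact abs_lt.2 ⟨by linarith, by linarith⟩
    have h7 : |e y 1 - e x 1| ≤ 5 * L * δ := by
      have : 0 ≤ L * |e y 0 - e a 0| := by positivity
      exact abs_le.2 ⟨by linarith, by linarith⟩
    rw [Metric.mem_ball]
    have := hdist y
    linarith
  have hmem : ∀ y, |e y 0 - e a 0| < 2 * δ → 2 * L * δ ≤ e y 1 - b ∨ y = a →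
      e y 1 < e x 1 + 5 * L * δ →
      L * e y 0 + (-1) * e y 1 < L * e a 0 - b ∧
      (-L) * e y 0 + (-1) * e y 1 < -L * e a 0 - b ∧
      0 * e y 0 + 1 * e y 1 < e x 1 + 5 * L * δ := by
    intro y h1 h2 h3
    have h4 := abs_lt.1 h1
    have h5 : L * (e y 0 - e a 0) < L * (2 * δ) := mul_lt_mul_of_pos_left h4.2 (by linarith)
    have h6 : L * (-(2 * δ)) < L * (e y 0 - e a 0) := mul_lt_mul_of_pos_left h4.1 (by linarith)
    rcases h2 with h2 | rfl
    · exact ⟨by linarith, by linarith, by linarith⟩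
    · exact ⟨by linarith, by linarith, by linarith⟩
  refine ⟨{y | L * e y 0 + (-1) * e y 1 < L * e a 0 - b} ∩
    ({y | (-L) * e y 0 + (-1) * e y 1 < -L * e a 0 - b} ∩
      {y | 0 * e y 0 + 1 * e y 1 < e x 1 + 5 * L * δ}), ?_, ?_, ?_, ?_, ?_, ?_⟩
  · exact (isOpen_lt (hcont _ _) continuous_const).inter
      ((isOpen_lt (hcont _ _) continuous_const).inter (isOpen_lt (hcont _ _) continuous_const))
  · exact (convex_halfSpace_lt (hlin _ _) _).inter
      ((convex_halfSpace_lt (hlin _ _) _).inter (convex_halfSpace_lt (hlin _ _) _))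
  · rintro y ⟨h1, h2, h3⟩
    obtain ⟨h4, h5⟩ := hsub y h1 h2 h3
    refine (hΩ y (Metric.ball_subset_ball (by linarith) h5)).2 ?_
    have h6 := hφ.dist_le_mul (e y 0) (e a 0)
    rw [Real.dist_eq, Real.dist_eq] at h6
    have h7 := (abs_le.1 h6).2
    have h8 : 0 ≤ |e y 0 - e a 0| := abs_nonneg _
    have h9 : L * |e y 0 - e a 0| = K * |e y 0 - e a 0| + |e y 0 - e a 0| := by
      rw [hL]
      ring
    linarith
  · rintro y ⟨h1, h2, h3⟩
    exact (hsub y h1 h2 h3).2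
  · exact hmem a (by simpa using hδ) (Or.inr rfl) (by linarith)
  · intro y hy
    rw [Metric.mem_ball] at hy
    have hy0 := abs_lt.1 ((hcoord y c 0).trans_lt hy)
    have hy1 := abs_lt.1 ((hcoord y c 1).trans_lt hy)
    rw [hc0] at hy0
    rw [hc1] at hy1
    exact hmem y (abs_lt.2 ⟨by linarith, by linarith⟩) (Or.inl (by linarith)) (by linarith)

theorem HasLipschitzBoundary.exists_convex_of_mem_closure {Ω : Set Plane} (hΩ : IsOpen Ω)
    (h : HasLipschitzBoundary Ω) {x : Plane} (hx : x ∈ closure Ω) :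
    ∃ M : ℝ, 0 < M ∧ ∃ δ₀ : ℝ, 0 < δ₀ ∧ ∀ δ : ℝ, 0 < δ → δ < δ₀ → ∃ c : Plane,
      ∀ a ∈ Ω, dist a x < δ → ∃ U : Set Plane, IsOpen U ∧ Convex ℝ U ∧ U ⊆ Ω ∧
        U ⊆ Metric.ball x (M * δ) ∧ a ∈ U ∧ Metric.ball c δ ⊆ U := by
  by_cases hxΩ : x ∈ Ω
  · obtain ⟨δ₀, hδ₀, hball⟩ := Metric.isOpen_iff.1 hΩ x hxΩ
    refine ⟨1, one_pos, δ₀, hδ₀, fun δ _ hδ => ⟨x, fun a _ hax => ⟨Metric.ball x δ,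
      Metric.isOpen_ball, convex_ball _ _, (Metric.ball_subset_ball hδ.le).trans hball, ?_, hax,
      subset_rfl⟩⟩⟩
    rw [one_mul]
  · exact h.exists_convex_of_mem_frontier (by rw [hΩ.frontier_eq]; exact ⟨hx, hxΩ⟩)

/-- A Lipschitz domain lies on one side of its boundary. -/
theorem HasLipschitzBoundary.interior_closure_eq {Ω : Set Plane} (hΩ : IsOpen Ω)
    (h : HasLipschitzBoundary Ω) : interior (closure Ω) = Ω := by
  refine subset_antisymm (fun x hx => ?_) (interior_maximal subset_closure hΩ)
  by_contra hxΩ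
  have hxf : x ∈ frontier Ω := by
    rw [hΩ.frontier_eq]
    exact ⟨interior_subset hx, hxΩ⟩
  obtain ⟨e, r, K, φ, hr, hφ, hiff⟩ := h x hxf
  have hφx : e x 1 ≤ φ (e x 0) := by
    by_contra hlt
    exact hxΩ ((hiff x (Metric.mem_ball_self hr)).2 (not_le.1 hlt))
  obtain ⟨ρ, hρ, hball⟩ := Metric.isOpen_iff.1 isOpen_interior x hx
  set t : ℝ := min ρ r / 2 with ht
  have ht0 : 0 < t := by positivity
  have htρ : t < ρ := by
    have := min_le_left ρ r
    have : 0 < min ρ r := by positivity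
    linarith
  have htr : t < r := by
    have := min_le_right ρ r
    have : 0 < min ρ r := by positivity
    linarith
  -- A point just below the boundary, around which there are no points of `Ω`.
  set y : Plane := x - t • e.symm (EuclideanSpace.single 1 1) with hy
  have hyx : dist y x = t := by
    rw [dist_eq_norm, hy, sub_sub_cancel_left, norm_neg, norm_smul, LinearIsometryEquiv.norm_map]
    simp [abs_of_pos ht0]
  have hy0 : e y 0 = e x 0 := by simp [hy]
  have hy1 : e y 1 = e x 1 - t := by simp [hy]
  have hyc : y ∈ closure Ω := interior_subset (hball (by rw [Metric.mem_ball, hyx]; exact htρ))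
  have hopen : IsOpen ({z : Plane | e z 1 < φ (e z 0)} ∩ Metric.ball x r) := by
    have he := e.continuous
    have h1 : Continuous fun z : Plane => e z 1 := by fun_prop
    have h0 : Continuous fun z : Plane => e z 0 := by fun_prop
    exact (isOpen_lt h1 (hφ.continuous.comp h0)).inter Metric.isOpen_ball
  obtain ⟨z, ⟨hz, hzr⟩, hzΩ⟩ := mem_closure_iff.1 hyc _ hopen
    ⟨by simp only [mem_ofPred_eq]; rw [hy0, hy1]; linarith, by rw [Metric.mem_ball, hyx]; exact htr⟩
  exact lt_asymm hz ((hiff z hzr).1 hzΩ)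

/-! ### The continuous representative of an `H²` function -/

theorem H1.aestronglyMeasurable_taylor {Ω : Set Plane} (u : H1 Ω) (a : Plane) (z : ℂ) :
    AEStronglyMeasurable (fun x => z - u.toL2 x - gradMap (fun i => u.deriv i x) (a - x))
      ((volume : Measure Plane).restrict Ω) := by
  simp_rw [gradMap_apply]
  refine (aestronglyMeasurable_const.sub (Lp.aestronglyMeasurable _)).sub ?_
  refine Finset.aestronglyMeasurable_fun_sum _ fun i _ => ?_
  have h : Continuous fun x : Plane => (a - x) i := by fun_prop
  exact h.aestronglyMeasurable.smul (Lp.aestronglyMeasurable (u.deriv i))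

theorem enorm_add_add_sq_le (x y z : ℂ) :
    ‖x + y + z‖ₑ ^ 2 ≤ 3 * (‖x‖ₑ ^ 2 + ‖y‖ₑ ^ 2 + ‖z‖ₑ ^ 2) := by
  have h := enorm_sq_le_of_norm_sq_le (z := x + y + z) (c := ![x, y, z]) (D := 3) Finset.univ
    (by norm_num) (by
      have := norm_sum_smul_sq_le Finset.univ (fun _ => 1) ![x, y, z]
      simp only [Fin.sum_univ_three] at this ⊢
      simp at this ⊢
      linarith)
  simp only [Fin.sum_univ_three] at h
  simpa using h

/-- The points of `Ω` at which the mollified functions converge to `u`. -/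
def mollSet {Ω : Set Plane} (u : L2 Ω) : Set Plane :=
  {a ∈ Ω | Tendsto (fun m => mollify m u a) atTop (𝓝 (u a))}

theorem ae_mem_mollSet {Ω : Set Plane} (hΩ : IsOpen Ω) (u : L2 Ω) :
    ∀ᵐ x ∂((volume : Measure Plane).restrict Ω), x ∈ mollSet u := by
  filter_upwards [ae_tendsto_mollify hΩ u, ae_restrict_mem hΩ.measurableSet] with x hx hxΩ
  exact ⟨hxΩ, hx⟩

theorem exists_mem_mollSet {Ω W : Set Plane} (hΩ : IsOpen Ω) (u : L2 Ω) (hW : IsOpen W)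
    (hWΩ : W ⊆ Ω) (hWn : W.Nonempty) : ∃ a ∈ W, a ∈ mollSet u := by
  by_contra! hcon
  have h1 : ∀ᵐ x ∂((volume : Measure Plane).restrict W), False := by
    filter_upwards [ae_mono (Measure.restrict_mono hWΩ le_rfl) (ae_mem_mollSet hΩ u),
      ae_restrict_mem hW.measurableSet] with x hx hxW
    exact hcon x hxW hx
  have h2 : volume W = 0 := by
    rw [← Measure.restrict_eq_zero, ← ae_eq_bot, ← Filter.eventually_false_iff_eq_bot]
    exact h1
  exact (hW.measure_pos volume hWn).ne' h2

theorem subset_closure_mollSet_inter {Ω W : Set Plane} (hΩ : IsOpen Ω) (u : L2 Ω) (hW : IsOpen W)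
    (hWΩ : W ⊆ Ω) : W ⊆ closure (mollSet u ∩ W) := by
  intro x hx
  rw [mem_closure_iff]
  intro O hO hxO
  obtain ⟨a, ⟨haO, haW⟩, ha⟩ := exists_mem_mollSet hΩ u (hO.inter hW)
    (inter_subset_right.trans hWΩ) ⟨x, hxO, hx⟩
  exact ⟨a, haO, ha, haW⟩

/-- The oscillation of an `H²` function over a convex set of size `δ`. -/
theorem H1.enorm_sub_sq_le {Ω U : Set Plane} (hΩ : IsOpen Ω) (hU : IsOpen U)
    (hUc : Convex ℝ U) (hUΩ : U ⊆ Ω) {u : H1 Ω} {D : Fin 2 → Fin 2 → L2 Ω}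
    (hD : ∀ i j, IsWeakPartial Ω j (u.deriv i) (D i j)) {x c : Plane} {M δ : ℝ} (hδ : 0 < δ)
    (hUx : U ⊆ Metric.ball x (M * δ)) (hc : Metric.ball c δ ⊆ U) {a b : Plane}
    (ha : a ∈ mollSet u.toL2) (haU : a ∈ U) (hb : b ∈ mollSet u.toL2) (hbU : b ∈ U) :
    ‖u.toL2 a - u.toL2 b‖ₑ ^ 2 ≤
      ENNReal.ofReal (96 * M ^ 4 * δ ^ 2) * (∫⁻ y in Ω, ∑ p : Fin 2 × Fin 2, ‖D p.1 p.2 y‖ₑ ^ 2) +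
        ENNReal.ofReal (12 * M ^ 2) *
          ∫⁻ y in Metric.ball x (M * δ), ∑ i, ‖u.deriv i y‖ₑ ^ 2 ∂(volume.restrict Ω) := by
  set d : ℝ := 2 * M * δ with hd
  have hdist : ∀ y ∈ U, ∀ z ∈ U, dist y z ≤ d := fun y hy z hz => by
    have h1 := Metric.mem_ball.1 (hUx hy)
    have h2 := Metric.mem_ball'.1 (hUx hz)
    have := dist_triangle y x z
    linarith
  have hle : (volume : Measure Plane).restrict U ≤ volume.restrict Ω :=
    Measure.restrict_mono hUΩ le_rfl
  have hm : ∀ a : Plane, AEMeasurable (fun y => ‖u.toL2 a - u.toL2 y -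
      gradMap (fun i => u.deriv i y) (a - y)‖ₑ ^ 2) ((volume : Measure Plane).restrict U) := fun a =>
    ((u.aestronglyMeasurable_taylor a _).mono_measure hle).enorm.pow_const 2
  have hT : ∀ a ∈ mollSet u.toL2, a ∈ U → ∫⁻ y in U, ‖u.toL2 a - u.toL2 y -
      gradMap (fun i => u.deriv i y) (a - y)‖ₑ ^ 2 ≤ ENNReal.ofReal (d ^ 4) *
        ∫⁻ y in Ω, ∑ p : Fin 2 × Fin 2, ‖D p.1 p.2 y‖ₑ ^ 2 := fun a ha haU =>
    (H1.lintegral_taylor_le hΩ hU hUc hUΩ hD haU ha.2 fun y hy => hdist y hy a haU).trans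
      (mul_le_mul' le_rfl (lintegral_mono' hle le_rfl))
  have hG : ∫⁻ y in U, ‖gradMap (fun i => u.deriv i y) (a - b)‖ₑ ^ 2 ≤ ENNReal.ofReal (d ^ 2) *
      ∫⁻ y in Metric.ball x (M * δ), ∑ i, ‖u.deriv i y‖ₑ ^ 2 ∂(volume.restrict Ω) := by
    calc ∫⁻ y in U, ‖gradMap (fun i => u.deriv i y) (a - b)‖ₑ ^ 2
        ≤ ∫⁻ y in U, ENNReal.ofReal (d ^ 2) * ∑ i, ‖u.deriv i y‖ₑ ^ 2 := by
          refine lintegral_mono fun y => enorm_sq_le_of_norm_sq_le _ (sq_nonneg d) ?_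
          refine (norm_gradMap_sq_le _ _).trans ?_
          have : ‖a - b‖ ≤ d := by rw [← dist_eq_norm]; exact hdist a haU b hbU
          gcongr
      _ = ENNReal.ofReal (d ^ 2) * ∫⁻ y in U, ∑ i, ‖u.deriv i y‖ₑ ^ 2 :=
          lintegral_const_mul' _ _ ENNReal.ofReal_ne_top
      _ ≤ _ := by
          refine mul_le_mul' le_rfl (lintegral_mono' ?_ le_rfl)
          rw [Measure.restrict_restrict Metric.isOpen_ball.measurableSet]
          exact Measure.restrict_mono (subset_inter hUx hUΩ) le_rfl
  have hvol : ENNReal.ofReal (δ ^ 2) ≤ volume U := by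
    refine le_trans ?_ (measure_mono hc)
    rw [EuclideanSpace.volume_ball_fin_two, ENNReal.ofReal_pow hδ.le]
    refine le_mul_of_one_le_right' ?_
    rw [ENNReal.one_le_ofReal]
    linarith [Real.pi_gt_three]
  have hmain : ENNReal.ofReal (δ ^ 2) * ‖u.toL2 a - u.toL2 b‖ₑ ^ 2 ≤ ENNReal.ofReal (δ ^ 2) *
      (ENNReal.ofReal (96 * M ^ 4 * δ ^ 2) *
        (∫⁻ y in Ω, ∑ p : Fin 2 × Fin 2, ‖D p.1 p.2 y‖ₑ ^ 2) +
        ENNReal.ofReal (12 * M ^ 2) *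
          ∫⁻ y in Metric.ball x (M * δ), ∑ i, ‖u.deriv i y‖ₑ ^ 2 ∂(volume.restrict Ω)) := by
    calc ENNReal.ofReal (δ ^ 2) * ‖u.toL2 a - u.toL2 b‖ₑ ^ 2
        ≤ volume U * ‖u.toL2 a - u.toL2 b‖ₑ ^ 2 := mul_le_mul' hvol le_rfl
      _ = ∫⁻ _ in U, ‖u.toL2 a - u.toL2 b‖ₑ ^ 2 := by
          rw [lintegral_const, Measure.restrict_apply_univ, mul_comm]
      _ ≤ ∫⁻ y in U, 3 * (‖u.toL2 a - u.toL2 y - gradMap (fun i => u.deriv i y) (a - y)‖ₑ ^ 2 +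
            ‖u.toL2 b - u.toL2 y - gradMap (fun i => u.deriv i y) (b - y)‖ₑ ^ 2 +
            ‖gradMap (fun i => u.deriv i y) (a - b)‖ₑ ^ 2) := by
          refine lintegral_mono fun y => ?_
          have h := enorm_add_add_sq_le
            (u.toL2 a - u.toL2 y - gradMap (fun i => u.deriv i y) (a - y))
            (-(u.toL2 b - u.toL2 y - gradMap (fun i => u.deriv i y) (b - y)))
            (gradMap (fun i => u.deriv i y) (a - b))
          rw [enorm_neg] at h
          refine le_trans (le_of_eq ?_) h
          congr 2
          simp only [map_sub]
          ring
      _ = 3 * ((∫⁻ y in U, ‖u.toL2 a - u.toL2 y - gradMap (fun i => u.deriv i y) (a - y)‖ₑ ^ 2) +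
            (∫⁻ y in U, ‖u.toL2 b - u.toL2 y - gradMap (fun i => u.deriv i y) (b - y)‖ₑ ^ 2) +
            ∫⁻ y in U, ‖gradMap (fun i => u.deriv i y) (a - b)‖ₑ ^ 2) := by
          rw [lintegral_const_mul' _ _ (by norm_num)]
          congr 1
          exact (lintegral_add_left' ((hm a).add (hm b)) _).trans
            (congrArg (· + _) (lintegral_add_left' (hm a) _))
      _ ≤ 3 * (ENNReal.ofReal (d ^ 4) * (∫⁻ y in Ω, ∑ p : Fin 2 × Fin 2, ‖D p.1 p.2 y‖ₑ ^ 2) +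
            ENNReal.ofReal (d ^ 4) * (∫⁻ y in Ω, ∑ p : Fin 2 × Fin 2, ‖D p.1 p.2 y‖ₑ ^ 2) +
            ENNReal.ofReal (d ^ 2) * ∫⁻ y in Metric.ball x (M * δ),
              ∑ i, ‖u.deriv i y‖ₑ ^ 2 ∂(volume.restrict Ω)) :=
          mul_le_mul' le_rfl (add_le_add (add_le_add (hT a ha haU) (hT b hb hbU)) hG)
      _ = _ := by
          have e1 : ENNReal.ofReal (d ^ 4) = ENNReal.ofReal (δ ^ 2) *
              ENNReal.ofReal (16 * M ^ 4 * δ ^ 2) := by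
            rw [← ENNReal.ofReal_mul (sq_nonneg _), hd]
            ring_nf
          have e2 : ENNReal.ofReal (d ^ 2) = ENNReal.ofReal (δ ^ 2) *
              ENNReal.ofReal (4 * M ^ 2) := by
            rw [← ENNReal.ofReal_mul (sq_nonneg _), hd]
            ring_nf
          have e3 : ENNReal.ofReal (96 * M ^ 4 * δ ^ 2) = 6 * ENNReal.ofReal (16 * M ^ 4 * δ ^ 2) := by
            rw [← ENNReal.ofReal_ofNat 6, ← ENNReal.ofReal_mul (by norm_num)]
            ring_nf
          have e4 : ENNReal.ofReal (12 * M ^ 2) = 3 * ENNReal.ofReal (4 * M ^ 2) := by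
            rw [← ENNReal.ofReal_ofNat 3, ← ENNReal.ofReal_mul (by norm_num)]
            ring_nf
          rw [e1, e2, e3, e4]
          ring
  exact (ENNReal.mul_le_mul_iff_right (by simpa using hδ.ne') ENNReal.ofReal_ne_top).1 hmain

theorem lintegral_enorm_sq_eq {Ω : Set Plane} (f : L2 Ω) :
    ∫⁻ x in Ω, ‖f x‖ₑ ^ 2 = ENNReal.ofReal (‖f‖ ^ 2) := by
  rw [ENNReal.ofReal_pow (norm_nonneg _), ofReal_norm, Lp.enorm_def,
    eLpNorm_eq_lintegral_rpow_enorm_toReal (by norm_num) (by norm_num), ← ENNReal.rpow_natCast,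
    ← ENNReal.rpow_mul]
  norm_num

theorem lintegral_sum_enorm_sq_eq {ι : Type*} [Fintype ι] {Ω : Set Plane} (f : ι → L2 Ω) :
    ∫⁻ x in Ω, ∑ i, ‖f i x‖ₑ ^ 2 = ENNReal.ofReal (∑ i, ‖f i‖ ^ 2) := by
  rw [lintegral_finsetSum' _ fun i _ => (Lp.aestronglyMeasurable (f i)).enorm.pow_const 2,
    ENNReal.ofReal_sum_of_nonneg fun _ _ => sq_nonneg _]
  simp_rw [lintegral_enorm_sq_eq]

theorem tendsto_lintegral_ball_zero {Ω : Set Plane} {f : Plane → ENNReal}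
    (hf : ∫⁻ y in Ω, f y ≠ ⊤) (x : Plane) (M : ℝ) :
    Tendsto (fun δ : ℝ => ∫⁻ y in Metric.ball x (M * δ), f y ∂(volume.restrict Ω)) (𝓝 0) (𝓝 0) := by
  refine tendsto_setLIntegral_zero hf ?_
  have h1 : Tendsto (fun δ : ℝ => ENNReal.ofReal (M * δ) ^ 2 * ENNReal.ofReal Real.pi) (𝓝 0) (𝓝 0) := by
    have h2 : Tendsto (fun δ : ℝ => ENNReal.ofReal (M * δ)) (𝓝 0) (𝓝 (ENNReal.ofReal (M * 0))) :=
      ENNReal.tendsto_ofReal (tendsto_const_nhds.mul tendsto_id)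
    have h3 := ENNReal.Tendsto.mul_const (b := ENNReal.ofReal Real.pi)
      (ENNReal.Tendsto.pow (n := 2) h2) (Or.inr ENNReal.ofReal_ne_top)
    simpa using h3
  refine tendsto_of_tendsto_of_tendsto_of_le_of_le tendsto_const_nhds h1 (fun _ => zero_le)
    fun δ => ?_
  rw [← EuclideanSpace.volume_ball_fin_two x]
  exact Measure.restrict_apply_le _ _

/-- The values of an `H²` function satisfy a Cauchy criterion at every point `x` of the closure: two
values near `x` are compared through a point of a common disc, and the oscillation bound tends to
zero with the size `δ` of the convex sets used. -/
theorem H1.exists_tendsto_of_mem_closure {Ω : Set Plane} (hΩ : IsOpen Ω)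
    (hL : HasLipschitzBoundary Ω) {u : H1 Ω} {D : Fin 2 → Fin 2 → L2 Ω}
    (hD : ∀ i j, IsWeakPartial Ω j (u.deriv i) (D i j)) {x : Plane} (hx : x ∈ closure Ω) :
    ∃ z : ℂ, Tendsto u.toL2 (𝓝[mollSet u.toL2] x) (𝓝 z) := by
  have hxA : x ∈ closure (mollSet u.toL2) := by
    have := subset_closure_mollSet_inter hΩ u.toL2 hΩ subset_rfl
    exact closure_minimal (this.trans (closure_mono inter_subset_left)) isClosed_closure hx
  have hne : (𝓝[mollSet u.toL2] x).NeBot := mem_closure_iff_nhdsWithin_neBot.1 hxA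
  refine cauchy_map_iff_exists_tendsto.1 (Metric.cauchy_iff.2 ⟨inferInstance, fun ε hε => ?_⟩)
  obtain ⟨M, hM, δ₀, hδ₀, hgeo⟩ := hL.exists_convex_of_mem_closure hΩ hx
  have hI₂ : ∫⁻ y in Ω, ∑ p : Fin 2 × Fin 2, ‖D p.1 p.2 y‖ₑ ^ 2 ≠ ⊤ := by
    rw [lintegral_sum_enorm_sq_eq fun p : Fin 2 × Fin 2 => D p.1 p.2]
    exact ENNReal.ofReal_ne_top
  have hI₁ : ∫⁻ y in Ω, ∑ i, ‖u.deriv i y‖ₑ ^ 2 ≠ ⊤ := by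
    rw [lintegral_sum_enorm_sq_eq]
    exact ENNReal.ofReal_ne_top
  have hlim : Tendsto (fun δ : ℝ => ENNReal.ofReal (96 * M ^ 4 * δ ^ 2) *
      (∫⁻ y in Ω, ∑ p : Fin 2 × Fin 2, ‖D p.1 p.2 y‖ₑ ^ 2) +
        ENNReal.ofReal (12 * M ^ 2) *
          ∫⁻ y in Metric.ball x (M * δ), ∑ i, ‖u.deriv i y‖ₑ ^ 2 ∂(volume.restrict Ω))
      (𝓝 0) (𝓝 0) := by
    have h1 : Tendsto (fun δ : ℝ => ENNReal.ofReal (96 * M ^ 4 * δ ^ 2)) (𝓝 0) (𝓝 0) := by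
      have : Tendsto (fun δ : ℝ => ENNReal.ofReal (96 * M ^ 4 * δ ^ 2)) (𝓝 0)
          (𝓝 (ENNReal.ofReal (96 * M ^ 4 * 0 ^ 2))) :=
        ENNReal.tendsto_ofReal (Continuous.tendsto (by fun_prop) 0)
      simpa using this
    have h2 := (ENNReal.Tendsto.mul_const h1 (Or.inr hI₂)).add
      (ENNReal.Tendsto.const_mul (a := ENNReal.ofReal (12 * M ^ 2))
        (tendsto_lintegral_ball_zero hI₁ x M) (Or.inr ENNReal.ofReal_ne_top))
    simpa using h2
  have hε2 : (0 : ENNReal) < ENNReal.ofReal ((ε / 2) ^ 2) := by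
    rw [ENNReal.ofReal_pos]
    positivity
  have hsmall := (hlim.eventually (gt_mem_nhds hε2)).and (gt_mem_nhds hδ₀)
  obtain ⟨δ, ⟨hδlt, hδδ₀⟩, hδ⟩ := ((hsmall.filter_mono (nhdsWithin_le_nhds (s := Ioi 0))).and
    self_mem_nhdsWithin).exists
  obtain ⟨c, hc⟩ := hgeo δ hδ hδδ₀
  have hclose : ∀ a ∈ mollSet u.toL2, dist a x < δ → ∀ b ∈ mollSet u.toL2,
      b ∈ Metric.ball c δ → dist (u.toL2 a) (u.toL2 b) < ε / 2 := by
    intro a ha hax b hb hbc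
    obtain ⟨U, hU, hUc, hUΩ, hUx, haU, hcU⟩ := hc a ha.1 hax
    have h := (H1.enorm_sub_sq_le hΩ hU hUc hUΩ hD hδ hUx hcU ha haU hb (hcU hbc)).trans_lt hδlt
    rw [enorm_sq_eq, ENNReal.ofReal_lt_ofReal_iff (by positivity)] at h
    rw [dist_eq_norm]
    exact lt_of_pow_lt_pow_left₀ 2 (by positivity) h
  refine ⟨u.toL2 '' (mollSet u.toL2 ∩ Metric.ball x δ), image_mem_map ?_, ?_⟩
  · exact inter_mem self_mem_nhdsWithin (mem_nhdsWithin_of_mem_nhds (Metric.ball_mem_nhds x hδ))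
  · rintro _ ⟨a, ⟨ha, hax⟩, rfl⟩ _ ⟨b, ⟨hb, hbx⟩, rfl⟩
    obtain ⟨U, _, _, hUΩ, _, _, hcU⟩ := hc a ha.1 hax
    obtain ⟨y, hyc, hy⟩ := exists_mem_mollSet hΩ u.toL2 Metric.isOpen_ball (hcU.trans hUΩ)
      ⟨c, Metric.mem_ball_self hδ⟩
    have h1 := hclose a ha hax y hy hyc
    have h2 := hclose b hb hbx y hy hyc
    have h3 := dist_triangle_right (u.toL2 a) (u.toL2 b) (u.toL2 y)
    linarith

/-- An `H²` function on a Lipschitz domain is continuous up to the boundary, and the `L²` Taylor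
expansion on convex subsets holds about every point of their closures. -/
theorem H1.exists_continuousOn_rep {Ω : Set Plane} (hΩ : IsOpen Ω)
    (hL : HasLipschitzBoundary Ω) {u : H1 Ω} {D : Fin 2 → Fin 2 → L2 Ω}
    (hD : ∀ i j, IsWeakPartial Ω j (u.deriv i) (D i j)) :
    ∃ φ : Plane → ℂ, ContinuousOn φ (closure Ω) ∧
      ∀ U : Set Plane, IsOpen U → Convex ℝ U → U ⊆ Ω → ∀ d : ℝ,
        (∀ x ∈ U, ∀ y ∈ U, dist x y ≤ d) → ∀ a ∈ closure U,
        ∫⁻ x in U, ‖φ a - u.toL2 x - gradMap (fun i => u.deriv i x) (a - x)‖ₑ ^ 2 ≤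
          ENNReal.ofReal (d ^ 4) * ∫⁻ x in U, ∑ p : Fin 2 × Fin 2, ‖D p.1 p.2 x‖ₑ ^ 2 := by
  have hlim := fun x (hx : x ∈ closure Ω) => H1.exists_tendsto_of_mem_closure hΩ hL hD hx
  have hcl : closure Ω ⊆ closure (mollSet u.toL2) := by
    have := subset_closure_mollSet_inter hΩ u.toL2 hΩ subset_rfl
    exact closure_minimal (this.trans (closure_mono inter_subset_left)) isClosed_closure
  have hφc : ContinuousOn (extendFrom (mollSet u.toL2) u.toL2) (closure Ω) :=
    continuousOn_extendFrom hcl hlim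
  have hφA : ∀ a ∈ mollSet u.toL2, extendFrom (mollSet u.toL2) u.toL2 a = u.toL2 a := by
    intro a ha
    obtain ⟨z, hz⟩ := hlim a (subset_closure ha.1)
    rw [extendFrom_eq (subset_closure ha) hz]
    have h1 : pure a ≤ 𝓝[mollSet u.toL2] a := pure_le_nhdsWithin ha
    have h2 := hz.mono_left h1
    exact (tendsto_nhds_unique h2 (tendsto_pure_nhds _ _))
  refine ⟨extendFrom (mollSet u.toL2) u.toL2, hφc, fun U hU hUc hUΩ d hd a ha => ?_⟩
  set φ := extendFrom (mollSet u.toL2) u.toL2 with hφ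
  have haA : a ∈ closure (mollSet u.toL2 ∩ U) :=
    closure_minimal (subset_closure_mollSet_inter hΩ u.toL2 hU hUΩ) isClosed_closure ha
  obtain ⟨b, hb, hba⟩ := mem_closure_iff_seq_limit.1 haA
  have hφb : Tendsto (fun m => φ (b m)) atTop (𝓝 (φ a)) := by
    have hac : a ∈ closure Ω := closure_mono hUΩ ha
    refine (hφc a hac).tendsto.comp (tendsto_nhdsWithin_iff.2 ⟨hba, ?_⟩)
    exact Eventually.of_forall fun m => subset_closure (hb m).1.1
  refine lintegral_le_of_ae_tendsto
    (F := fun m x => ‖φ (b m) - u.toL2 x - gradMap (fun i => u.deriv i x) (b m - x)‖ₑ ^ 2)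
    (fun m => ?_) (Eventually.of_forall fun x => ?_) (Eventually.of_forall fun m => ?_)
  · exact (((u.aestronglyMeasurable_taylor (b m) _).mono_measure
      (Measure.restrict_mono hUΩ le_rfl)).enorm.pow_const 2)
  · exact tendsto_enorm_sq ((hφb.sub tendsto_const_nhds).sub
      (tendsto_gradMap_apply (fun i => tendsto_const_nhds) (hba.sub tendsto_const_nhds)))
  · rw [hφA _ (hb m).1]
    exact H1.lintegral_taylor_le hΩ hU hUc hUΩ hD (hb m).2 (hb m).1.2
      fun y hy => hd y hy _ (hb m).2

/-! ### Triangulations -/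

/-- The closed triangle with vertex set `t`. -/
abbrev triangle (t : Finset Plane) : Set Plane := convexHull ℝ (t : Set Plane)

theorem isCompact_triangle (t : Finset Plane) : IsCompact (triangle t) :=
  t.finite_toSet.isCompact_convexHull ℝ

theorem convex_triangle (t : Finset Plane) : Convex ℝ (triangle t) := convex_convexHull ℝ _

theorem Mesh.dist_le_diam (t : Finset Plane) {x y : Plane}
    (hx : x ∈ triangle t) (hy : y ∈ triangle t) : dist x y ≤ Metric.diam (triangle t) :=
  Metric.dist_le_diam_of_mem (isCompact_triangle t).isBounded hx hy

theorem Mesh.diam_le_size {Ω : Set Plane} (T : Mesh Ω) {t : Finset Plane} (ht : t ∈ T.cells) :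
    Metric.diam (triangle t) ≤ T.size :=
  le_ciSup (f := fun t : T.cells => Metric.diam (triangle t)) (Set.finite_range _).bddAbove ⟨t, ht⟩

theorem Mesh.size_nonneg {Ω : Set Plane} (T : Mesh Ω) : 0 ≤ T.size :=
  Real.iSup_nonneg fun _ => Metric.diam_nonneg

theorem Mesh.triangle_subset {Ω : Set Plane} (T : Mesh Ω) {t : Finset Plane} (ht : t ∈ T.cells) :
    triangle t ⊆ closure Ω := by
  rw [← T.iUnion_eq]
  exact subset_iUnion₂_of_subset t ht subset_rfl

theorem Mesh.exists_mem_triangle {Ω : Set Plane} (T : Mesh Ω) {x : Plane} (hx : x ∈ closure Ω) :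
    ∃ t ∈ T.cells, x ∈ triangle t := by
  rw [← T.iUnion_eq] at hx
  simpa using hx

theorem Mesh.interior_subset {Ω : Set Plane} (hΩ : IsOpen Ω) (hL : HasLipschitzBoundary Ω)
    (T : Mesh Ω) {t : Finset Plane} (ht : t ∈ T.cells) : interior (triangle t) ⊆ Ω := by
  rw [← hL.interior_closure_eq hΩ]
  exact interior_mono (T.triangle_subset ht)

theorem Mesh.nonempty_interior {Ω : Set Plane} (T : Mesh Ω) {t : Finset Plane}
    (ht : t ∈ T.cells) : (interior (triangle t)).Nonempty := by
  rw [interior_convexHull_nonempty_iff_affineSpan_eq_top]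
  have h := (T.affineIndependent t ht).affineSpan_eq_top_iff_card_eq_finrank_add_one
  rw [Subtype.range_coe] at h
  refine h.2 ?_
  rw [Fintype.card_coe, T.card_eq t ht, finrank_euclideanSpace_fin]

theorem Mesh.closure_interior {Ω : Set Plane} (T : Mesh Ω) {t : Finset Plane}
    (ht : t ∈ T.cells) : closure (interior (triangle t)) = triangle t := by
  rw [(convex_triangle t).closure_interior_eq_closure_of_nonempty_interior
    (T.nonempty_interior ht), (isCompact_triangle t).isClosed.closure_eq]

/-- Conformity makes distinct triangles overlap in the convex hull of at most two points. -/
theorem Mesh.disjoint_interior {Ω : Set Plane} (T : Mesh Ω) {s t : Finset Plane}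
    (hs : s ∈ T.cells) (ht : t ∈ T.cells) (hst : s ≠ t) :
    Disjoint (interior (triangle s)) (interior (triangle t)) := by
  rw [Set.disjoint_iff_inter_eq_empty, ← interior_inter, T.inter_eq s hs t ht]
  by_contra hne
  have hspan := interior_convexHull_nonempty_iff_affineSpan_eq_top.1
    (Set.nonempty_iff_ne_empty.2 hne)
  -- A vertex of `s` which is not in `t` is not in the affine span of the other vertices.
  have hsub : ¬ s ⊆ t := fun h =>
    hst (Finset.eq_of_subset_of_card_le h (by rw [T.card_eq s hs, T.card_eq t ht]))
  obtain ⟨v, hvs, hvt⟩ := Finset.not_subset.1 hsub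
  have h1 := (T.affineIndependent s hs).mem_affineSpan_iff ⟨v, hvs⟩ {a | (a : Plane) ∈ t}
  have h2 : ((↑) : s → Plane) '' {a | (a : Plane) ∈ t} = (s : Set Plane) ∩ t := by
    ext x
    simp [and_comm]
  rw [h2, hspan] at h1
  exact hvt (h1.1 (AffineSubspace.mem_top ℝ Plane v))

/-- The open triangles fill `Ω` up to the null set of their edges. -/
theorem Mesh.iUnion_interior_ae_eq {Ω : Set Plane} (hΩ : IsOpen Ω) (hL : HasLipschitzBoundary Ω)
    (T : Mesh Ω) :
    (⋃ t ∈ T.cells, interior (triangle t) : Set Plane) =ᵐ[volume] Ω := by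
  refine (ae_le_set.2 ?_).antisymm (ae_le_set.2 ?_)
  · refine measure_mono_null (t := ∅) (fun x hx => ?_) measure_empty
    obtain ⟨t, ht, hxt⟩ := mem_iUnion₂.1 hx.1
    exact absurd (T.interior_subset hΩ hL ht hxt) hx.2
  · refine measure_mono_null (t := ⋃ t ∈ T.cells, frontier (triangle t)) ?_ ?_
    · rintro x ⟨hx, hx'⟩
      obtain ⟨t, ht, hxt⟩ := T.exists_mem_triangle (subset_closure hx)
      refine mem_iUnion₂.2 ⟨t, ht, subset_closure hxt, fun hxi => hx' ?_⟩
      exact mem_iUnion₂.2 ⟨t, ht, hxi⟩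
    · exact (measure_biUnion_null_iff (I := (T.cells : Set (Finset Plane)))
        T.cells.countable_toSet).2 fun t _ => (convex_triangle t).addHaar_frontier volume

theorem Mesh.lintegral_eq_sum {Ω : Set Plane} (hΩ : IsOpen Ω) (hL : HasLipschitzBoundary Ω)
    (T : Mesh Ω) (f : Plane → ENNReal) :
    ∫⁻ x in Ω, f x = ∑ t ∈ T.cells, ∫⁻ x in interior (triangle t), f x := by
  rw [← setLIntegral_congr (T.iUnion_interior_ae_eq hΩ hL)]
  exact lintegral_biUnion_finset (fun s hs t ht hst => T.disjoint_interior hs ht hst)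
    (fun t _ => isOpen_interior.measurableSet) f

theorem Mesh.ae_iff {Ω : Set Plane} (hΩ : IsOpen Ω) (hL : HasLipschitzBoundary Ω)
    (T : Mesh Ω) {P : Plane → Prop} :
    (∀ᵐ x ∂((volume : Measure Plane).restrict Ω), P x) ↔
      ∀ t ∈ T.cells, ∀ᵐ x ∂((volume : Measure Plane).restrict (interior (triangle t))), P x := by
  rw [← Measure.restrict_congr_set (T.iUnion_interior_ae_eq hΩ hL)]
  exact ae_restrict_biUnion_finset_iff _ _ _

theorem convex_setOf_affine_eq (c₀ d₀ : ℂ) (c d : Fin 2 → ℂ) :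
    Convex ℝ {x : Plane | c₀ + gradMap c x = d₀ + gradMap d x} := by
  intro x hx y hy a b _ _ hab
  simp only [mem_ofPred_eq, map_add, map_smul] at hx hy ⊢
  have h1 : a • (c₀ + gradMap c x) + b • (c₀ + gradMap c y) =
      a • (d₀ + gradMap d x) + b • (d₀ + gradMap d y) := by rw [hx, hy]
  have h2 : ∀ z : ℂ, a • z + b • z = z := fun z => by rw [← add_smul, hab, one_smul]
  calc c₀ + (a • gradMap c x + b • gradMap c y)
      = (a • c₀ + b • c₀) + (a • gradMap c x + b • gradMap c y) := by rw [h2]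
    _ = a • (c₀ + gradMap c x) + b • (c₀ + gradMap c y) := by simp only [smul_add]; abel
    _ = (a • d₀ + b • d₀) + (a • gradMap d x + b • gradMap d y) := by
        rw [h1]; simp only [smul_add]; abel
    _ = _ := by rw [h2]

theorem gradMap_single (c : Fin 2 → ℂ) (i : Fin 2) :
    gradMap c (EuclideanSpace.single i 1) = c i := by
  rw [gradMap_apply]
  fin_cases i <;> simp

/-- Values at the vertices of a triangle are interpolated by an affine function. -/
theorem Mesh.exists_affine {Ω : Set Plane} (T : Mesh Ω) {t : Finset Plane} (ht : t ∈ T.cells)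
    (f : Plane → ℂ) : ∃ (c₀ : ℂ) (c : Fin 2 → ℂ), ∀ a ∈ t, c₀ + gradMap c a = f a := by
  let E : (ℂ × (Fin 2 → ℂ)) →ₗ[ℂ] (t → ℂ) :=
    { toFun := fun q a => q.1 + gradMap q.2 a
      map_add' := fun q q' => by
        funext a
        simp only [gradMap_apply, Prod.fst_add, Prod.snd_add, Pi.add_apply, smul_add,
          Finset.sum_add_distrib]
        ring
      map_smul' := fun z q => by
        funext a
        simp only [gradMap_apply, Prod.smul_fst, Prod.smul_snd, Pi.smul_apply, smul_eq_mul,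
          RingHom.id_apply, Finset.mul_sum, mul_add, mul_smul_comm] }
  have hinj : Function.Injective E := by
    rw [← LinearMap.ker_eq_bot, LinearMap.ker_eq_bot']
    rintro ⟨c₀, c⟩ hq
    have h0 : ∀ x ∈ triangle t, c₀ + gradMap c x = 0 + gradMap 0 x := by
      refine convexHull_min (fun a ha => ?_) (convex_setOf_affine_eq c₀ 0 c 0)
      have h1 : c₀ + gradMap c a = 0 := congrFun hq ⟨a, ha⟩
      change c₀ + gradMap c a = 0 + gradMap 0 a
      rw [h1]
      simp
    obtain ⟨x, hx⟩ := T.nonempty_interior ht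
    obtain ⟨ε, hε, hball⟩ := Metric.isOpen_iff.1 isOpen_interior x hx
    have hx0 := h0 x (_root_.interior_subset hx)
    have hc : c = 0 := by
      funext i
      have hy : x + (ε / 2) • EuclideanSpace.single i (1 : ℝ) ∈ Metric.ball x ε := by
        rw [Metric.mem_ball, dist_eq_norm, add_sub_cancel_left, norm_smul]
        simp only [PiLp.norm_single, Real.norm_eq_abs, abs_one, mul_one]
        rw [abs_of_pos (by positivity)]
        linarith
      have h1 := h0 _ (_root_.interior_subset (hball hy))
      rw [map_add, map_smul, map_add, map_smul, ← add_assoc, ← add_assoc, hx0,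
        gradMap_single, gradMap_single] at h1
      have h2 : (ε / 2) • c i = (ε / 2) • (0 : ℂ) := add_left_cancel h1
      exact smul_right_injective ℂ (by positivity : ε / 2 ≠ 0) h2
    subst hc
    have h3 : c₀ = 0 := by simpa using hx0
    rw [h3]
    rfl
  have hfin : Module.finrank ℂ (ℂ × (Fin 2 → ℂ)) = Module.finrank ℂ (t → ℂ) := by
    rw [Module.finrank_prod, Module.finrank_self, Module.finrank_fintype_fun_eq_card,
      Module.finrank_fintype_fun_eq_card, Fintype.card_coe, T.card_eq t ht, Fintype.card_fin]
  obtain ⟨q, hq⟩ := (LinearMap.injective_iff_surjective_of_finrank_eq_finrank hfin).1 hinj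
    fun a => f a
  exact ⟨q.1, q.2, fun a ha => congrFun hq ⟨a, ha⟩⟩

theorem Mesh.continuousOn {Ω : Set Plane} (T : Mesh Ω) {φ : Plane → ℂ}
    (h : ∀ t ∈ T.cells, ContinuousOn φ (triangle t)) : ContinuousOn φ (closure Ω) := by
  have h1 : closure Ω = ⋃ t : T.cells, triangle t := by
    rw [← T.iUnion_eq]
    exact iUnion_subtype (fun t => t ∈ T.cells) (fun t => triangle t) |>.symm
  rw [h1]
  exact (locallyFinite_of_finite _).continuousOn_iUnion
    (fun t => (isCompact_triangle t).isClosed) fun t => h t t.2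

/-- The continuous piecewise affine function with given values at the vertices. -/
theorem Mesh.exists_interpolant {Ω : Set Plane} (T : Mesh Ω) (f : Plane → ℂ) :
    ∃ (φ : Plane → ℂ) (c₀ : Finset Plane → ℂ) (c : Finset Plane → Fin 2 → ℂ),
      ContinuousOn φ (closure Ω) ∧
      (∀ t ∈ T.cells, ∀ x ∈ triangle t, φ x = c₀ t + gradMap (c t) x) ∧
      ∀ t ∈ T.cells, ∀ a ∈ t, c₀ t + gradMap (c t) a = f a := by
  classical
  have hex : ∀ t : Finset Plane, ∃ (c₀ : ℂ) (c : Fin 2 → ℂ),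
      t ∈ T.cells → ∀ a ∈ t, c₀ + gradMap c a = f a := by
    intro t
    by_cases ht : t ∈ T.cells
    · obtain ⟨c₀, c, h⟩ := T.exists_affine ht f
      exact ⟨c₀, c, fun _ => h⟩
    · exact ⟨0, 0, fun h => absurd h ht⟩
  choose c₀ c hc using hex
  set φ : Plane → ℂ := fun x =>
    if h : ∃ t ∈ T.cells, x ∈ triangle t then c₀ h.choose + gradMap (c h.choose) x else 0 with hφ
  have hφt : ∀ t ∈ T.cells, ∀ x ∈ triangle t, φ x = c₀ t + gradMap (c t) x := by
    intro t ht x hx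
    have h : ∃ t ∈ T.cells, x ∈ triangle t := ⟨t, ht, hx⟩
    have hφx : φ x = c₀ h.choose + gradMap (c h.choose) x := dif_pos h
    rw [hφx]
    obtain ⟨hs, hxs⟩ := h.choose_spec
    set s := h.choose
    have hx' : x ∈ convexHull ℝ ((s : Set Plane) ∩ (t : Set Plane)) := by
      rw [← T.inter_eq s hs t ht]
      exact ⟨hxs, hx⟩
    refine convexHull_min ?_ (convex_setOf_affine_eq (c₀ s) (c₀ t) (c s) (c t)) hx'
    rintro a ⟨has, hat⟩
    exact (hc s hs a has).trans (hc t ht a hat).symm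
  refine ⟨φ, c₀, c, T.continuousOn fun t ht => ?_, hφt, fun t ht => hc t ht⟩
  refine ContinuousOn.congr ?_ (hφt t ht)
  exact (continuous_const.add (gradMap (c t)).continuous).continuousOn

/-- A continuous piecewise affine function is Lipschitz along segments. -/
theorem Mesh.norm_sub_le_of_segment {Ω : Set Plane} (T : Mesh Ω) {φ : Plane → ℂ}
    {c₀ : Finset Plane → ℂ} {c : Finset Plane → Fin 2 → ℂ} (hφ : ContinuousOn φ (closure Ω))
    (hφt : ∀ t ∈ T.cells, ∀ x ∈ triangle t, φ x = c₀ t + gradMap (c t) x) {x v : Plane}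
    (hseg : ∀ s ∈ Icc (0 : ℝ) 1, x + s • v ∈ closure Ω) :
    ‖φ (x + v) - φ x‖ ≤ (∑ t ∈ T.cells, ‖gradMap (c t)‖) * ‖v‖ := by
  set L := ∑ t ∈ T.cells, ‖gradMap (c t)‖ with hL
  have hcl : Continuous fun s : ℝ => x + s • v := by fun_prop
  have hcont : ContinuousOn (fun s : ℝ => φ (x + s • v)) (Icc 0 1) :=
    hφ.comp hcl.continuousOn hseg
  have hmain : Icc (0 : ℝ) 1 ⊆ {s | ‖φ (x + s • v) - φ x‖ ≤ L * (s * ‖v‖)} := by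
    refine IsClosed.Icc_subset_of_forall_exists_gt ?_ (by simp) ?_
    · rw [inter_comm]
      have h1 : ContinuousOn (fun s : ℝ => ‖φ (x + s • v) - φ x‖ - L * (s * ‖v‖)) (Icc 0 1) :=
        (hcont.sub continuousOn_const).norm.sub (by fun_prop)
      have h2 := h1.preimage_isClosed_of_isClosed isClosed_Icc (isClosed_Iic (a := (0 : ℝ)))
      convert h2 using 1
      ext s
      simp
    · rintro s ⟨hs, hs0, hs1⟩ y hy
      -- Close to `s`, the segment stays in triangles which contain the point at `s`.
      have hev : ∀ᶠ s' in 𝓝 s, ∀ t ∈ T.cells, x + s' • v ∈ triangle t → x + s • v ∈ triangle t := by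
        rw [Finset.eventually_all]
        intro t _
        by_cases hst : x + s • v ∈ triangle t
        · exact Eventually.of_forall fun _ _ => hst
        · filter_upwards [hcl.continuousAt.preimage_mem_nhds
            ((isCompact_triangle t).isClosed.isOpen_compl.mem_nhds hst)] with s' hs' h
          exact absurd h hs'
      have hev2 : ∀ᶠ s' in 𝓝[>] s, s' ∈ Ioc s (min y 1) := Ioc_mem_nhdsGT (lt_min hy hs1)
      obtain ⟨s', hs', hss', hs'y⟩ := ((hev.filter_mono nhdsWithin_le_nhds).and hev2).exists
      have hs'1 : s' ≤ 1 := hs'y.trans (min_le_right _ _)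
      refine ⟨s', ?_, hss', hs'y.trans (min_le_left _ _)⟩
      obtain ⟨t, ht, hs't⟩ := T.exists_mem_triangle (hseg s' ⟨hs0.trans hss'.le, hs'1⟩)
      have hstep : ‖φ (x + s' • v) - φ (x + s • v)‖ ≤ L * ((s' - s) * ‖v‖) := by
        rw [hφt t ht _ hs't, hφt t ht _ (hs' t ht hs't), add_sub_add_left_eq_sub, ← map_sub,
          add_sub_add_left_eq_sub, ← sub_smul]
        refine (ContinuousLinearMap.le_opNorm _ _).trans ?_
        rw [norm_smul, Real.norm_eq_abs, abs_of_pos (sub_pos.2 hss')]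
        refine mul_le_mul_of_nonneg_right ?_ (by have := sub_pos.2 hss'; positivity)
        exact Finset.single_le_sum (f := fun t => ‖gradMap (c t)‖) (fun _ _ => norm_nonneg _) ht
      have htri := norm_add_le (φ (x + s' • v) - φ (x + s • v)) (φ (x + s • v) - φ x)
      rw [sub_add_sub_cancel] at htri
      have hs2 : ‖φ (x + s • v) - φ x‖ ≤ L * (s * ‖v‖) := hs
      change ‖φ (x + s' • v) - φ x‖ ≤ L * (s' * ‖v‖)
      calc _ ≤ _ := htri
        _ ≤ L * ((s' - s) * ‖v‖) + L * (s * ‖v‖) := add_le_add hstep hs2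
        _ = _ := by ring
  have := hmain (right_mem_Icc.2 zero_le_one)
  simpa using this

/-! ### Piecewise affine functions and interpolation -/

theorem integrable_indicator_of_continuousOn_closure {Ω : Set Plane} (hΩ : IsOpen Ω)
    (hb : Bornology.IsBounded Ω) {φ : Plane → ℂ} (hφ : ContinuousOn φ (closure Ω)) :
    Integrable (Ω.indicator φ) (volume : Measure Plane) := by
  rw [integrable_indicator_iff hΩ.measurableSet]
  exact (hφ.integrableOn_compact hb.isCompact_closure).mono_set subset_closure

/-- Integration by parts for continuous piecewise affine functions, by passing to the limit in
difference quotients. -/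
theorem Mesh.integral_partialDeriv_smul {Ω : Set Plane} (hΩ : IsOpen Ω)
    (hL : HasLipschitzBoundary Ω) (hb : Bornology.IsBounded Ω) (T : Mesh Ω) {φ : Plane → ℂ}
    {c₀ : Finset Plane → ℂ} {c : Finset Plane → Fin 2 → ℂ} (hφ : ContinuousOn φ (closure Ω))
    (hφt : ∀ t ∈ T.cells, ∀ x ∈ triangle t, φ x = c₀ t + gradMap (c t) x) (i : Fin 2)
    {g : Plane → ℂ} (hg : ∀ t ∈ T.cells, ∀ x ∈ interior (triangle t), g x = c t i)
    {ψ : Plane → ℝ} (hψ : IsTestFunction Ω ψ) :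
    ∫ x in Ω, partialDeriv i ψ x • φ x = - ∫ x in Ω, ψ x • g x := by
  set e : Plane := EuclideanSpace.single i 1 with he
  have hen : ‖e‖ = 1 := by simp [he]
  set Φ : Plane → ℂ := Ω.indicator φ with hΦ
  have hΦi : Integrable Φ volume := integrable_indicator_of_continuousOn_closure hΩ hb hφ
  obtain ⟨δ, hδ, hthick⟩ := hψ.hasCompactSupport.isCompact.exists_thickening_subset_open hΩ
    hψ.tsupport_subset
  set τ : ℕ → ℝ := fun m => δ / ((m : ℝ) + 2) with hτ
  have hτ0 : ∀ m, 0 < τ m := fun m => by simp only [hτ]; positivity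
  have hτδ : ∀ m, τ m < δ := fun m => by
    have : (0 : ℝ) ≤ m := Nat.cast_nonneg m
    rw [hτ, div_lt_iff₀ (by positivity)]
    nlinarith
  have hτl : Tendsto τ atTop (𝓝 0) :=
    Tendsto.const_div_atTop (tendsto_atTop_add_const_right _ _ tendsto_natCast_atTop_atTop) δ
  have hτne : Tendsto τ atTop (𝓝[≠] 0) :=
    tendsto_nhdsWithin_iff.2 ⟨hτl, Eventually.of_forall fun m => (hτ0 m).ne'⟩
  have hψc := hψ.contDiff.continuous
  have hi1 : ∀ m, Integrable (fun x => ψ (x + τ m • e) • Φ x) volume := fun m => by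
    refine hΦi.locallyIntegrable.integrable_smul_left_of_hasCompactSupport
      (hψc.comp (continuous_id.add continuous_const)) ?_
    exact hψ.hasCompactSupport.comp_homeomorph (Homeomorph.addRight (τ m • e))
  have hi2 : Integrable (fun x => ψ x • Φ x) volume :=
    hΦi.locallyIntegrable.integrable_smul_left_of_hasCompactSupport hψc hψ.hasCompactSupport
  have hi3 : ∀ m, Integrable (fun x => ψ x • Φ (x - τ m • e)) volume := fun m =>
    (hΦi.comp_sub_right (τ m • e)).locallyIntegrable.integrable_smul_left_of_hasCompactSupport hψc
      hψ.hasCompactSupport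
  set A : ℕ → Plane → ℂ := fun m x => ((τ m)⁻¹ * (ψ (x + τ m • e) - ψ x)) • Φ x with hA
  set B : ℕ → Plane → ℂ := fun m x => ψ x • ((τ m)⁻¹ • (Φ (x - τ m • e) - Φ x)) with hB
  have hAeq : ∀ m, A m = fun x => (τ m)⁻¹ • (ψ (x + τ m • e) • Φ x - ψ x • Φ x) := fun m => by
    funext x
    simp only [hA, mul_smul, sub_smul]
  have hBeq : ∀ m, B m = fun x => (τ m)⁻¹ • (ψ x • Φ (x - τ m • e) - ψ x • Φ x) := fun m => by
    funext x
    simp only [hB, smul_comm (ψ x), smul_sub]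
  have hAB : ∀ m, ∫ x, A m x = ∫ x, B m x := by
    intro m
    rw [hAeq, hBeq, integral_smul, integral_smul, integral_sub (hi1 m) hi2,
      integral_sub (hi3 m) hi2, ← integral_add_right_eq_self (fun x => ψ x • Φ (x - τ m • e))
      (τ m • e)]
    simp
  obtain ⟨C, hC⟩ := hψ.contDiff.lipschitzWith_of_hasCompactSupport hψ.hasCompactSupport (by simp)
  have hAlim : Tendsto (fun m => ∫ x, A m x) atTop (𝓝 (∫ x, partialDeriv i ψ x • Φ x)) := by
    refine tendsto_integral_of_dominated_convergence (fun x => C * ‖Φ x‖) (fun m => ?_)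
      (hΦi.norm.const_mul _) (fun m => Eventually.of_forall fun x => ?_)
      (Eventually.of_forall fun x => ?_)
    · rw [hAeq]
      exact ((hi1 m).sub hi2).aestronglyMeasurable.const_smul (τ m)⁻¹
    · simp only [hA]
      rw [norm_smul]
      refine mul_le_mul_of_nonneg_right ?_ (norm_nonneg _)
      have h1 := hC.dist_le_mul (x + τ m • e) x
      rw [dist_eq_norm, dist_eq_norm, add_sub_cancel_left, norm_smul, hen, mul_one,
        Real.norm_of_nonneg (hτ0 m).le] at h1
      rw [norm_mul, norm_inv, Real.norm_of_nonneg (hτ0 m).le, inv_mul_le_iff₀ (hτ0 m), mul_comm]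
      exact h1
    · refine Tendsto.smul_const ?_ (Φ x)
      have h1 : HasFDerivAt ψ (fderiv ℝ ψ x) (x + (0 : ℝ) • e) := by
        rw [zero_smul, add_zero]
        exact (hψ.contDiff.differentiable (by simp) x).hasFDerivAt
      have h2 : HasDerivAt (fun s : ℝ => x + s • e) e 0 := by
        simpa using ((hasDerivAt_id (0 : ℝ)).smul_const e).const_add x
      have h3 := (hasDerivAt_iff_tendsto_slope_zero.1 (h1.comp_hasDerivAt 0 h2)).comp hτne
      refine h3.congr fun m => ?_
      simp
  have hBlim : Tendsto (fun m => ∫ x, B m x) atTop (𝓝 (∫ x, ψ x • (-Ω.indicator g x))) := by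
    set L := ∑ t ∈ T.cells, ‖gradMap (c t)‖ with hLdef
    refine tendsto_integral_of_dominated_convergence (fun x => ‖ψ x‖ * L) (fun m => ?_)
      ((hψc.integrable_of_hasCompactSupport hψ.hasCompactSupport).norm.mul_const _)
      (fun m => Eventually.of_forall fun x => ?_) ?_
    · rw [hBeq]
      exact ((hi3 m).sub hi2).aestronglyMeasurable.const_smul (τ m)⁻¹
    · simp only [hB]
      rw [norm_smul]
      by_cases hx : x ∈ tsupport ψ
      swap
      · simp [image_eq_zero_of_notMem_tsupport hx]
      refine mul_le_mul_of_nonneg_left ?_ (norm_nonneg _)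
      have hseg : ∀ s ∈ Icc (0 : ℝ) 1, x + s • (-(τ m • e)) ∈ Ω := by
        intro s hs
        refine hthick (Metric.mem_thickening_iff.2 ⟨x, hx, ?_⟩)
        rw [dist_eq_norm, add_sub_cancel_left, norm_smul, norm_neg, norm_smul, hen, mul_one,
          Real.norm_of_nonneg hs.1, Real.norm_of_nonneg (hτ0 m).le]
        calc s * τ m ≤ 1 * τ m := mul_le_mul_of_nonneg_right hs.2 (hτ0 m).le
          _ < δ := by rw [one_mul]; exact hτδ m
      have h1 := T.norm_sub_le_of_segment hφ hφt (x := x) (v := -(τ m • e))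
        fun s hs => subset_closure (hseg s hs)
      have h2 : x - τ m • e ∈ Ω := by
        have := hseg 1 (right_mem_Icc.2 zero_le_one)
        rwa [one_smul, ← sub_eq_add_neg] at this
      rw [hΦ, indicator_of_mem h2, indicator_of_mem (hψ.tsupport_subset hx), norm_smul, norm_inv,
        Real.norm_of_nonneg (hτ0 m).le, inv_mul_le_iff₀ (hτ0 m), mul_comm (τ m)]
      rw [norm_neg, norm_smul, hen, mul_one, Real.norm_of_nonneg (hτ0 m).le,
        ← sub_eq_add_neg] at h1
      exact h1
    · have hae := (ae_restrict_iff' hΩ.measurableSet).1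
        ((T.ae_iff hΩ hL (P := fun x => ∃ t ∈ T.cells, x ∈ interior (triangle t))).2
          fun t ht => (ae_restrict_mem isOpen_interior.measurableSet).mono fun x hx => ⟨t, ht, hx⟩)
      filter_upwards [hae] with x hx
      by_cases hxΩ : x ∈ Ω
      swap
      · have : ψ x = 0 := image_eq_zero_of_notMem_tsupport fun h => hxΩ (hψ.tsupport_subset h)
        simp [hB, this]
      obtain ⟨t, ht, hxt⟩ := hx hxΩ
      refine Tendsto.const_smul ?_ (ψ x)
      rw [indicator_of_mem hxΩ, hg t ht x hxt]
      refine tendsto_const_nhds.congr' ?_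
      have hlim : Tendsto (fun m => x - τ m • e) atTop (𝓝 x) := by
        have := (tendsto_const_nhds (x := x)).sub (hτl.smul_const e)
        simpa using this
      filter_upwards [hlim.eventually (isOpen_interior.mem_nhds hxt)] with m hm
      have hΦ' : ∀ y ∈ interior (triangle t), Φ y = c₀ t + gradMap (c t) y := fun y hy => by
        rw [hΦ, indicator_of_mem (T.interior_subset hΩ hL ht hy),
          hφt t ht y (_root_.interior_subset hy)]
      rw [hΦ' _ hm, hΦ' _ hxt, add_sub_add_left_eq_sub, ← map_sub, sub_sub_cancel_left, map_neg,
        map_smul, gradMap_single, smul_neg, smul_smul, inv_mul_cancel₀ (hτ0 m).ne', one_smul]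
  have hlim := tendsto_nhds_unique hAlim (hBlim.congr fun m => (hAB m).symm)
  rw [setIntegral_smul_eq_integral_smul_indicator hΩ.measurableSet,
    setIntegral_smul_eq_integral_smul_indicator hΩ.measurableSet]
  rw [hlim, ← integral_neg]
  simp

/-- Continuous piecewise affine functions belong to `H¹`. -/
theorem Mesh.exists_H1 {Ω : Set Plane} (hΩ : IsOpen Ω)
    (hL : HasLipschitzBoundary Ω) (hb : Bornology.IsBounded Ω) (T : Mesh Ω) {φ : Plane → ℂ}
    {c₀ : Finset Plane → ℂ} {c : Finset Plane → Fin 2 → ℂ} (hφ : ContinuousOn φ (closure Ω))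
    (hφt : ∀ t ∈ T.cells, ∀ x ∈ triangle t, φ x = c₀ t + gradMap (c t) x) :
    ∃ v : H1 Ω, (v.toL2 =ᵐ[(volume : Measure Plane).restrict Ω] φ) ∧ ∀ t ∈ T.cells, ∀ i,
      ∀ᵐ x ∂((volume : Measure Plane).restrict (interior (triangle t))),
        v.deriv i x = c t i := by
  classical
  have hfin : IsFiniteMeasure ((volume : Measure Plane).restrict Ω) :=
    ⟨by rw [Measure.restrict_apply_univ]; exact hb.measure_lt_top⟩
  obtain ⟨K, hK⟩ := hb.isCompact_closure.exists_bound_of_continuousOn hφ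
  have hφm : MemLp φ 2 ((volume : Measure Plane).restrict Ω) := by
    refine MemLp.of_bound ((hφ.mono subset_closure).aestronglyMeasurable hΩ.measurableSet) K ?_
    filter_upwards [ae_restrict_mem hΩ.measurableSet] with x hx
    exact hK x (subset_closure hx)
  set g : Fin 2 → Plane → ℂ := fun i x =>
    ∑ t ∈ T.cells, (interior (triangle t)).indicator (fun _ => c t i) x with hg
  have hgt : ∀ i, ∀ t ∈ T.cells, ∀ x ∈ interior (triangle t), g i x = c t i := by
    intro i t ht x hx
    simp only [hg]
    rw [Finset.sum_eq_single_of_mem t ht, indicator_of_mem hx]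
    intro s hs hst
    exact indicator_of_notMem (fun hxs => Set.disjoint_left.1 (T.disjoint_interior hs ht hst) hxs hx) _
  have hgm : ∀ i, MemLp (g i) 2 ((volume : Measure Plane).restrict Ω) := by
    intro i
    refine memLp_finsetSum _ fun t _ => ?_
    exact (memLp_const (c t i)).indicator isOpen_interior.measurableSet
  have hweak : ∀ i, IsWeakPartial Ω i hφm.toLp (hgm i).toLp := by
    intro i ψ hψ
    have h1 : ∫ x in Ω, partialDeriv i ψ x • hφm.toLp φ x = ∫ x in Ω, partialDeriv i ψ x • φ x := by
      refine integral_congr_ae ?_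
      filter_upwards [hφm.coeFn_toLp] with x hx
      rw [hx]
    have h2 : ∫ x in Ω, ψ x • (hgm i).toLp (g i) x = ∫ x in Ω, ψ x • g i x := by
      refine integral_congr_ae ?_
      filter_upwards [(hgm i).coeFn_toLp] with x hx
      rw [hx]
    rw [h1, h2]
    exact T.integral_partialDeriv_smul hΩ hL hb hφ hφt i (hgt i) hψ
  refine ⟨⟨WithLp.toLp 2 (hφm.toLp, WithLp.toLp 2 fun i => (hgm i).toLp), hweak⟩,
    hφm.coeFn_toLp, fun t ht i => ?_⟩
  filter_upwards [ae_mono (Measure.restrict_mono (T.interior_subset hΩ hL ht) le_rfl)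
    (hgm i).coeFn_toLp, ae_restrict_mem isOpen_interior.measurableSet] with x hx hxt
  exact hx.trans (hgt i t ht x hxt)

theorem Mesh.mem_lagrange {Ω : Set Plane} (T : Mesh Ω) {p : ℕ} (hp : 1 ≤ p) {φ : Plane → ℂ}
    {c₀ : Finset Plane → ℂ} {c : Finset Plane → Fin 2 → ℂ} (hφ : ContinuousOn φ (closure Ω))
    (hφt : ∀ t ∈ T.cells, ∀ x ∈ triangle t, φ x = c₀ t + gradMap (c t) x) {v : H1 Ω}
    (hv : v.toL2 =ᵐ[(volume : Measure Plane).restrict Ω] φ) : v ∈ T.lagrange p := by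
  refine ⟨φ, ⟨hφ, fun t ht => ?_⟩, hv⟩
  refine ⟨MvPolynomial.C (c₀ t) + ∑ i, MvPolynomial.X i * MvPolynomial.C (c t i), ?_, ?_⟩
  · refine (MvPolynomial.totalDegree_add _ _).trans (max_le ?_ ?_)
    · simp
    · refine (MvPolynomial.totalDegree_finsetSum _ _).trans (Finset.sup_le fun i _ => ?_)
      refine (MvPolynomial.totalDegree_mul _ _).trans ?_
      simpa using hp
  · intro x hx
    rw [hφt t ht x hx]
    simp [gradMap_apply]

/-- An affine function bounded by `M` at the vertices of a triangle is bounded by `M` on the triangle,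
and its gradient is bounded in terms of `M` and the radius of an inscribed disc. -/
theorem affine_bound {t : Finset Plane} {b : ℂ} {γ : Fin 2 → ℂ} {x : Plane} {M : ℝ}
    (hM : ∀ a ∈ t, ‖b + gradMap γ (a - x)‖ ≤ M) (hx : x ∈ triangle t) {z : Plane} {r : ℝ}
    (hr : 0 < r) (hball : Metric.closedBall z r ⊆ triangle t) :
    ‖b‖ ≤ M ∧ ∀ i, ‖γ i‖ ≤ M / r := by
  have hall : ∀ y ∈ triangle t, ‖b + gradMap γ (y - x)‖ ≤ M := by
    refine convexHull_min (s := (t : Set Plane)) (t := {y | ‖b + gradMap γ (y - x)‖ ≤ M}) hM ?_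
    intro y hy w hw s s' hs hs' hss
    have hy' : ‖b + gradMap γ (y - x)‖ ≤ M := hy
    have hw' : ‖b + gradMap γ (w - x)‖ ≤ M := hw
    have h1 : b + gradMap γ (s • y + s' • w - x) =
        s • (b + gradMap γ (y - x)) + s' • (b + gradMap γ (w - x)) := by
      have h2 : s • y + s' • w - x = s • (y - x) + s' • (w - x) := by
        have : x = s • x + s' • x := by rw [← add_smul, hss, one_smul]
        nth_rewrite 1 [this]
        simp only [smul_sub]
        abel
      have h3 : b = s • b + s' • b := by rw [← add_smul, hss, one_smul]
      rw [h2, map_add, map_smul, map_smul]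
      nth_rewrite 1 [h3]
      simp only [smul_add]
      abel
    change ‖b + gradMap γ (s • y + s' • w - x)‖ ≤ M
    rw [h1]
    refine (norm_add_le _ _).trans ?_
    rw [norm_smul, norm_smul, Real.norm_of_nonneg hs, Real.norm_of_nonneg hs']
    calc s * ‖b + gradMap γ (y - x)‖ + s' * ‖b + gradMap γ (w - x)‖ ≤ s * M + s' * M := by gcongr
      _ = M := by rw [← add_mul, hss, one_mul]
  refine ⟨by simpa using hall x hx, fun i => ?_⟩
  have hmem : ∀ s : ℝ, |s| = r → z + s • EuclideanSpace.single i (1 : ℝ) ∈ triangle t := by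
    intro s hs
    refine hball ?_
    rw [Metric.mem_closedBall, dist_eq_norm, add_sub_cancel_left, norm_smul]
    simp [hs]
  have h1 := hall _ (hmem r (abs_of_pos hr))
  have h2 := hall _ (hmem (-r) (by rw [abs_neg, abs_of_pos hr]))
  have h3 : (2 * r) • γ i = (b + gradMap γ (z + r • EuclideanSpace.single i (1 : ℝ) - x)) -
      (b + gradMap γ (z + (-r) • EuclideanSpace.single i (1 : ℝ) - x)) := by
    rw [add_sub_add_left_eq_sub, ← map_sub, sub_sub_sub_cancel_right, add_sub_add_left_eq_sub,
      ← sub_smul, map_smul, gradMap_single]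
    ring_nf
  have h4 : 2 * r * ‖γ i‖ ≤ M + M := by
    rw [← abs_of_pos (show 0 < 2 * r by positivity), ← Real.norm_eq_abs, ← norm_smul, h3]
    exact (norm_sub_le _ _).trans (add_le_add h1 h2)
  rw [le_div_iff₀ hr]
  linarith

theorem H1.ofReal_norm_sq {Ω : Set Plane} (u : H1 Ω) :
    ENNReal.ofReal (‖u‖ ^ 2) = ∫⁻ x in Ω, (‖u.toL2 x‖ₑ ^ 2 + ∑ i, ‖u.deriv i x‖ₑ ^ 2) := by
  rw [H1.norm_sq_eq, ENNReal.ofReal_add (sq_nonneg _) (Finset.sum_nonneg fun _ _ => sq_nonneg _),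
    ← lintegral_enorm_sq_eq, ← lintegral_sum_enorm_sq_eq]
  exact (lintegral_add_left' ((Lp.aestronglyMeasurable u.toL2).enorm.pow_const 2) _).symm

theorem gradMap_sub (c d : Fin 2 → ℂ) (v : Plane) :
    gradMap (fun i => c i - d i) v = gradMap c v - gradMap d v := by
  simp only [gradMap_apply, smul_sub, Finset.sum_sub_distrib]

/-- On a shape-regular triangle, an affine function and its gradient are controlled by the values
at the vertices, in `L²` form. -/
theorem sq_add_sum_sq_le {t : Finset Plane} {b : ℂ} {γ : Fin 2 → ℂ} {x : Plane} {R : Plane → ℂ}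
    (hR : ∀ a ∈ t, b + gradMap γ (a - x) = R a) (hx : x ∈ triangle t) {z : Plane} {r : ℝ}
    (hr : 0 < r) (hball : Metric.closedBall z r ⊆ triangle t) :
    ‖b‖ₑ ^ 2 + ∑ i, ‖γ i‖ₑ ^ 2 ≤ ENNReal.ofReal (1 + 2 / r ^ 2) * ∑ a ∈ t, ‖R a‖ₑ ^ 2 := by
  set M := Real.sqrt (∑ a ∈ t, ‖R a‖ ^ 2) with hM
  have hM2 : M ^ 2 = ∑ a ∈ t, ‖R a‖ ^ 2 := Real.sq_sqrt (Finset.sum_nonneg fun _ _ => sq_nonneg _)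
  have hRM : ∀ a ∈ t, ‖b + gradMap γ (a - x)‖ ≤ M := by
    intro a ha
    rw [hR a ha]
    refine Real.le_sqrt_of_sq_le ?_
    exact Finset.single_le_sum (f := fun a => ‖R a‖ ^ 2) (fun _ _ => sq_nonneg _) ha
  obtain ⟨h1, h2⟩ := affine_bound hRM hx hr hball
  simp_rw [enorm_sq_eq]
  rw [← ENNReal.ofReal_sum_of_nonneg fun _ _ => sq_nonneg _,
    ← ENNReal.ofReal_sum_of_nonneg fun _ _ => sq_nonneg _, ← ENNReal.ofReal_mul (by positivity),
    ← ENNReal.ofReal_add (sq_nonneg _) (Finset.sum_nonneg fun _ _ => sq_nonneg _), ← hM2]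
  refine ENNReal.ofReal_le_ofReal ?_
  calc ‖b‖ ^ 2 + ∑ i, ‖γ i‖ ^ 2 ≤ M ^ 2 + ∑ _i : Fin 2, (M / r) ^ 2 := by
        refine add_le_add (by gcongr) (Finset.sum_le_sum fun i _ => ?_)
        have := h2 i
        gcongr
    _ = (1 + 2 / r ^ 2) * M ^ 2 := by
        simp only [Fin.sum_univ_two]
        ring

/-- The interpolation error of an `H²` function in the finite element space. -/
theorem Mesh.exists_interpolation_le {Ω : Set Plane} (hΩ : IsOpen Ω)
    (hL : HasLipschitzBoundary Ω) (hb : Bornology.IsBounded Ω) (T : Mesh Ω) {σ : ℝ}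
    (hσ : T.IsRegular σ) {p : ℕ} (hp : 1 ≤ p) {w : H1 Ω} {D : Fin 2 → Fin 2 → L2 Ω}
    (hD : ∀ i j, IsWeakPartial Ω j (w.deriv i) (D i j)) :
    ∃ v ∈ T.lagrange p, ‖w - v‖ ^ 2 ≤
      3 * (T.size ^ 2 + 2 * σ ^ 2) * T.size ^ 2 * ∑ q : Fin 2 × Fin 2, ‖D q.1 q.2‖ ^ 2 := by
  obtain ⟨f, _, hf⟩ := H1.exists_continuousOn_rep hΩ hL hD
  obtain ⟨φ, c₀, c, hφ, hφt, hφv⟩ := T.exists_interpolant f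
  obtain ⟨v, hv, hvd⟩ := T.exists_H1 hΩ hL hb hφ hφt
  refine ⟨v, T.mem_lagrange hp hφ hφt hv, ?_⟩
  set h := T.size with hh
  set I : Finset Plane → Set Plane := fun t => interior (triangle t) with hI
  have hIle : ∀ t ∈ T.cells, (volume : Measure Plane).restrict (I t) ≤ volume.restrict Ω :=
    fun t ht => Measure.restrict_mono (T.interior_subset hΩ hL ht) le_rfl
  have hlocal : ∀ t ∈ T.cells,
      ∫⁻ x in I t, (‖(w - v).toL2 x‖ₑ ^ 2 + ∑ i, ‖(w - v).deriv i x‖ₑ ^ 2) ≤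
        ENNReal.ofReal (3 * (h ^ 2 + 2 * σ ^ 2) * h ^ 2) *
          ∫⁻ x in I t, ∑ q : Fin 2 × Fin 2, ‖D q.1 q.2 x‖ₑ ^ 2 := by
    intro t ht
    obtain ⟨z, r, hr, hball, hdr⟩ := hσ t ht
    set d := Metric.diam (triangle t) with hd
    have hd0 : 0 ≤ d := Metric.diam_nonneg
    have hdh : d ≤ h := T.diam_le_size ht
    set R : Plane → Plane → ℂ := fun a x =>
      f a - w.toL2 x - gradMap (fun i => w.deriv i x) (a - x) with hR
    have hRm : ∀ a, AEMeasurable (fun x => ‖R a x‖ₑ ^ 2) ((volume : Measure Plane).restrict (I t)) :=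
      fun a => ((w.aestronglyMeasurable_taylor a _).mono_measure (hIle t ht)).enorm.pow_const 2
    have hRle : ∀ a ∈ t, ∫⁻ x in I t, ‖R a x‖ₑ ^ 2 ≤
        ENNReal.ofReal (d ^ 4) * ∫⁻ x in I t, ∑ q : Fin 2 × Fin 2, ‖D q.1 q.2 x‖ₑ ^ 2 := by
      intro a ha
      refine hf (I t) isOpen_interior (convex_triangle t).interior (T.interior_subset hΩ hL ht) d
        (fun x hx y hy => Mesh.dist_le_diam t (_root_.interior_subset hx)
          (_root_.interior_subset hy)) a ?_
      simp only [hI]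
      rw [T.closure_interior ht]
      exact subset_convexHull ℝ _ ha
    have hpt : ∀ᵐ x ∂((volume : Measure Plane).restrict (I t)),
        ‖(w - v).toL2 x‖ₑ ^ 2 + ∑ i, ‖(w - v).deriv i x‖ₑ ^ 2 ≤
          ENNReal.ofReal (1 + 2 / r ^ 2) * ∑ a ∈ t, ‖R a x‖ₑ ^ 2 := by
      have e1 : ∀ᵐ x ∂((volume : Measure Plane).restrict (I t)),
          (w - v).toL2 x = w.toL2 x - v.toL2 x :=
        ae_mono (hIle t ht) (Lp.coeFn_sub w.toL2 v.toL2)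
      have e2 : ∀ᵐ x ∂((volume : Measure Plane).restrict (I t)),
          ∀ i, (w - v).deriv i x = w.deriv i x - v.deriv i x :=
        ae_all_iff.2 fun i => ae_mono (hIle t ht) (Lp.coeFn_sub (w.deriv i) (v.deriv i))
      filter_upwards [e1, e2, ae_mono (hIle t ht) hv, ae_all_iff.2 (hvd t ht),
        ae_restrict_mem isOpen_interior.measurableSet] with x hx1 hx2 hx3 hx4 hxt
      have hxt' : x ∈ triangle t := _root_.interior_subset hxt
      have key := sq_add_sum_sq_le (b := c₀ t + gradMap (c t) x - w.toL2 x)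
        (γ := fun i => c t i - w.deriv i x) (R := fun a => R a x) (fun a ha => by
          simp only [gradMap_sub, hR, ← hφv t ht a ha, map_sub]
          ring) hxt' hr hball
      rw [hx1, hx3, hφt t ht x hxt', enorm_sub_rev]
      simp_rw [hx2, hx4, enorm_sub_rev (w.deriv _ x)]
      exact key
    calc ∫⁻ x in I t, (‖(w - v).toL2 x‖ₑ ^ 2 + ∑ i, ‖(w - v).deriv i x‖ₑ ^ 2)
        ≤ ∫⁻ x in I t, ENNReal.ofReal (1 + 2 / r ^ 2) * ∑ a ∈ t, ‖R a x‖ₑ ^ 2 :=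
          lintegral_mono_ae hpt
      _ = ENNReal.ofReal (1 + 2 / r ^ 2) * ∑ a ∈ t, ∫⁻ x in I t, ‖R a x‖ₑ ^ 2 := by
          rw [lintegral_const_mul' _ _ ENNReal.ofReal_ne_top,
            lintegral_finsetSum' _ fun a _ => hRm a]
      _ ≤ ENNReal.ofReal (1 + 2 / r ^ 2) * ∑ _a ∈ t, ENNReal.ofReal (d ^ 4) *
            ∫⁻ x in I t, ∑ q : Fin 2 × Fin 2, ‖D q.1 q.2 x‖ₑ ^ 2 :=
          mul_le_mul' le_rfl (Finset.sum_le_sum hRle)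
      _ = ENNReal.ofReal ((1 + 2 / r ^ 2) * (3 * d ^ 4)) *
            ∫⁻ x in I t, ∑ q : Fin 2 × Fin 2, ‖D q.1 q.2 x‖ₑ ^ 2 := by
          rw [Finset.sum_const, T.card_eq t ht, nsmul_eq_mul, ENNReal.ofReal_mul (by positivity),
            ENNReal.ofReal_mul (by norm_num)]
          simp only [ENNReal.ofReal_ofNat, Nat.cast_ofNat]
          ring
      _ ≤ _ := by
          refine mul_le_mul' (ENNReal.ofReal_le_ofReal ?_) le_rfl
          have h1 : d / r ≤ σ := by rwa [div_le_iff₀ hr]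
          have h2 : (d / r) ^ 2 ≤ σ ^ 2 := by gcongr
          have h3 : d ^ 2 ≤ h ^ 2 := by gcongr
          calc (1 + 2 / r ^ 2) * (3 * d ^ 4) = 3 * (d ^ 2 + 2 * (d / r) ^ 2) * d ^ 2 := by
                field_simp
            _ ≤ _ := by gcongr
  have hsum : ENNReal.ofReal (‖w - v‖ ^ 2) ≤ ENNReal.ofReal (3 * (h ^ 2 + 2 * σ ^ 2) * h ^ 2 *
      ∑ q : Fin 2 × Fin 2, ‖D q.1 q.2‖ ^ 2) := by
    rw [H1.ofReal_norm_sq, T.lintegral_eq_sum hΩ hL, ENNReal.ofReal_mul (by positivity),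
      ← lintegral_sum_enorm_sq_eq fun q : Fin 2 × Fin 2 => D q.1 q.2,
      T.lintegral_eq_sum hΩ hL (fun x => ∑ q : Fin 2 × Fin 2, ‖D q.1 q.2 x‖ₑ ^ 2),
      Finset.mul_sum]
    exact Finset.sum_le_sum hlocal
  exact (ENNReal.ofReal_le_ofReal_iff (by positivity)).1 hsum

/-! ### The embedding of `H¹` into `L²` is compact -/

/-- On a fine mesh, `H¹` functions are close in `L²` to piecewise constant functions. -/
theorem Mesh.exists_finiteDimensional_le {Ω : Set Plane} (hΩ : IsOpen Ω)
    (hL : HasLipschitzBoundary Ω) (hb : Bornology.IsBounded Ω) (T : Mesh Ω) :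
    ∃ S : Submodule ℂ (L2 Ω), FiniteDimensional ℂ S ∧ ∀ u : H1 Ω, ∃ s ∈ S,
      ‖u.toL2 - s‖ ^ 2 ≤ 8 * T.size ^ 2 * ‖u‖ ^ 2 := by
  classical
  have hfin : IsFiniteMeasure ((volume : Measure Plane).restrict Ω) :=
    ⟨by rw [Measure.restrict_apply_univ]; exact hb.measure_lt_top⟩
  set I : Finset Plane → Set Plane := fun t => interior (triangle t) with hI
  have hIm : ∀ t, MeasurableSet (I t) := fun t => isOpen_interior.measurableSet
  set χ : Finset Plane → L2 Ω := fun t =>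
    indicatorConstLp 2 (hIm t) (measure_ne_top (volume.restrict Ω) _) (1 : ℂ) with hχ
  refine ⟨Submodule.span ℂ (χ '' T.cells), FiniteDimensional.span_of_finite ℂ
    (T.cells.finite_toSet.image χ), fun u => ?_⟩
  have hP : ∀ t : Finset Plane, ∃ z : ℂ, t ∈ T.cells → ∫⁻ x in I t, ‖u.toL2 x - z‖ₑ ^ 2 ≤
      ENNReal.ofReal (8 * T.size ^ 2) * ∫⁻ x in I t, ∑ i, ‖u.deriv i x‖ₑ ^ 2 := by
    intro t
    by_cases ht : t ∈ T.cells
    · obtain ⟨z, hz⟩ := H1.exists_lintegral_sub_const_le hΩ (U := I t) isOpen_interior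
        (convex_triangle t).interior (T.interior_subset hΩ hL ht) (T.nonempty_interior ht) u
        (d := T.size) fun x hx y hy => (Mesh.dist_le_diam t (_root_.interior_subset hx)
          (_root_.interior_subset hy)).trans (T.diam_le_size ht)
      exact ⟨z, fun _ => hz⟩
    · exact ⟨0, fun h => absurd h ht⟩
  choose z hz using hP
  refine ⟨∑ t ∈ T.cells, z t • χ t, Submodule.sum_mem _ fun t ht =>
    Submodule.smul_mem _ _ (Submodule.subset_span (mem_image_of_mem χ ht)), ?_⟩
  set s : L2 Ω := ∑ t ∈ T.cells, z t • χ t with hs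
  have hsΩ : ∀ᵐ x ∂((volume : Measure Plane).restrict Ω),
      s x = ∑ t ∈ T.cells, z t * (I t).indicator (fun _ => (1 : ℂ)) x := by
    have h1 : ∀ᵐ x ∂((volume : Measure Plane).restrict Ω), ∀ t ∈ T.cells,
        (z t • χ t : L2 Ω) x = z t * (I t).indicator (fun _ => (1 : ℂ)) x := by
      rw [Finset.eventually_all]
      intro t _
      filter_upwards [Lp.coeFn_smul (z t) (χ t), indicatorConstLp_coeFn (p := 2) (hs := hIm t)
        (hμs := measure_ne_top (volume.restrict Ω) _) (c := (1 : ℂ))] with x hx hx'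
      rw [hx, Pi.smul_apply, hχ, hx', smul_eq_mul]
    filter_upwards [h1, Lp.coeFn_fun_finsetSum T.cells fun t => z t • χ t] with x hx hx'
    rw [hs, hx']
    exact Finset.sum_congr rfl hx
  have hst : ∀ t ∈ T.cells, ∀ᵐ x ∂((volume : Measure Plane).restrict (I t)), s x = z t := by
    intro t ht
    filter_upwards [ae_mono (Measure.restrict_mono (T.interior_subset hΩ hL ht) le_rfl) hsΩ,
      ae_restrict_mem (hIm t)] with x hx hxt
    rw [hx, Finset.sum_eq_single_of_mem t ht, indicator_of_mem hxt, mul_one]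
    intro t' ht' hne
    rw [indicator_of_notMem, mul_zero]
    exact fun hxt' => Set.disjoint_left.1 (T.disjoint_interior ht' ht hne) hxt' hxt
  have hmain : ENNReal.ofReal (‖u.toL2 - s‖ ^ 2) ≤ ENNReal.ofReal (8 * T.size ^ 2 * ‖u‖ ^ 2) := by
    calc ENNReal.ofReal (‖u.toL2 - s‖ ^ 2) = ∑ t ∈ T.cells, ∫⁻ x in I t, ‖(u.toL2 - s) x‖ₑ ^ 2 := by
          rw [← lintegral_enorm_sq_eq, T.lintegral_eq_sum hΩ hL]
      _ ≤ ∑ t ∈ T.cells, ENNReal.ofReal (8 * T.size ^ 2) *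
            ∫⁻ x in I t, ∑ i, ‖u.deriv i x‖ₑ ^ 2 := by
          refine Finset.sum_le_sum fun t ht => le_trans (le_of_eq ?_) (hz t ht)
          refine lintegral_congr_ae ?_
          filter_upwards [hst t ht, ae_mono (Measure.restrict_mono (T.interior_subset hΩ hL ht)
            le_rfl) (Lp.coeFn_sub u.toL2 s)] with x hx hx'
          rw [hx', Pi.sub_apply, hx]
      _ = ENNReal.ofReal (8 * T.size ^ 2) * ENNReal.ofReal (∑ i, ‖u.deriv i‖ ^ 2) := by
          rw [← Finset.mul_sum, ← T.lintegral_eq_sum hΩ hL, lintegral_sum_enorm_sq_eq]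
      _ = ENNReal.ofReal (8 * T.size ^ 2 * ∑ i, ‖u.deriv i‖ ^ 2) :=
          (ENNReal.ofReal_mul (by positivity)).symm
      _ ≤ _ := by
          refine ENNReal.ofReal_le_ofReal (mul_le_mul_of_nonneg_left ?_ (by positivity))
          rw [H1.norm_sq_eq]
          linarith [sq_nonneg ‖u.toL2‖]
  exact (ENNReal.ofReal_le_ofReal_iff (by positivity)).1 hmain

/-! ### The sesquilinear form and the Fredholm alternative -/

/-- Multiplication by an essentially bounded function is a bounded operator on `L²(Ω)`. -/
theorem exists_mul_operator {Ω : Set Plane} {n : Plane → ℂ}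
    (hn : MemLp n ⊤ ((volume : Measure Plane).restrict Ω)) :
    ∃ N : L2 Ω →L[ℂ] L2 Ω, ∀ u v : L2 Ω,
      inner ℂ v (N u) = ∫ x in Ω, n x * u x * (starRingEnd ℂ) (v x) := by
  refine ⟨(ContinuousLinearMap.mul ℂ ℂ).holderL (volume.restrict Ω) ⊤ 2 2 hn.toLp, fun u v => ?_⟩
  rw [L2.inner_def]
  refine integral_congr_ae ?_
  have h := ContinuousLinearMap.coeFn_holder (r := 2) (ContinuousLinearMap.mul ℂ ℂ) hn.toLp u
  filter_upwards [h, hn.coeFn_toLp] with x hx hx'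
  rw [ContinuousLinearMap.holderL_apply_apply, hx, hx']
  rfl

/-- The operator on `H¹` associated with the form is a perturbation of the identity through
`L²`. -/
theorem exists_form_operator {Ω : Set Plane} {n : Plane → ℂ} (κ : ℂ)
    (hn : MemLp n ⊤ ((volume : Measure Plane).restrict Ω)) :
    ∃ M : L2 Ω →L[ℂ] L2 Ω, ∀ u v : H1 Ω,
      form κ n u v = inner ℂ v u - inner ℂ v.toL2 (M u.toL2) := by
  obtain ⟨N, hN⟩ := exists_mul_operator hn
  refine ⟨ContinuousLinearMap.id ℂ _ + κ • N, fun u v => ?_⟩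
  rw [form, add_apply, inner_add_right, smul_apply,
    inner_smul_right, hN, H1.inner_eq, ContinuousLinearMap.id_apply]
  simp_rw [pairing_eq_inner]
  ring

section Abstract

variable {H X : Type*} [NormedAddCommGroup H] [InnerProductSpace ℂ H] [CompleteSpace H]
  [NormedAddCommGroup X] [InnerProductSpace ℂ X] [CompleteSpace X]

/-- An operator which is approximated by finite-dimensional subspaces, uniformly on the unit ball, is
compact. -/
theorem isCompactOperator_of_forall_finiteDimensional {H X : Type*} [NormedAddCommGroup H]
    [NormedSpace ℂ H] [NormedAddCommGroup X] [InnerProductSpace ℂ X] [CompleteSpace X]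
    (ι : H →L[ℂ] X)
    (h : ∀ ε : ℝ, 0 < ε → ∃ W : Submodule ℂ X, FiniteDimensional ℂ W ∧
      ∀ u, ∃ s ∈ W, ‖ι u - s‖ ≤ ε * ‖u‖) : IsCompactOperator ι := by
  choose W hWf hW using fun m : ℕ => h (1 / ((m : ℝ) + 1)) (by positivity)
  have hcomp : ∀ m, IsCompactOperator ((W m).starProjection.comp ι) := by
    intro m
    have h1 : IsCompactOperator (id : W m → W m) :=
      isCompactOperator_id_iff_finiteDimensional.2 (hWf m)
    exact (h1.comp_clm ((W m).orthogonalProjectionOnto.comp ι)).clm_comp (W m).subtypeL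
  refine isCompactOperator_of_tendsto (l := atTop) (F := fun m => (W m).starProjection.comp ι) ?_
    (Eventually.of_forall hcomp)
  rw [tendsto_iff_norm_sub_tendsto_zero]
  refine squeeze_zero (fun _ => norm_nonneg _) (fun m => ?_)
    tendsto_one_div_add_atTop_nhds_zero_nat
  refine ContinuousLinearMap.opNorm_le_bound _ (by positivity) fun u => ?_
  obtain ⟨s, hs, hle⟩ := hW m u
  have h1 : ‖ι u - (W m).starProjection (ι u)‖ ≤ ‖ι u - s‖ := by
    rw [Submodule.starProjection_minimal]
    exact ciInf_le ⟨0, by rintro _ ⟨y, rfl⟩; exact norm_nonneg _⟩ (⟨s, hs⟩ : W m)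
  rw [sub_apply, ContinuousLinearMap.comp_apply, norm_sub_rev]
  exact h1.trans hle

theorem inner_one_sub_adjoint_comp (ι : H →L[ℂ] X) (M : X →L[ℂ] X) (u v : H) :
    inner ℂ v ((1 - (ContinuousLinearMap.adjoint ι).comp (M.comp ι) : H →L[ℂ] H) u) =
      inner ℂ v u - inner ℂ (ι v) (M (ι u)) := by
  rw [sub_apply, inner_sub_right, one_apply_eq_self,
    ContinuousLinearMap.comp_apply, ContinuousLinearMap.adjoint_inner_right,
    ContinuousLinearMap.comp_apply]

theorem exists_operator_sub_adjoint_comp (ι : H →L[ℂ] X) (M : X →L[ℂ] X) :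
    ∃ A : H →L[ℂ] H, ∀ u v, inner ℂ v (A u) = inner ℂ v u - inner ℂ (ι v) (M (ι u)) :=
  ⟨_, inner_one_sub_adjoint_comp ι M⟩

/-- If a compact perturbation of the identity is injective, the adjoint problem is solvable, with
a bounded solution operator. -/
theorem exists_adjoint_solution {ι : H →L[ℂ] X} (hι : IsCompactOperator ι) (M : X →L[ℂ] X)
    (hinj : ∀ u : H, (∀ v : H, inner ℂ v u - inner ℂ (ι v) (M (ι u)) = 0) → u = 0) :
    ∃ S : X →L[ℂ] H, ∀ (f : X) (v : H),
      inner ℂ (S f) v - inner ℂ (ι (S f)) (M (ι v)) = inner ℂ f (ι v) := by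
  set K : H →L[ℂ] H := (ContinuousLinearMap.adjoint ι).comp (M.comp ι) with hK
  have hKc : IsCompactOperator K := (hι.clm_comp M).clm_comp (ContinuousLinearMap.adjoint ι)
  have hA := fun u v => inner_one_sub_adjoint_comp ι M u v
  rw [← hK] at hA
  rcases hKc.hasEigenvalue_or_mem_resolventSet (one_ne_zero (α := ℂ)) with hev | hres
  · obtain ⟨u, hu⟩ := hev.exists_hasEigenvector
    refine absurd (hinj u fun v => ?_) hu.2
    have hKu : K u = u := by simpa using hu.apply_eq_smul
    rw [← hA, sub_apply, hKu]
    simp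
  · have hunit : IsUnit (1 - K) := by
      have h1 := hres
      rw [spectrum.mem_resolventSet_iff, map_one] at h1
      exact h1
    obtain ⟨B, hB⟩ := hunit.exists_left_inv
    refine ⟨(ContinuousLinearMap.adjoint B).comp (ContinuousLinearMap.adjoint ι), fun f v => ?_⟩
    rw [← hA, ContinuousLinearMap.comp_apply, ContinuousLinearMap.adjoint_inner_left,
      ContinuousLinearMap.adjoint_inner_left]
    have : B ((1 - K) v) = v := by
      rw [← mul_apply_eq_comp, hB]
      rfl
    rw [this]

/-- Schatz's argument: for a form satisfying a Gårding inequality, duality and approximability of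
the solutions of the dual problem yield error bounds for a Galerkin-orthogonal error. -/
theorem galerkin_error_bounds {H X : Type*} [NormedAddCommGroup H]
    [InnerProductSpace ℂ H] [NormedAddCommGroup X] [InnerProductSpace ℂ X] {ι : H →L[ℂ] X} {M : X →L[ℂ] X} {S : X →L[ℂ] H}
    (hS : ∀ (f : X) (v : H), inner ℂ (S f) v - inner ℂ (ι (S f)) (M (ι v)) = inner ℂ f (ι v))
    {V : Submodule ℂ H} {η α : ℝ} (hη : 0 ≤ η)
    (happrox : ∀ f : X, ∃ v ∈ V, ‖S f - v‖ ≤ η * ‖f‖)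
    {A : H →L[ℂ] H} (hA : ∀ u v, inner ℂ v (A u) = inner ℂ v u - inner ℂ (ι v) (M (ι u)))
    (hα : ‖A‖ ≤ α)
    (hsmall : ‖M‖ * (α * η) ^ 2 ≤ 1 / 2) {e : H}
    (he : ∀ v ∈ V, inner ℂ v e - inner ℂ (ι v) (M (ι e)) = 0) :
    ‖ι e‖ ≤ α * η * ‖e‖ ∧ ∀ z : H, e - z ∈ V → ‖e‖ ≤ 2 * α * ‖z‖ := by
  have hα0 : 0 ≤ α := (norm_nonneg _).trans hα
  have hAle : ∀ u v : H, ‖inner ℂ v (A u)‖ ≤ α * ‖u‖ * ‖v‖ := fun u v => by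
    refine (norm_inner_le_norm _ _).trans ?_
    rw [mul_comm]
    exact mul_le_mul_of_nonneg_right (A.le_of_opNorm_le hα u) (norm_nonneg _)
  have h1 : ‖ι e‖ ≤ α * η * ‖e‖ := by
    obtain ⟨v, hv, hle⟩ := happrox (ι e)
    have h2 : inner ℂ (ι e) (ι e) = inner ℂ (S (ι e) - v) (A e) := by
      rw [inner_sub_left, hA, hA, hS, he v hv, sub_zero]
    have h3 : ‖ι e‖ * ‖ι e‖ ≤ (α * η * ‖e‖) * ‖ι e‖ := by
      calc ‖ι e‖ * ‖ι e‖ = ‖(inner ℂ (ι e) (ι e) : ℂ)‖ := by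
            rw [inner_self_eq_norm_sq_to_K]
            simp [sq]
        _ ≤ α * ‖e‖ * ‖S (ι e) - v‖ := by rw [h2]; exact hAle _ _
        _ ≤ α * ‖e‖ * (η * ‖ι e‖) := by gcongr
        _ = _ := by ring
    rcases (norm_nonneg (ι e)).eq_or_lt' with h0 | hpos
    · rw [h0]
      positivity
    · exact le_of_mul_le_mul_right h3 hpos
  refine ⟨h1, fun z hz => ?_⟩
  have h4 : inner ℂ e (A e) = inner ℂ z (A e) := by
    have h5 : inner ℂ (e - z) (A e) = 0 := by rw [hA]; exact he _ hz
    rw [inner_sub_left] at h5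
    exact sub_eq_zero.1 h5
  -- The Gårding inequality.
  have h6 : ‖e‖ * ‖e‖ ≤ α * ‖e‖ * ‖z‖ + ‖M‖ * (‖ι e‖ * ‖ι e‖) := by
    have h7 : (inner ℂ e e : ℂ) = inner ℂ z (A e) + inner ℂ (ι e) (M (ι e)) := by
      rw [← h4, hA]
      ring
    calc ‖e‖ * ‖e‖ = ‖(inner ℂ e e : ℂ)‖ := by
          rw [inner_self_eq_norm_sq_to_K]
          simp [sq]
      _ ≤ ‖(inner ℂ z (A e) : ℂ)‖ + ‖(inner ℂ (ι e) (M (ι e)) : ℂ)‖ := by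
          rw [h7]
          exact norm_add_le _ _
      _ ≤ α * ‖e‖ * ‖z‖ + ‖ι e‖ * (‖M‖ * ‖ι e‖) :=
          add_le_add (hAle _ _) ((norm_inner_le_norm _ _).trans
            (mul_le_mul_of_nonneg_left (M.le_opNorm _) (norm_nonneg _)))
      _ = _ := by ring
  have h8 : ‖M‖ * (‖ι e‖ * ‖ι e‖) ≤ 1 / 2 * (‖e‖ * ‖e‖) := by
    calc ‖M‖ * (‖ι e‖ * ‖ι e‖) ≤ ‖M‖ * ((α * η * ‖e‖) * (α * η * ‖e‖)) := by gcongr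
      _ = ‖M‖ * (α * η) ^ 2 * (‖e‖ * ‖e‖) := by ring
      _ ≤ _ := by gcongr
  rcases (norm_nonneg e).eq_or_lt' with h0 | hpos
  · rw [h0]
    positivity
  · refine le_of_mul_le_mul_right ?_ hpos
    linarith

/-- The error bounds for a family of trial spaces with parameter `h i`, for a sesquilinear form which
is a compact perturbation of the inner product, if the solutions of the dual problem are
approximated to first order. -/
theorem exists_galerkin_constants {ι : H →L[ℂ] X}
    (hι : ∀ ε : ℝ, 0 < ε → ∃ W : Submodule ℂ X, FiniteDimensional ℂ W ∧
      ∀ u, ∃ s ∈ W, ‖ι u - s‖ ≤ ε * ‖u‖) (M : X →L[ℂ] X)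
    {a : H → H → ℂ} (ha : ∀ u v, a u v = inner ℂ v u - inner ℂ (ι v) (M (ι u)))
    (hinj : ∀ u, (∀ v, a u v = 0) → u = 0) {I : Type*} {V : I → Submodule ℂ H} {h : I → ℝ}
    (hh : ∀ i, 0 ≤ h i)
    (happrox : ∀ S : X →L[ℂ] H, (∀ f v, a v (S f) = inner ℂ f (ι v)) →
      ∃ C : ℝ, 0 ≤ C ∧ ∀ i, h i ≤ 1 → ∀ f, ∃ v ∈ V i, ‖S f - v‖ ≤ C * h i * ‖f‖) :
    ∃ h₀ : ℝ, 0 < h₀ ∧ ∃ C : ℝ, 0 < C ∧ ∀ i, h i ≤ h₀ → ∀ e, (∀ v ∈ V i, a e v = 0) →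
      ‖ι e‖ ≤ C * h i * ‖e‖ ∧ ∀ z, e - z ∈ V i → ‖e‖ ≤ C * ‖z‖ := by
  obtain ⟨S, hS⟩ := exists_adjoint_solution
    (isCompactOperator_of_forall_finiteDimensional ι hι) M fun u hu => hinj u fun v => by rw [ha, hu]
  obtain ⟨C, hC, happrox⟩ := happrox S fun f v => by rw [ha, hS]
  obtain ⟨A, hA⟩ := exists_operator_sub_adjoint_comp ι M
  have hα0 : 0 ≤ ‖A‖ := norm_nonneg _
  set B := ‖M‖ * (‖A‖ * C) ^ 2 with hB
  have hB0 : 0 ≤ B := by positivity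
  have hh1 : 1 / (1 + 2 * B) ≤ 1 := by
    rw [div_le_one (by positivity)]
    linarith
  have hαC : 0 ≤ ‖A‖ * C := by positivity
  refine ⟨1 / (1 + 2 * B), by positivity, 2 * ‖A‖ + ‖A‖ * C + 1, by positivity,
    fun i hi e he => ?_⟩
  have hi0 := hh i
  -- The threshold `1 / (1 + 2 B)` makes the zeroth-order term of the Gårding inequality absorbable.
  have hsmall : ‖M‖ * (‖A‖ * (C * h i)) ^ 2 ≤ 1 / 2 := by
    have h1 : h i * (1 + 2 * B) ≤ 1 := (le_div_iff₀ (by positivity)).1 hi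
    have h2 : B * h i * h i ≤ B * h i * 1 :=
      mul_le_mul_of_nonneg_left (hi.trans hh1) (by positivity)
    calc ‖M‖ * (‖A‖ * (C * h i)) ^ 2 = B * h i * h i := by rw [hB]; ring
      _ ≤ 1 / 2 := by linarith
  obtain ⟨h1, h2⟩ := galerkin_error_bounds hS (by positivity) (happrox i (hi.trans hh1)) hA le_rfl
    hsmall fun v hv => (ha e v).symm.trans (he v hv)
  refine ⟨h1.trans ?_, fun z hz => (h2 z hz).trans ?_⟩
  · rw [← mul_assoc]
    gcongr
    linarith
  · gcongr
    linarith

end Abstract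

/-- On a finite-dimensional space, uniqueness for the discrete problem implies existence. -/
theorem exists_galerkin_solution {H X : Type*} [NormedAddCommGroup H]
    [InnerProductSpace ℂ H] [NormedAddCommGroup X] [InnerProductSpace ℂ X] [CompleteSpace X]
    (A : H →L[ℂ] H) (V : Submodule ℂ H) [FiniteDimensional ℂ V]
    (hinj : ∀ e ∈ V, (∀ v ∈ V, inner ℂ v (A e) = 0) → e = 0) (F : V →ₗ[ℂ] X) (g : X) :
    ∃ u ∈ V, ∀ v : V, inner ℂ (v : H) (A u) = inner ℂ (F v) g := by
  set G : V →ₗ[ℂ] V := (V.orthogonalProjectionOnto.comp (A.comp V.subtypeL)).toLinearMap with hG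
  have hGi : ∀ u v : V, inner ℂ v (G u) = inner ℂ (v : H) (A u) := fun u v => by
    rw [hG]
    exact Submodule.inner_orthogonalProjectionOnto_eq_of_mem_left v (A u)
  have hGinj : Function.Injective G := by
    rw [← LinearMap.ker_eq_bot, LinearMap.ker_eq_bot']
    intro e he
    refine Subtype.ext (hinj e e.2 fun v hv => ?_)
    rw [← hGi e ⟨v, hv⟩, he, inner_zero_right]
  have hcomp : CompleteSpace V := FiniteDimensional.complete ℂ V
  obtain ⟨u, hu⟩ := (LinearMap.injective_iff_surjective.1 hGinj)
    (ContinuousLinearMap.adjoint (LinearMap.toContinuousLinearMap F) g)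
  refine ⟨u, u.2, fun v => ?_⟩
  rw [← hGi, hu, ContinuousLinearMap.adjoint_inner_right]
  rfl

/-- A bounded family of `H²` functions has second derivatives bounded in `L²`, by the closed graph
theorem. -/
theorem exists_second_deriv_bound {Ω : Set Plane} (hΩ : IsOpen Ω) (S : L2 Ω →L[ℂ] H1 Ω)
    (hS : ∀ f, IsH2 (S f)) :
    ∃ C : ℝ, 0 ≤ C ∧ ∀ f, ∃ D : Fin 2 → Fin 2 → L2 Ω,
      (∀ i j, IsWeakPartial Ω j ((S f).deriv i) (D i j)) ∧
      ∑ q : Fin 2 × Fin 2, ‖D q.1 q.2‖ ^ 2 ≤ C ^ 2 * ‖f‖ ^ 2 := by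
  choose D hD using hS
  have hbound : ∀ q : Fin 2 × Fin 2, ∃ C : ℝ, 0 ≤ C ∧ ∀ f, ‖D f q.1 q.2‖ ≤ C * ‖f‖ := by
    rintro ⟨i, j⟩
    let G : L2 Ω →ₗ[ℂ] L2 Ω :=
      { toFun := fun f => D f i j
        map_add' := fun f g => by
          refine (hD (f + g) i j).unique hΩ ?_
          rw [map_add]
          exact (hD f i j).add (hD g i j)
        map_smul' := fun c f => by
          refine (hD (c • f) i j).unique hΩ ?_
          rw [map_smul]
          exact (hD f i j).smul c }
    have hG : Continuous G := by
      refine G.continuous_of_isClosed_graph ?_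
      have h1 : (G.graph : Set (L2 Ω × L2 Ω)) =
          (fun q : L2 Ω × L2 Ω => (H1.derivL Ω i (S q.1), q.2)) ⁻¹'
            {w : L2 Ω × L2 Ω | IsWeakPartial Ω j w.1 w.2} := by
        ext q
        constructor
        · intro hq
          have hq' : q.2 = D q.1 i j := (LinearMap.mem_graph_iff _ _).1 hq
          change IsWeakPartial Ω j ((S q.1).deriv i) q.2
          rw [hq']
          exact hD q.1 i j
        · intro hq
          have hq' : IsWeakPartial Ω j ((S q.1).deriv i) q.2 := hq
          exact (LinearMap.mem_graph_iff _ _).2 (hq'.unique hΩ (hD q.1 i j))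
      rw [h1]
      exact (isClosed_isWeakPartial Ω j).preimage (by fun_prop)
    refine ⟨‖(⟨G, hG⟩ : L2 Ω →L[ℂ] L2 Ω)‖, norm_nonneg _, fun f => ?_⟩
    exact (⟨G, hG⟩ : L2 Ω →L[ℂ] L2 Ω).le_opNorm f
  choose C hC0 hC using hbound
  refine ⟨Real.sqrt (∑ q, C q ^ 2), Real.sqrt_nonneg _, fun f => ⟨D f, hD f, ?_⟩⟩
  rw [Real.sq_sqrt (Finset.sum_nonneg fun _ _ => sq_nonneg _), Finset.sum_mul]
  refine Finset.sum_le_sum fun q _ => ?_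
  rw [← mul_pow]
  exact pow_le_pow_left₀ (norm_nonneg _) (hC q f) 2

/-! ### The finite element space and its boundary values -/

theorem memLp_indicator_eval {Ω : Set Plane} (hb : Bornology.IsBounded Ω) (t : Finset Plane)
    (P : MvPolynomial (Fin 2) ℂ) :
    MemLp ((interior (triangle t)).indicator
      fun x : Plane => MvPolynomial.eval (fun i => ((x i : ℝ) : ℂ)) P) 2
      ((volume : Measure Plane).restrict Ω) := by
  have hfin : IsFiniteMeasure ((volume : Measure Plane).restrict Ω) :=
    ⟨by rw [Measure.restrict_apply_univ]; exact hb.measure_lt_top⟩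
  have hc : Continuous fun x : Plane => MvPolynomial.eval (fun i => ((x i : ℝ) : ℂ)) P :=
    (MvPolynomial.continuous_eval P).comp (by fun_prop)
  obtain ⟨K, hK⟩ := (isCompact_triangle t).exists_bound_of_continuousOn hc.continuousOn
  refine MemLp.of_bound (hc.aestronglyMeasurable.indicator isOpen_interior.measurableSet) (max K 0)
    (Eventually.of_forall fun x => ?_)
  by_cases hx : x ∈ interior (triangle t)
  · rw [indicator_of_mem hx]
    exact (hK x (interior_subset hx)).trans (le_max_left _ _)
  · rw [indicator_of_notMem hx, norm_zero]
    exact le_max_right _ _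

/-- Extension by zero of a polynomial on a triangle, as a linear map into `L²(Ω)`. -/
def cellPolynomial {Ω : Set Plane} (hb : Bornology.IsBounded Ω) (t : Finset Plane) :
    MvPolynomial (Fin 2) ℂ →ₗ[ℂ] L2 Ω where
  toFun P := (memLp_indicator_eval hb t P).toLp
  map_add' P Q := by
    rw [← MemLp.toLp_add]
    refine MemLp.toLp_congr _ _ (Eventually.of_forall fun x => ?_)
    by_cases hx : x ∈ interior (triangle t) <;> simp [hx]
  map_smul' c P := by
    rw [RingHom.id_apply, ← MemLp.toLp_const_smul]
    refine MemLp.toLp_congr _ _ (Eventually.of_forall fun x => ?_)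
    by_cases hx : x ∈ interior (triangle t) <;> simp [hx, MvPolynomial.smul_eval]

/-- A finite element function is a sum of polynomials of bounded degree on the triangles, extended by
zero, and an `H¹` function is determined by its class in `L²(Ω)`. -/
theorem Mesh.finiteDimensional_lagrange {Ω : Set Plane} (hΩ : IsOpen Ω)
    (hL : HasLipschitzBoundary Ω) (hb : Bornology.IsBounded Ω) (T : Mesh Ω) (p : ℕ) :
    FiniteDimensional ℂ (T.lagrange p) := by
  classical
  set W : Submodule ℂ (L2 Ω) := T.cells.sup fun t =>
    (MvPolynomial.restrictTotalDegree (Fin 2) ℂ p).map (cellPolynomial hb t) with hW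
  have hinj : Function.Injective (H1.toL2L Ω).toLinearMap := fun u v h => H1.ext_toL2 hΩ h
  have hle : (T.lagrange p).map (H1.toL2L Ω).toLinearMap ≤ W := by
    rintro _ ⟨v, ⟨φ, ⟨-, hφ⟩, hv⟩, rfl⟩
    choose! P hP hφP using hφ
    have heq : v.toL2 = ∑ t ∈ T.cells, cellPolynomial hb t (P t) := by
      refine Lp.ext ?_
      refine Filter.EventuallyEq.trans ?_ (Lp.coeFn_fun_finsetSum _ _).symm
      have hcell : ∀ᵐ x ∂((volume : Measure Plane).restrict Ω), ∀ t ∈ T.cells,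
          cellPolynomial hb t (P t) x = (interior (triangle t)).indicator
            (fun x : Plane => MvPolynomial.eval (fun i => ((x i : ℝ) : ℂ)) (P t)) x :=
        (Finset.eventually_all _).2 fun t _ => (memLp_indicator_eval hb t (P t)).coeFn_toLp
      refine (T.ae_iff hΩ hL).2 fun s hs => ?_
      filter_upwards [ae_mono (Measure.restrict_mono (T.interior_subset hΩ hL hs) le_rfl)
        (hv.and hcell), ae_restrict_mem isOpen_interior.measurableSet] with x hx hxs
      rw [hx.1, Finset.sum_congr rfl hx.2, Finset.sum_eq_single_of_mem s hs,
        indicator_of_mem hxs, hφP s hs x (_root_.interior_subset hxs)]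
      intro t ht hts
      exact indicator_of_notMem
        (fun hxt => Set.disjoint_left.1 (T.disjoint_interior ht hs hts) hxt hxs) _
    change v.toL2 ∈ W
    rw [heq]
    refine Submodule.sum_mem _ fun t ht => ?_
    have h1 : (MvPolynomial.restrictTotalDegree (Fin 2) ℂ p).map (cellPolynomial hb t) ≤ W :=
      Finset.le_sup (f := fun t =>
        (MvPolynomial.restrictTotalDegree (Fin 2) ℂ p).map (cellPolynomial hb t)) ht
    exact h1 (Submodule.mem_map_of_mem ((MvPolynomial.mem_restrictTotalDegree _ _ _).2 (hP t ht)))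
  have hWf : FiniteDimensional ℂ W := Submodule.finiteDimensional_finset_sup _ _
  have hmf := Submodule.finiteDimensional_of_le hle
  exact (Submodule.equivMapOfInjective _ hinj (T.lagrange p)).symm.finiteDimensional

/-- The boundary of a polygon has finite length. -/
theorem IsLipschitzPolygon.isFiniteMeasure_boundaryMeasure {Ω : Set Plane}
    (hΩ : IsLipschitzPolygon Ω) : IsFiniteMeasure (boundaryMeasure Ω) := by
  refine ⟨?_⟩
  obtain ⟨S, hS⟩ := hΩ.frontier_eq
  rw [Measure.restrict_apply_univ, hS]
  refine (measure_biUnion_finset_le _ _).trans_lt (ENNReal.sum_lt_top.2 fun s _ => ?_)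
  rw [hausdorffMeasure_segment]
  exact edist_lt_top _ _

theorem IsLipschitzPolygon.exists_isBoundaryRestriction {Ω : Set Plane}
    (hΩ : IsLipschitzPolygon Ω) (T : Mesh Ω) {p : ℕ} {v : H1 Ω} (hv : v ∈ T.lagrange p) :
    ∃ γ : L2Boundary Ω, IsBoundaryRestriction v γ := by
  obtain ⟨φ, ⟨hφ, -⟩, hvφ⟩ := hv
  have hfin := hΩ.isFiniteMeasure_boundaryMeasure
  obtain ⟨K, hK⟩ := hΩ.isBounded.isCompact_closure.exists_bound_of_continuousOn hφ
  have hm : MemLp φ 2 (boundaryMeasure Ω) := by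
    refine MemLp.of_bound ((hφ.mono frontier_subset_closure).aestronglyMeasurable
      isClosed_frontier.measurableSet) K ?_
    filter_upwards [ae_restrict_mem isClosed_frontier.measurableSet] with x hx
    exact hK x (frontier_subset_closure hx)
  exact ⟨hm.toLp, φ, hφ, hvφ, hm.coeFn_toLp⟩

/-- The boundary values of a continuous `H¹` function are determined by its class in `L²(Ω)`. -/
theorem IsBoundaryRestriction.unique {Ω : Set Plane} (hΩ : IsOpen Ω) {v : H1 Ω}
    {γ δ : L2Boundary Ω} (hγ : IsBoundaryRestriction v γ) (hδ : IsBoundaryRestriction v δ) :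
    γ = δ := by
  obtain ⟨φ, hφ, hvφ, hγφ⟩ := hγ
  obtain ⟨ψ, hψ, hvψ, hδψ⟩ := hδ
  have h1 : EqOn φ ψ Ω := Measure.eqOn_open_of_ae_eq (hvφ.symm.trans hvψ) hΩ
    (hφ.mono subset_closure) (hψ.mono subset_closure)
  have h2 : EqOn φ ψ (closure Ω) := h1.of_subset_closure hφ hψ subset_closure subset_rfl
  refine Lp.ext ?_
  filter_upwards [hγφ, hδψ, ae_restrict_mem isClosed_frontier.measurableSet] with x hx hx' hxf
  rw [hx, hx', h2 (frontier_subset_closure hxf)]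

theorem IsBoundaryRestriction.add {Ω : Set Plane} {v w : H1 Ω} {γ δ : L2Boundary Ω}
    (hγ : IsBoundaryRestriction v γ) (hδ : IsBoundaryRestriction w δ) :
    IsBoundaryRestriction (v + w) (γ + δ) := by
  obtain ⟨φ, hφ, hvφ, hγφ⟩ := hγ
  obtain ⟨ψ, hψ, hwψ, hδψ⟩ := hδ
  exact ⟨φ + ψ, hφ.add hψ, (Lp.coeFn_add v.toL2 w.toL2).trans (hvφ.add hwψ),
    (Lp.coeFn_add γ δ).trans (hγφ.add hδψ)⟩

theorem IsBoundaryRestriction.smul {Ω : Set Plane} {v : H1 Ω} {γ : L2Boundary Ω} (c : ℂ)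
    (hγ : IsBoundaryRestriction v γ) : IsBoundaryRestriction (c • v) (c • γ) := by
  obtain ⟨φ, hφ, hvφ, hγφ⟩ := hγ
  exact ⟨c • φ, hφ.const_smul c, (Lp.coeFn_smul c v.toL2).trans (hvφ.const_smul c),
    (Lp.coeFn_smul c γ).trans (hγφ.const_smul c)⟩

theorem IsBoundaryRestriction.isTrace {Ω : Set Plane} {v : H1 Ω} {γ : L2Boundary Ω}
    (h : IsBoundaryRestriction v γ) : IsTrace v γ :=
  ⟨fun _ => v, fun _ => γ, fun _ => h, tendsto_const_nhds, tendsto_const_nhds⟩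

/-- Restriction to the boundary is a linear map on the finite element space; its range is the
boundary space. -/
theorem IsLipschitzPolygon.exists_restriction {Ω : Set Plane} (hΩ : IsLipschitzPolygon Ω)
    (T : Mesh Ω) (p : ℕ) :
    ∃ F : T.lagrange p →ₗ[ℂ] L2Boundary Ω, ∀ v : T.lagrange p,
      IsBoundaryRestriction (v : H1 Ω) (F v) := by
  choose F hF using fun v : T.lagrange p => hΩ.exists_isBoundaryRestriction T v.2
  exact ⟨{ toFun := F
           map_add' := fun v w => (hF (v + w)).unique hΩ.isOpen ((hF v).add (hF w))
           map_smul' := fun c v => (hF (c • v)).unique hΩ.isOpen ((hF v).smul c) }, hF⟩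

theorem Mesh.exists_unique_isBoundaryProjection {Ω : Set Plane} (hΩ : IsLipschitzPolygon Ω)
    (T : Mesh Ω) (p : ℕ) (g : L2Boundary Ω) : ∃! gh, T.IsBoundaryProjection p g gh := by
  obtain ⟨F, hF⟩ := hΩ.exists_restriction T p
  have hfd := T.finiteDimensional_lagrange hΩ.isOpen hΩ.lipschitz hΩ.isBounded p
  have hmem : ∀ γ, T.MemBoundarySpace p γ ↔ γ ∈ LinearMap.range F := by
    intro γ
    constructor
    · rintro ⟨v, hv, hγ⟩
      exact ⟨⟨v, hv⟩, (hF ⟨v, hv⟩).unique hΩ.isOpen hγ⟩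
    · rintro ⟨v, rfl⟩
      exact ⟨v.1, v.2, hF v⟩
  refine ⟨(LinearMap.range F).starProjection g, ⟨?_, fun γ hγ => ?_⟩, fun δ hδ => ?_⟩
  · exact (hmem _).2 (Submodule.starProjection_apply_mem _ _)
  · rw [boundaryPairing_eq_inner]
    exact inner_eq_zero_symm.1 (Submodule.starProjection_inner_eq_zero _ _ ((hmem _).1 hγ))
  · refine (Submodule.eq_starProjection_of_mem_of_inner_eq_zero ((hmem _).1 hδ.1)
      fun w hw => ?_).symm
    have h := hδ.2 w ((hmem w).2 hw)
    rw [boundaryPairing_eq_inner] at h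
    exact inner_eq_zero_symm.1 h

/-! ### Quasi-optimality of the discrete source problem -/

theorem memLp_refractiveIndex {Ω : Set Plane} (hΩ : IsOpen Ω) {k : ℝ} {n₁ n₂ : Plane → ℝ}
    (hn₁ : ContDiffOn ℝ ∞ n₁ Ω) (hn₂ : ContDiffOn ℝ ∞ n₂ Ω)
    (hn₁_pos : ∀ x ∈ Ω, 0 < n₁ x) (hn₂_nonneg : ∀ x ∈ Ω, 0 ≤ n₂ x)
    (hn₁_bdd : ∃ B : ℝ, ∀ x ∈ Ω, n₁ x ≤ B) (hn₂_bdd : ∃ B : ℝ, ∀ x ∈ Ω, n₂ x ≤ B) :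
    MemLp (refractiveIndex k n₁ n₂) ⊤ ((volume : Measure Plane).restrict Ω) := by
  obtain ⟨B₁, hB₁⟩ := hn₁_bdd
  obtain ⟨B₂, hB₂⟩ := hn₂_bdd
  have hc : ContinuousOn (refractiveIndex k n₁ n₂) Ω := by
    have h1 : ContinuousOn (fun x => (n₁ x : ℂ)) Ω :=
      Complex.continuous_ofReal.comp_continuousOn hn₁.continuousOn
    have h2 : ContinuousOn (fun x => (n₂ x : ℂ)) Ω :=
      Complex.continuous_ofReal.comp_continuousOn hn₂.continuousOn
    exact h1.add (continuousOn_const.mul (h2.div_const _))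
  refine memLp_top_of_bound (hc.aestronglyMeasurable hΩ.measurableSet) (B₁ + B₂ / |k|) ?_
  filter_upwards [ae_restrict_mem hΩ.measurableSet] with x hx
  refine (norm_add_le _ _).trans (add_le_add ?_ ?_)
  · rw [Complex.norm_real, Real.norm_of_nonneg (hn₁_pos x hx).le]
    exact hB₁ x hx
  · rw [norm_mul, Complex.norm_I, one_mul, norm_div, Complex.norm_real, Complex.norm_real,
      Real.norm_of_nonneg (hn₂_nonneg x hx), Real.norm_eq_abs]
    gcongr
    exact hB₂ x hx

/-- The solution operator of the adjoint problem is approximated by finite elements to first order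
in the mesh size. -/
theorem exists_approx_constant {Ω : Set Plane} (hΩ : IsLipschitzPolygon Ω)
    (S : L2 Ω →L[ℂ] H1 Ω) (hS : ∀ f, IsH2 (S f)) (σ : ℝ) :
    ∃ C : ℝ, 0 ≤ C ∧ ∀ T : Mesh Ω, T.IsRegular σ → T.size ≤ 1 → ∀ p : ℕ, 1 ≤ p → ∀ f : L2 Ω,
      ∃ v ∈ T.lagrange p, ‖S f - v‖ ≤ C * T.size * ‖f‖ := by
  obtain ⟨C, hC0, hC⟩ := exists_second_deriv_bound hΩ.isOpen S hS
  refine ⟨Real.sqrt (3 * (1 + 2 * σ ^ 2)) * C, by positivity, fun T hTσ hT p hp f => ?_⟩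
  obtain ⟨D, hD, hDle⟩ := hC f
  obtain ⟨v, hv, hle⟩ := T.exists_interpolation_le hΩ.isOpen hΩ.lipschitz hΩ.isBounded hTσ hp hD
  have h0 := T.size_nonneg
  refine ⟨v, hv, le_of_sq_le_sq (hle.trans ?_) (by positivity)⟩
  have h1 : T.size ^ 2 ≤ 1 := pow_le_one₀ h0 hT
  calc 3 * (T.size ^ 2 + 2 * σ ^ 2) * T.size ^ 2 * ∑ q : Fin 2 × Fin 2, ‖D q.1 q.2‖ ^ 2
      ≤ 3 * (1 + 2 * σ ^ 2) * T.size ^ 2 * (C ^ 2 * ‖f‖ ^ 2) := by gcongr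
    _ = (Real.sqrt (3 * (1 + 2 * σ ^ 2)) * C * T.size * ‖f‖) ^ 2 := by
      rw [mul_pow, mul_pow, mul_pow, Real.sq_sqrt (by positivity)]
      ring

theorem exists_form_eq_inner {Ω : Set Plane} {n : Plane → ℂ} (κ : ℂ)
    (hn : MemLp n ⊤ ((volume : Measure Plane).restrict Ω)) :
    ∃ A : H1 Ω →L[ℂ] H1 Ω, ∀ u v : H1 Ω, inner ℂ v (A u) = form κ n u v := by
  obtain ⟨M, hM⟩ := exists_form_operator κ hn
  obtain ⟨A, hA⟩ := exists_operator_sub_adjoint_comp (H := H1 Ω) (X := L2 Ω) (H1.toL2L Ω) M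
  exact ⟨A, fun u v => (hA u v).trans (hM u v).symm⟩

/-- On fine meshes, an error orthogonal to the finite element space is quasi-optimal in `H¹` and of
one order of the mesh size better in `L²`. -/
theorem exists_error_bounds {Ω : Set Plane} (hΩ : IsLipschitzPolygon Ω) {κ : ℂ}
    {n : Plane → ℂ} (hn : MemLp n ⊤ ((volume : Measure Plane).restrict Ω))
    (hNeumann : ¬ IsNeumannEigenvalue Ω n κ) (hReg : AdjointH2Regular Ω κ n) {p : ℕ} (hp : 1 ≤ p)
    (σ : ℝ) (hT : ∀ ε : ℝ, 0 < ε → ∃ T : Mesh Ω, T.size ≤ ε) :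
    ∃ h₀ : ℝ, 0 < h₀ ∧ ∃ C : ℝ, 0 < C ∧ ∀ T : Mesh Ω, T.IsRegular σ → T.size ≤ h₀ →
      ∀ e : H1 Ω, (∀ v ∈ T.lagrange p, form κ n e v = 0) →
        ‖e.toL2‖ ≤ C * T.size * ‖e‖ ∧ ∀ z : H1 Ω, e - z ∈ T.lagrange p → ‖e‖ ≤ C * ‖z‖ := by
  obtain ⟨M, hM⟩ := exists_form_operator κ hn
  obtain ⟨h₀, hh₀, C, hC, h⟩ := exists_galerkin_constants (H := H1 Ω) (X := L2 Ω)
    (ι := H1.toL2L Ω) (fun ε hε => by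
      obtain ⟨T, hTs⟩ := hT (ε / 3) (by positivity)
      obtain ⟨W, hWf, hW⟩ := T.exists_finiteDimensional_le hΩ.isOpen hΩ.lipschitz hΩ.isBounded
      refine ⟨W, hWf, fun u => ?_⟩
      obtain ⟨s, hs, hle⟩ := hW u
      have h1 : T.size ^ 2 ≤ (ε / 3) ^ 2 := pow_le_pow_left₀ T.size_nonneg hTs 2
      have h2 : ‖u.toL2 - s‖ ≤ ε * ‖u‖ := by
        refine le_of_sq_le_sq (hle.trans ?_) (mul_nonneg hε.le (norm_nonneg _))
        calc 8 * T.size ^ 2 * ‖u‖ ^ 2 ≤ 9 * (ε / 3) ^ 2 * ‖u‖ ^ 2 := by gcongr; norm_num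
          _ = (ε * ‖u‖) ^ 2 := by ring
      exact ⟨s, hs, h2⟩) M (a := form κ n) (fun u v => hM u v)
    (fun u hu => by
      by_contra hne
      exact hNeumann ⟨u, hne, fun v => hu v⟩)
    (I := {T : Mesh Ω // T.IsRegular σ}) (V := fun T => T.1.lagrange p) (h := fun T => T.1.size)
    (fun T => T.1.size_nonneg) (fun S hS => by
      obtain ⟨C, hC, h⟩ := exists_approx_constant hΩ S (fun f => hReg f (S f) fun v => by
        rw [pairing_eq_inner]
        exact hS f v) σ
      refine ⟨C, hC, fun T hT f => ?_⟩
      obtain ⟨v, hv, hle⟩ := h T.1 T.2 hT p hp f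
      exact ⟨v, hv, hle⟩)
  refine ⟨h₀, hh₀, C, hC, fun T hTσ hTs e he => ?_⟩
  obtain ⟨h1, h2⟩ := h ⟨T, hTσ⟩ hTs e fun v hv => he v hv
  exact ⟨h1, fun z hz => h2 z hz⟩

/-- A Galerkin scheme whose `a`-orthogonal errors are quasi-optimal is uniquely solvable, and its
solutions inherit the error bounds. -/
theorem Mesh.quasi_optimality {Ω : Set Plane} (hΩ : IsLipschitzPolygon Ω) {κ : ℂ}
    {n : Plane → ℂ} (hn : MemLp n ⊤ ((volume : Measure Plane).restrict Ω)) (T : Mesh Ω) {p : ℕ}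
    {C : ℝ} (hC : 0 ≤ C)
    (hbounds : ∀ e : H1 Ω, (∀ v ∈ T.lagrange p, form κ n e v = 0) →
      ‖e.toL2‖ ≤ C * T.size * ‖e‖ ∧ ∀ z : H1 Ω, e - z ∈ T.lagrange p → ‖e‖ ≤ C * ‖z‖)
    (g : L2Boundary Ω) :
    (∃! uh : H1 Ω, T.IsDiscreteSolution p κ n g uh) ∧
      ∀ u uh : H1 Ω, IsSourceSolution κ n g u → T.IsDiscreteSolution p κ n g uh →
        ‖u - uh‖ ≤ C * ⨅ v : T.lagrange p, ‖u - (v : H1 Ω)‖ ∧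
        ‖(u - uh).toL2‖ ≤ C * T.size * ‖u - uh‖ := by
  obtain ⟨A, hA⟩ := exists_form_eq_inner κ hn
  have hfd := T.finiteDimensional_lagrange hΩ.isOpen hΩ.lipschitz hΩ.isBounded p
  have hinj : ∀ e ∈ T.lagrange p, (∀ v ∈ T.lagrange p, form κ n e v = 0) → e = 0 := by
    intro e he h0
    have h1 := (hbounds e h0).2 0 (by rwa [sub_zero])
    rw [norm_zero, mul_zero] at h1
    exact norm_le_zero_iff.1 h1
  have hsub : ∀ u w v : H1 Ω, form κ n (u - w) v = form κ n u v - form κ n w v := fun u w v => by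
    rw [← hA, ← hA, ← hA]
    exact (congrArg (inner ℂ v) (map_sub A u w)).trans (inner_sub_right v (A u) (A w))
  obtain ⟨F, hF⟩ := hΩ.exists_restriction T p
  obtain ⟨gh, hgh, hghu⟩ := T.exists_unique_isBoundaryProjection hΩ p g
  have hdisc : ∀ uh, T.IsDiscreteSolution p κ n g uh → uh ∈ T.lagrange p ∧
      ∀ v : T.lagrange p, form κ n uh v = boundaryPairing gh (F v) := by
    rintro uh ⟨huh, g', hg', h⟩
    obtain rfl := hghu g' hg'
    exact ⟨huh, fun v => h v v.2 _ (hF v)⟩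
  refine ⟨?_, fun u uh hu huh => ?_⟩
  · obtain ⟨uh, huh, hsol⟩ := exists_galerkin_solution A (T.lagrange p)
      (fun e he h0 => hinj e he fun v hv => by rw [← hA]; exact h0 v hv) F gh
    refine ⟨uh, ⟨huh, gh, hgh, fun v hv γ hγ => ?_⟩, fun w hw => ?_⟩
    · rw [← hA, hsol ⟨v, hv⟩, boundaryPairing_eq_inner, (hF ⟨v, hv⟩).unique hΩ.isOpen hγ]
    · obtain ⟨hw1, hw2⟩ := hdisc w hw
      refine sub_eq_zero.1 (hinj _ (Submodule.sub_mem _ hw1 huh) fun v hv => ?_)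
      rw [hsub, hw2 ⟨v, hv⟩, ← hA uh, hsol ⟨v, hv⟩, boundaryPairing_eq_inner, sub_self]
  · obtain ⟨huh1, huh2⟩ := hdisc uh huh
    -- Galerkin orthogonality holds because `g - gh` is orthogonal to the boundary space.
    have horth : ∀ v ∈ T.lagrange p, form κ n (u - uh) v = 0 := by
      intro v hv
      have h1 := hgh.2 (F ⟨v, hv⟩) ⟨v, hv, hF ⟨v, hv⟩⟩
      rw [hsub, hu v _ (hF ⟨v, hv⟩).isTrace, huh2 ⟨v, hv⟩]
      rwa [boundaryPairing_eq_inner, inner_sub_right, ← boundaryPairing_eq_inner,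
        ← boundaryPairing_eq_inner] at h1
    obtain ⟨h1, h2⟩ := hbounds _ horth
    refine ⟨?_, h1⟩
    rw [Real.mul_iInf_of_nonneg hC]
    refine le_ciInf fun v => h2 _ ?_
    rw [sub_sub_sub_cancel_left]
    exact Submodule.sub_mem _ v.2 huh1

end Steklov

end

theorem mainTheorem4
    (Ω : Set Steklov.Plane) (hΩ : Steklov.IsLipschitzPolygon Ω)
    (k : ℝ) (hk : 0 < k)
    (n₁ n₂ : Steklov.Plane → ℝ)
    (hn₁ : ContDiffOn ℝ ∞ n₁ Ω) (hn₂ : ContDiffOn ℝ ∞ n₂ Ω)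
    (hn₁_pos : ∀ x ∈ Ω, 0 < n₁ x) (hn₂_nonneg : ∀ x ∈ Ω, 0 ≤ n₂ x)
    (hn₁_bdd : ∃ B : ℝ, ∀ x ∈ Ω, n₁ x ≤ B) (hn₂_bdd : ∃ B : ℝ, ∀ x ∈ Ω, n₂ x ≤ B)
    (hNeumann : ¬ Steklov.IsNeumannEigenvalue Ω (Steklov.refractiveIndex k n₁ n₂) ((k : ℂ) ^ 2))
    (hReg : Steklov.AdjointH2Regular Ω ((k : ℂ) ^ 2) (Steklov.refractiveIndex k n₁ n₂))
    (p : ℕ) (hp : 1 ≤ p) (σ : ℝ) :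
    ∃ h₀ : ℝ, 0 < h₀ ∧ ∃ C : ℝ, 0 < C ∧
      ∀ T : Steklov.Mesh Ω, T.IsRegular σ → T.size ≤ h₀ →
        ∀ g : Steklov.L2Boundary Ω,
          (∃! uh : Steklov.H1 Ω,
            T.IsDiscreteSolution p ((k : ℂ) ^ 2) (Steklov.refractiveIndex k n₁ n₂) g uh) ∧
          ∀ u uh : Steklov.H1 Ω,
            Steklov.IsSourceSolution ((k : ℂ) ^ 2) (Steklov.refractiveIndex k n₁ n₂) g u →
            T.IsDiscreteSolution p ((k : ℂ) ^ 2) (Steklov.refractiveIndex k n₁ n₂) g uh →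
              ‖u - uh‖ ≤ C * ⨅ v : T.lagrange p, ‖u - (v : Steklov.H1 Ω)‖ ∧
              ‖(u - uh).toL2‖ ≤ C * T.size * ‖u - uh‖ := by
  have hn := Steklov.memLp_refractiveIndex (k := k) hΩ.isOpen hn₁ hn₂ hn₁_pos hn₂_nonneg hn₁_bdd
    hn₂_bdd
  -- Compactness is derived from arbitrarily fine meshes; without them no mesh is finer than `h₀`.
  by_cases hT : ∀ ε : ℝ, 0 < ε → ∃ T : Steklov.Mesh Ω, T.size ≤ ε
  · obtain ⟨h₀, hh₀, C, hC, h⟩ := Steklov.exists_error_bounds hΩ hn hNeumann hReg hp σ hT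
    exact ⟨h₀, hh₀, C, hC, fun T hTσ hTs g => T.quasi_optimality hΩ hn hC.le (h T hTσ hTs) g⟩
  · push Not at hT
    obtain ⟨ε, hε, hT⟩ := hT
    exact ⟨ε, hε, 1, one_pos, fun T _ hTs => absurd hTs (hT T).not_ge⟩
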